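/- **Model.** Let $p,d_0,h\ge 0$ be fixed. On a probability space let $w_t\in\mathbb R^p$, $f_t\in\mathbb R^{d_0}$, $\epsilon_t\in\mathbb R$, $\lambda_i\in\mathbb R^{d_0}$, $e_{it}\in\mathbb R$ be random variables, put $z_t=(1,w_t^\top,f_t^\top)^\top$, let $\beta=(\beta_0,\beta_w^\top,\beta_f^\top)^\top\in\mathbb R^{1+p+d_0}$ be fixed, and let $y_{t+h}=1$ if $\beta^\top z_t-\epsilon_{t+h}\ge 0$ and $y_{t+h}=0$ otherwise, and $x_{it}=\lambda_i^\top f_t+e_{it}$. For $N$ units and $T$ periods let $F=(f_1,\dots,f_T)^\top$, $\Lambda=(\lambda_1,\dots,\lambda_N)^\top$, and let $X=F\Lambda^\top+E$ be the $T\times N$ matrix of the $x_{it}$. **Estimators.** Let $V_{NT}$ be the diagonal matrix of the $d_0$ largest eigenvalues of $\frac1{NT}XX^\top$ in descending order, and $\tilde F=(\tilde f_1,\dots,\tilde f_T)^\top$ any $T\times d_0$ matrix with $\frac1{NT}XX^\top\tilde F=\tilde FV_{NT}$ and $\frac1T\tilde F^\top\tilde F=I_{d_0}$. Put $\tilde z_t=(1,w_t^\top,\tilde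 f_t^\top)^\top$ and $l_y(x)=y\log\Phi_\epsilon(x)+(1-y)\log(1-\Phi_\epsilon(x))$, and let $\hat\beta$ be a maximizer over $b\in\mathbb R^{1+p+d_0}$ of $\sum_{t=1}^{T-h}l_{y_{t+h}}(b^\top\tilde z_t)$ (any maximizer if there is one, an arbitrary vector otherwise). Put $H=(\Lambda^\top\Lambda/N)(F^\top\tilde F/T)V_{NT}^{-1}$ and $\tilde H=\mathrm{diag}(I_{p+1},H^{-1})$. **Assumption 1.** For some $\delta>0$ and $M<\infty$: (1) $(w_t,f_t,\epsilon_t)$ is jointly strictly stationary and $\alpha$-mixing with $\sum_{t\ge0}\alpha(t)^{\delta/(4+\delta)}<\infty$, and $\mathbb E\|f_t\|^{4+\delta}\le M$. (2) $\mathbb E\|\lambda_i\|^{4+\delta}\le M$ and $\frac1N\Lambda^\top\Lambda=\Sigma_\lambda+O_P(N^{-1/2})$ with $\Sigma_\lambda$ positive definite. (3) Each series $(e_{it})_t$ is strictly stationary, $\mathbb E e_{it}=0$, $\mathbb E|e_{it}|^{4+\delta}\le M$, $\sum_{i,j=1}^N\sum_{t\ge0}\alpha_{ij}(t)^{\delta/(4+\delta)}=O(N)$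 and $\max_i\sum_{t\ge1}\alpha_{ii}(t)^{\delta/(4+\delta)}=O(1)$, where $\alpha_{ij}(n)$ is the supremum of the strong-mixing coefficients between $\sigma(e_{ir}:r\in I)$ and $\sigma(e_{jr}:r\in J)$ over time intervals $I,J$ with $|s-t|\ge n$ for all $s\in I$, $t\in J$ (so $\alpha_{ij}(0)$ compares the two whole series; $\alpha(n)$ in (1) is the same coefficient of the series $(w_t,f_t,\epsilon_t)$ with itself). (4) $\{w_t,\lambda_i,f_t\}$, $\{e_{it}\}$ and $\{\epsilon_t\}$ are mutually independent. (5) $(1,w_t,f_t)$ is not collinear: $v^\top z_t=0$ almost surely only for $v=0$. **Assumption 2.** (1) The $\epsilon_t$ have the common known density $\phi_\epsilon$ and distribution function $\Phi_\epsilon$. (2) There are intervals $\Xi_T=[\Xi_T^l,\Xi_T^u]$ and $c>0$ such that, with probability tending to $1$ as $T\to\infty$, $\beta^\top z_t\in\Xi_T$ for all $1\le t\le T-h$, and such that $\phi_\epsilon\ge c$ on $\Xi_T$ and $0<\Phi_\epsilon(\Xi_T^l)<\Phi_\epsilon(\Xi_T^u)<1$. (3) $\phi_\epsilon$ is twice continuously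 differentiable on $\Xi_T$, with first and second derivatives bounded uniformly in $T$. (4) $l_0$ and $l_1$ are three times continuously differentiable on $\mathbb R$, with derivatives up to third order bounded on $\Xi_T$ uniformly in $T$, and there are $b_U>b_L>0$ such that, for $y\in\{0,1\}$, $-l_y''\ge b_L$ on every $\Xi_T$ and $-l_y''\le b_U$ on $\mathbb R$. **Theorem.** Under Assumptions 1 and 2, as $N,T\to\infty$ jointly (at arbitrary relative rates), $V_{NT}$ and $H$ are invertible and the likelihood has a maximizer with probability tending to $1$, and $$\|\hat\beta-\tilde H\beta\|=o_P(1).$$ So the coefficients on the intercept and the observed regressors are consistent, and the factor coefficients are consistent up to the rotation $H^{-1}$. -/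

import Mathlib

open MeasureTheory ProbabilityTheory Filter Topology
open scoped ENNReal NNReal Matrix Matrix.Norms.Frobenius

noncomputable section

/-! ### Dependence, stationarity, stochastic orders -/

section Probability

variable {Ω : Type*} [MeasurableSpace Ω]

/-- The strong-mixing coefficient `α(m₁, m₂) = sup |P(A ∩ B) - P(A) P(B)|` over
`A ∈ m₁`, `B ∈ m₂`, of two sub-σ-algebras. -/
def alphaCoeff (μ : Measure Ω) (m₁ m₂ : MeasurableSpace Ω) : ℝ≥0∞ :=
  ⨆ (A : Set Ω) (_ : MeasurableSet[m₁] A) (B : Set Ω) (_ : MeasurableSet[m₂] B),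
    ENNReal.ofReal |μ.real (A ∩ B) - μ.real A * μ.real B|

/-- The σ-algebra generated by the variables `Z r`, `r ∈ I`. -/
abbrev sigmaOn {S : Type*} [MeasurableSpace S] (Z : ℕ → Ω → S) (I : Set ℕ) : MeasurableSpace Ω :=
  ⨆ r ∈ I, MeasurableSpace.comap (Z r) inferInstance

/-- The strong-mixing coefficient at lag `n` of two time series `Y`, `Z`: the supremum of
`α(σ(Y r : r ∈ I), σ(Z r : r ∈ J))` over intervals of times `I`, `J` at distance at least `n`.
For `n ≥ 1` one interval lies in the past of the other, so for `Y = Z` this is the usual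
past/future coefficient of the series; for `n = 0` the intervals are arbitrary, so that
it measures the dependence between the two whole series. -/
def mixCoeff {S S' : Type*} [MeasurableSpace S] [MeasurableSpace S'] (μ : Measure Ω)
    (Y : ℕ → Ω → S) (Z : ℕ → Ω → S') (n : ℕ) : ℝ≥0∞ :=
  ⨆ (I : Set ℕ) (J : Set ℕ) (_ : I.OrdConnected) (_ : J.OrdConnected)
    (_ : ∀ s ∈ I, ∀ t ∈ J, s + n ≤ t ∨ t + n ≤ s), alphaCoeff μ (sigmaOn Y I) (sigmaOn Z J)

/-- Strict stationarity: the law of the path is invariant under time shifts. -/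
def StrictlyStationary {S : Type*} [MeasurableSpace S] (μ : Measure Ω) (Z : ℕ → Ω → S) : Prop :=
  ∀ k : ℕ, μ.map (fun ω (t : ℕ) => Z (t + k) ω) = μ.map (fun ω (t : ℕ) => Z t ω)

/-- `X n = O_P(a n)` as `n → ∞`. -/
def IsBigOP (μ : Measure Ω) (X : ℕ → Ω → ℝ) (a : ℕ → ℝ) : Prop :=
  ∀ η : ℝ, 0 < η → ∃ K : ℝ, ∀ᶠ n in atTop, μ {ω | K * a n < |X n ω|} ≤ ENNReal.ofReal η

end Probability

/-! ### The model -/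

section Model

variable {p d : ℕ}

/-- The coordinates of the coefficient vector: intercept, observed regressors, factors. -/
abbrev Coord (p d : ℕ) : Type := (Unit ⊕ Fin p) ⊕ Fin d

/-- The regressor vector `z = (1, wᵀ, fᵀ)ᵀ`. -/
def regressor (w : EuclideanSpace ℝ (Fin p)) (f : EuclideanSpace ℝ (Fin d)) :
    EuclideanSpace ℝ (Coord p d) :=
  WithLp.toLp 2 (Sum.elim (Sum.elim (fun _ => 1) w) f)

/-- The binary response: `1` if `βᵀz - ε ≥ 0`, and `0` otherwise. -/
def response (β z : EuclideanSpace ℝ (Coord p d)) (ε : ℝ) : ℝ :=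
  open Classical in if 0 ≤ inner ℝ β z - ε then 1 else 0

/-- The `T × d` matrix of factors. -/
def factorMatrix (T : ℕ) (f : ℕ → EuclideanSpace ℝ (Fin d)) : Matrix (Fin T) (Fin d) ℝ :=
  Matrix.of fun t j => f t j

/-- The `N × d` matrix of loadings. -/
def loadingMatrix (N : ℕ) (lam : ℕ → EuclideanSpace ℝ (Fin d)) : Matrix (Fin N) (Fin d) ℝ :=
  Matrix.of fun i j => lam i j

/-- The `T × N` matrix of predictors `X = F Λᵀ + E`, where `E` has the entries `e i t`. -/
def predictorMatrix (N T : ℕ) (f lam : ℕ → EuclideanSpace ℝ (Fin d)) (e : ℕ → ℕ → ℝ) :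
    Matrix (Fin T) (Fin N) ℝ :=
  factorMatrix T f * (loadingMatrix N lam)ᵀ + Matrix.of fun (t : Fin T) (i : Fin N) => e i t

/-! ### Principal components -/

/-- The matrix `X Xᵀ / (N T)`. -/
def pcaMatrix {N T : ℕ} (X : Matrix (Fin T) (Fin N) ℝ) : Matrix (Fin T) (Fin T) ℝ :=
  ((N : ℝ) * (T : ℝ))⁻¹ • (X * Xᵀ)

theorem pcaMatrix_isHermitian {N T : ℕ} (X : Matrix (Fin T) (Fin N) ℝ) :
    (pcaMatrix X).IsHermitian := by
  unfold pcaMatrix Matrix.IsHermitian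
  rw [Matrix.conjTranspose_eq_transpose_of_trivial, Matrix.transpose_smul,
    Matrix.transpose_mul, Matrix.transpose_transpose]

/-- The `d` largest eigenvalues of `X Xᵀ / (N T)` in descending order, with multiplicity
(`eigenvalues₀` is sorted in descending order; the default value occurs only if `T < d`). -/
def pcaEigenvalues {N T : ℕ} (d : ℕ) (X : Matrix (Fin T) (Fin N) ℝ) : Fin d → ℝ := fun j =>
  if hj : j.val < Fintype.card (Fin T) then (pcaMatrix_isHermitian X).eigenvalues₀ ⟨j.val, hj⟩
  else 0

/-- The diagonal matrix `V_{NT}`. -/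
def pcaV {N T : ℕ} (d : ℕ) (X : Matrix (Fin T) (Fin N) ℝ) : Matrix (Fin d) (Fin d) ℝ :=
  Matrix.diagonal (pcaEigenvalues d X)

/-- `Ft` is a PCA factor estimate: `(NT)⁻¹ X Xᵀ Ft = Ft V_{NT}` and `T⁻¹ Ftᵀ Ft = I`. -/
def IsPCAFactor {N T : ℕ} (X : Matrix (Fin T) (Fin N) ℝ) (Ft : Matrix (Fin T) (Fin d) ℝ) : Prop :=
  pcaMatrix X * Ft = Ft * pcaV d X ∧ (T : ℝ)⁻¹ • (Ftᵀ * Ft) = 1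

/-- The rotation `H = (ΛᵀΛ / N) (Fᵀ Ft / T) V⁻¹`. -/
def pcaRotation {N T : ℕ} (Lam : Matrix (Fin N) (Fin d) ℝ) (F Ft : Matrix (Fin T) (Fin d) ℝ)
    (V : Matrix (Fin d) (Fin d) ℝ) : Matrix (Fin d) (Fin d) ℝ :=
  ((N : ℝ)⁻¹ • (Lamᵀ * Lam)) * ((T : ℝ)⁻¹ • (Fᵀ * Ft)) * V⁻¹

/-- `diag(I_{p+1}, H⁻¹)`. -/
def rotationExt (p : ℕ) (H : Matrix (Fin d) (Fin d) ℝ) : Matrix (Coord p d) (Coord p d) ℝ :=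
  Matrix.fromBlocks 1 0 0 H⁻¹

/-! ### Maximum likelihood -/

/-- The log-likelihood contribution `y log Φ(x) + (1 - y) log (1 - Φ(x))`. -/
def logLik (Φ : ℝ → ℝ) (y x : ℝ) : ℝ :=
  y * Real.log (Φ x) + (1 - y) * Real.log (1 - Φ x)

/-- The factor-augmented log-likelihood at `b`: the sum, over the times `t` of the sample for which
`t + h` is in the sample as well, of the contributions of `y (t + h)` at `bᵀ (1, w t, ft t)`. -/
def sampleLogLik (h T : ℕ) (Φ : ℝ → ℝ) (y : ℕ → ℝ) (w : ℕ → EuclideanSpace ℝ (Fin p))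
    (Ft : Matrix (Fin T) (Fin d) ℝ) (b : EuclideanSpace ℝ (Coord p d)) : ℝ :=
  ∑ t : Fin T with t.val + h < T,
    logLik Φ (y (t.val + h)) (inner ℝ b (regressor (w t) (WithLp.toLp 2 (Ft t))))

/-- `b` maximizes the factor-augmented log-likelihood over all of `ℝ^{1+p+d}`. -/
def IsMLE (h T : ℕ) (Φ : ℝ → ℝ) (y : ℕ → ℝ) (w : ℕ → EuclideanSpace ℝ (Fin p))
    (Ft : Matrix (Fin T) (Fin d) ℝ) (b : EuclideanSpace ℝ (Coord p d)) : Prop :=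
  ∀ b' : EuclideanSpace ℝ (Coord p d),
    sampleLogLik h T Φ y w Ft b' ≤ sampleLogLik h T Φ y w Ft b

/-! ### Assumptions -/

/-- Conditions on the regressors, factors, loadings and errors. -/
structure FactorAssumptions {Ω : Type*} [MeasurableSpace Ω] (μ : Measure Ω)
    (w : ℕ → Ω → EuclideanSpace ℝ (Fin p)) (f : ℕ → Ω → EuclideanSpace ℝ (Fin d))
    (eps : ℕ → Ω → ℝ) (lam : ℕ → Ω → EuclideanSpace ℝ (Fin d)) (e : ℕ → ℕ → Ω → ℝ)
    (δ : ℝ) (Sigma : Matrix (Fin d) (Fin d) ℝ) : Prop where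
  measurable_w : ∀ t, Measurable (w t)
  measurable_f : ∀ t, Measurable (f t)
  measurable_eps : ∀ t, Measurable (eps t)
  measurable_lam : ∀ i, Measurable (lam i)
  measurable_e : ∀ i t, Measurable (e i t)
  delta_pos : 0 < δ
  /-- `(w, f, ε)` is jointly strictly stationary -/
  stationary : StrictlyStationary μ fun t ω => (w t ω, f t ω, eps t ω)
  /-- and jointly `α`-mixing with `∑ α(t)^{δ/(4+δ)} < ∞`. -/
  mixing : ∑' t : ℕ, mixCoeff μ (fun t ω => (w t ω, f t ω, eps t ω))
    (fun t ω => (w t ω, f t ω, eps t ω)) t ^ (δ / (4 + δ)) < ∞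
  /-- `E ‖f t‖^{4+δ} ≤ M` -/
  moment_f : ∃ M : ℝ≥0, ∀ t, ∫⁻ ω, ‖f t ω‖ₑ ^ (4 + δ) ∂μ ≤ M
  /-- `E ‖λ i‖^{4+δ} ≤ M` -/
  moment_lam : ∃ M : ℝ≥0, ∀ i, ∫⁻ ω, ‖lam i ω‖ₑ ^ (4 + δ) ∂μ ≤ M
  /-- `ΛᵀΛ / N = Σ_λ + O_P(N^{-1/2})` with `Σ_λ` positive definite -/
  sigma_posDef : Sigma.PosDef
  loadings : IsBigOP μ
    (fun N ω => ‖(N : ℝ)⁻¹ • ((loadingMatrix N fun i => lam i ω)ᵀ *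
      loadingMatrix N fun i => lam i ω) - Sigma‖)
    (fun N => 1 / Real.sqrt N)
  /-- each error series is strictly stationary, -/
  stationary_e : ∀ i, StrictlyStationary μ (e i)
  /-- `∑_{i,j ≤ N} ∑_{t ≥ 0} α_{ij}(t)^{δ/(4+δ)} = O(N)`, -/
  mixing_e : ∃ C : ℝ≥0, ∀ N : ℕ, ∑ i ∈ Finset.range N, ∑ j ∈ Finset.range N,
    ∑' t : ℕ, mixCoeff μ (e i) (e j) t ^ (δ / (4 + δ)) ≤ C * N
  /-- `max_i ∑_{t ≥ 1} α_{ii}(t)^{δ/(4+δ)} = O(1)`, -/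
  mixing_e_diag : ∃ C : ℝ≥0, ∀ i : ℕ,
    ∑' t : ℕ, mixCoeff μ (e i) (e i) (t + 1) ^ (δ / (4 + δ)) ≤ C
  /-- `E |e i t|^{4+δ} ≤ M`, -/
  moment_e : ∃ M : ℝ≥0, ∀ i t, ∫⁻ ω, ‖e i t ω‖ₑ ^ (4 + δ) ∂μ ≤ M
  /-- and the errors are centred. -/
  mean_e : ∀ i t, ∫ ω, e i t ω ∂μ = 0
  /-- `{w, λ, f}`, `{e}` and `{ε}` are mutually independent. -/
  indep : iIndep ![sigmaOn w Set.univ ⊔ sigmaOn lam Set.univ ⊔ sigmaOn f Set.univ,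
    ⨆ i, sigmaOn (e i) Set.univ, sigmaOn eps Set.univ] μ

/-- Conditions on the response equation, with error density `φ`, error distribution function `Φ`
and the intervals `Ξ_T = [Ξl T, Ξu T]`. -/
structure LikelihoodAssumptions {Ω : Type*} [MeasurableSpace Ω] (μ : Measure Ω) (h : ℕ)
    (β : EuclideanSpace ℝ (Coord p d))
    (w : ℕ → Ω → EuclideanSpace ℝ (Fin p)) (f : ℕ → Ω → EuclideanSpace ℝ (Fin d))
    (eps : ℕ → Ω → ℝ) (φ Φ : ℝ → ℝ) (Ξl Ξu : ℕ → ℝ) : Prop where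
  /-- the `ε t` have the common density `φ` and distribution function `Φ` -/
  measurable_pdf : Measurable φ
  pdf_nonneg : ∀ x, 0 ≤ φ x
  pdf : ∀ t, μ.map (eps t) = (volume : Measure ℝ).withDensity fun x => ENNReal.ofReal (φ x)
  cdf : ∀ t x, Φ x = μ.real {ω | eps t ω ≤ x}
  /-- all `βᵀ z t` lie in `Ξ_T` with probability approaching one -/
  support : Tendsto (fun T : ℕ => μ {ω | ∀ t : ℕ, t + h < T →
    inner ℝ β (regressor (w t ω) (f t ω)) ∈ Set.Icc (Ξl T) (Ξu T)}) atTop (𝓝 1)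
  pdf_lower : ∃ c : ℝ, 0 < c ∧ ∀ T, ∀ x ∈ Set.Icc (Ξl T) (Ξu T), c ≤ φ x
  cdf_Ξ : ∀ T, 0 < Φ (Ξl T) ∧ Φ (Ξl T) < Φ (Ξu T) ∧ Φ (Ξu T) < 1
  /-- `φ` is twice continuously differentiable on `Ξ_T` with uniformly bounded derivatives -/
  pdf_smooth : ∀ T, ContDiffOn ℝ 2 φ (Set.Icc (Ξl T) (Ξu T))
  pdf_deriv_bdd : ∃ M : ℝ, ∀ T, ∀ x ∈ Set.Icc (Ξl T) (Ξu T),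
    |iteratedDerivWithin 1 φ (Set.Icc (Ξl T) (Ξu T)) x| ≤ M ∧
    |iteratedDerivWithin 2 φ (Set.Icc (Ξl T) (Ξu T)) x| ≤ M
  /-- the log-likelihood contributions are three times continuously differentiable, with
  uniformly bounded derivatives up to the third order on `Ξ_T` -/
  logLik_smooth : ∀ y : ℝ, y = 0 ∨ y = 1 → ContDiff ℝ 3 (logLik Φ y)
  logLik_deriv_bdd : ∃ M : ℝ, ∀ y : ℝ, y = 0 ∨ y = 1 → ∀ T, ∀ x ∈ Set.Icc (Ξl T) (Ξu T),
    ∀ k ∈ Finset.Icc 1 3, |iteratedDeriv k (logLik Φ y) x| ≤ M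
  /-- their curvature is at least `b_L > 0` on `Ξ_T` and at most `b_U` everywhere (no distribution
  function satisfies the lower bound on the whole line) -/
  curvature : ∃ bL bU : ℝ, 0 < bL ∧ bL < bU ∧ ∀ y : ℝ, y = 0 ∨ y = 1 →
    (∀ T, ∀ x ∈ Set.Icc (Ξl T) (Ξu T), bL ≤ -iteratedDeriv 2 (logLik Φ y) x) ∧
    (∀ x : ℝ, -iteratedDeriv 2 (logLik Φ y) x ≤ bU)

end Model

end

/-!
The argument is Wald's: a global separation of the likelihood, with no rates and no expansion in the
parameter, so that the relative rates of `N` and `T` never matter.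

*Reparametrization.* Evaluated at the coefficient vector `diag(I, H⁻¹) γ`, the likelihood with the
estimated factors is the likelihood at `γ` with the true regressors `z t` replaced by `z t + u t`,
where `u t` is the error of the estimated factors after rotating them back by `H⁻¹`
(`sampleLogLik_rotationExt`). It therefore suffices to show that the likelihood at `γ` falls short
of its value at `β` by a multiple of `T`, uniformly over `‖γ - β‖ ≥ η` and over all perturbations
with `∑ ‖u t‖²` small compared to `T`, while perturbing the regressors at `γ = β` itself costs only
a small multiple of `T` (`mle_close_of_separation`). The second point is a Taylor expansion of order
two at the true indices, using the first derivative on `Ξ_T` and the global bound on the curvature.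
Existence of a maximizer is part of the conclusion: outside a compact set the likelihood is smaller
than at the rotated `β`.

*Separation* (`UniformlyWorse.compl_ball`). Since `log r ≤ 2 (√r - 1)`, the mean log-likelihood
ratio is negative as soon as the Hellinger affinity of the two Bernoulli laws is below one on
average, which is identification; an envelope over a small neighbourhood and a small perturbation
has negative mean by dominated convergence, the dominating function `1 / P(outcome)` being
integrable with mean two. Large perturbations occur rarely and are paid for by `C ∑ ‖u t‖²`, because
the log-likelihood is at most zero. At infinity, along the ray of a direction `v`, the outcome
contradicts the sign of `vᵀz` with positive probability, since the errors have full support and the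
regressors are not collinear, and the likelihood of such outcomes tends to zero. Compactness of a
large ball and of the unit sphere gives uniformity. The regularity assumptions enter here through
two facts: `log Φ` and `log (1 - Φ)` are continuous on the line, which under the convention
`log 0 = 0` forces `0 < Φ < 1` everywhere; and the curvature on `Ξ_T` makes `Φ` non-constant on
every interval with an endpoint in `Ξ_T`, which together with non-collinearity identifies `β`.

*Law of large numbers* (`WeaklyMixing.tendsto_measure`). Only `α(t) → 0` is used: indicator
functions are handled by their covariances, and integrable functions by approximation in `L¹` with
simple ones.

*Factors* (`pca_consistency`, `tendsto_measure_norm_errorGram`). In the Frobenius norm,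
`X Xᵀ / (N T)` differs from its common part `F (ΛᵀΛ / N) Fᵀ / T` by a matrix of small norm if
`‖E Eᵀ‖` is small compared to `N T`. The latter follows by truncating the errors at a level `K`: the
truncated and centred part is bounded and its Gram matrix has a second moment controlled by the sums
of the mixing coefficients, and the remainder has variance of order `1 / K²` uniformly. The `d`
largest eigenvalues of `X Xᵀ / (N T)` are bounded below by the Courant–Fischer principle on the
column space of `F`, and the eigenvector equation, divided by them, is an explicit formula for
`Ft - F H`. No separation of the eigenvalues is needed.
-/

/-! ### Mixing coefficients and the covariance inequality -/

section Mixing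

variable {Ω : Type*} {m m₁ m₂ : MeasurableSpace Ω} {mΩ : MeasurableSpace Ω} {μ : Measure Ω}
  [IsProbabilityMeasure μ]

theorem abs_cov_sets_le_one (A B : Set Ω) : |μ.real (A ∩ B) - μ.real A * μ.real B| ≤ 1 := by
  have h1 : μ.real (A ∩ B) ≤ 1 := measureReal_le_one
  have h2 : 0 ≤ μ.real (A ∩ B) := measureReal_nonneg
  have h3 : μ.real A ≤ 1 := measureReal_le_one
  have h4 : 0 ≤ μ.real A := measureReal_nonneg
  have h5 : μ.real B ≤ 1 := measureReal_le_one
  have h6 : 0 ≤ μ.real B := measureReal_nonneg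
  rw [abs_le]
  constructor <;> nlinarith

theorem alphaCoeff_le_one : alphaCoeff μ m₁ m₂ ≤ 1 := by
  unfold alphaCoeff
  refine iSup₂_le fun A _ => iSup₂_le fun B _ => ?_
  exact ENNReal.ofReal_le_one.2 (abs_cov_sets_le_one A B)

theorem alphaCoeff_ne_top : alphaCoeff μ m₁ m₂ ≠ ∞ :=
  (alphaCoeff_le_one.trans_lt ENNReal.one_lt_top).ne

theorem abs_cov_sets_le_alphaCoeff {A B : Set Ω}
    (hA : MeasurableSet[m₁] A) (hB : MeasurableSet[m₂] B) :
    |μ.real (A ∩ B) - μ.real A * μ.real B| ≤ (alphaCoeff μ m₁ m₂).toReal := by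
  rw [← ENNReal.ofReal_le_iff_le_toReal alphaCoeff_ne_top]
  unfold alphaCoeff
  exact le_iSup₂_of_le A hA (le_iSup₂_of_le B hB le_rfl)

theorem mixCoeff_le_one {S S' : Type*} [MeasurableSpace S] [MeasurableSpace S']
    (Y : ℕ → Ω → S) (Z : ℕ → Ω → S') (n : ℕ) : mixCoeff μ Y Z n ≤ 1 := by
  unfold mixCoeff
  exact iSup₂_le fun I J => iSup₂_le fun _ _ => iSup_le fun _ => alphaCoeff_le_one

theorem mixCoeff_ne_top {S S' : Type*} [MeasurableSpace S] [MeasurableSpace S']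
    (Y : ℕ → Ω → S) (Z : ℕ → Ω → S') (n : ℕ) : mixCoeff μ Y Z n ≠ ∞ :=
  ((mixCoeff_le_one Y Z n).trans_lt ENNReal.one_lt_top).ne

theorem alphaCoeff_toReal_le_mixCoeff {S S' : Type*} [MeasurableSpace S] [MeasurableSpace S']
    (Y : ℕ → Ω → S) (Z : ℕ → Ω → S') {n : ℕ} {I J : Set ℕ} (hI : I.OrdConnected)
    (hJ : J.OrdConnected) (hIJ : ∀ s ∈ I, ∀ t ∈ J, s + n ≤ t ∨ t + n ≤ s) :
    (alphaCoeff μ (sigmaOn Y I) (sigmaOn Z J)).toReal ≤ (mixCoeff μ Y Z n).toReal := by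
  refine ENNReal.toReal_mono (mixCoeff_ne_top Y Z n) ?_
  unfold mixCoeff
  exact le_iSup₂_of_le I J (le_iSup₂_of_le hI hJ (le_iSup_of_le hIJ le_rfl))

theorem measurable_sigmaOn {S : Type*} [MeasurableSpace S] (Z : ℕ → Ω → S) {I : Set ℕ} {r : ℕ}
    (hr : r ∈ I) : Measurable[sigmaOn Z I] (Z r) := by
  rw [measurable_iff_comap_le]
  exact le_iSup₂_of_le r hr le_rfl

theorem sigmaOn_le {S : Type*} [MeasurableSpace S] {Z : ℕ → Ω → S} (hZ : ∀ r, Measurable (Z r))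
    (I : Set ℕ) : sigmaOn Z I ≤ mΩ :=
  iSup₂_le fun r _ => (hZ r).comap_le

/-- In a covariance, a bounded variable may be replaced by a random sign that is measurable with
respect to the same σ-algebra: the sign of the conditional expectation of the other variable. -/
theorem exists_sign_abs_cov_le (hm : m ≤ mΩ) {X Y : Ω → ℝ} {C : ℝ}
    (hX : Measurable[m] X) (hXC : ∀ ω, |X ω| ≤ C) (hY : Integrable Y μ) :
    ∃ A, MeasurableSet[m] A ∧ |∫ ω, X ω * Y ω ∂μ - (∫ ω, X ω ∂μ) * ∫ ω, Y ω ∂μ| ≤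
      C * |∫ ω, (A.indicator (fun _ => (2 : ℝ)) ω - 1) * Y ω ∂μ -
        (∫ ω, (A.indicator (fun _ => (2 : ℝ)) ω - 1) ∂μ) * ∫ ω, Y ω ∂μ| := by
  set Y0 : Ω → ℝ := fun ω => Y ω - ∫ ω, Y ω ∂μ with hY0
  have hY0i : Integrable Y0 μ := hY.sub (integrable_const _)
  set g : Ω → ℝ := μ[Y0 | m] with hg
  have hgm : StronglyMeasurable[m] g := stronglyMeasurable_condExp
  have hgi : Integrable g μ := integrable_condExp
  -- the covariance with a bounded `m`-measurable variable only sees `g`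
  have key : ∀ Z : Ω → ℝ, Measurable[m] Z → ∀ K : ℝ, (∀ ω, |Z ω| ≤ K) →
      ∫ ω, Z ω * Y ω ∂μ - (∫ ω, Z ω ∂μ) * ∫ ω, Y ω ∂μ = ∫ ω, Z ω * g ω ∂μ := by
    intro Z hZ K hK
    have hZi : Integrable Z μ := by
      refine Integrable.of_bound (hZ.mono hm le_rfl).aestronglyMeasurable K ?_
      exact ae_of_all _ fun ω => by simpa using hK ω
    have hb : ∀ W : Ω → ℝ, Integrable W μ → Integrable (fun ω => Z ω * W ω) μ := fun W hW =>
      hW.bdd_mul (hZ.mono hm le_rfl).aestronglyMeasurable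
        (ae_of_all _ fun ω => by simpa using hK ω)
    have h1 : ∫ ω, Z ω * g ω ∂μ = ∫ ω, Z ω * Y0 ω ∂μ := by
      have := condExp_mul_of_stronglyMeasurable_left (μ := μ) (m := m) (f := Z) (g := Y0)
        hZ.stronglyMeasurable (hb Y0 hY0i) hY0i
      calc ∫ ω, Z ω * g ω ∂μ = ∫ ω, (μ[Z * Y0 | m]) ω ∂μ :=
            integral_congr_ae (this.mono fun ω h => h.symm)
        _ = ∫ ω, Z ω * Y0 ω ∂μ := integral_condExp hm
    rw [h1]
    simp only [hY0, mul_sub]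
    rw [integral_sub (hb Y hY) (hZi.mul_const _), integral_mul_const]
  set A : Set Ω := {ω | 0 ≤ g ω} with hAdef
  have hA : MeasurableSet[m] A := hgm.measurable measurableSet_Ici
  refine ⟨A, hA, ?_⟩
  rw [key X hX C hXC]
  have hs : Measurable[m] fun ω => A.indicator (fun _ => (2 : ℝ)) ω - 1 :=
    (measurable_const.indicator hA).sub measurable_const
  rw [key _ hs 1 (fun ω => by
    by_cases h : ω ∈ A <;> simp [h]
    norm_num)]
  have habs : ∀ ω, (A.indicator (fun _ => (2 : ℝ)) ω - 1) * g ω = |g ω| := by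
    intro ω
    by_cases h : ω ∈ A
    · have h0 : 0 ≤ g ω := h
      rw [Set.indicator_of_mem h, abs_of_nonneg h0]; ring
    · have h0 : g ω < 0 := not_le.1 h
      rw [Set.indicator_of_notMem h, abs_of_neg h0]; ring
  simp only [habs]
  have h0 : 0 ≤ ∫ ω, |g ω| ∂μ := integral_nonneg fun ω => abs_nonneg (g ω)
  rw [abs_of_nonneg h0, ← integral_const_mul]
  refine (abs_integral_le_integral_abs (f := fun ω => X ω * g ω)).trans
    (integral_mono_of_nonneg ?_ (hgi.abs.const_mul C) ?_)
  · exact ae_of_all _ fun ω => abs_nonneg (X ω * g ω)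
  · exact ae_of_all _ fun ω => by
      simp only [abs_mul]
      exact mul_le_mul_of_nonneg_right (hXC ω) (abs_nonneg _)

/-- The covariance inequality for bounded variables and the strong-mixing coefficient. -/
theorem abs_cov_le_alphaCoeff (hm₁ : m₁ ≤ mΩ) (hm₂ : m₂ ≤ mΩ)
    {X Y : Ω → ℝ} {C D : ℝ} (hX : Measurable[m₁] X) (hXC : ∀ ω, |X ω| ≤ C)
    (hY : Measurable[m₂] Y) (hYD : ∀ ω, |Y ω| ≤ D) :
    |∫ ω, X ω * Y ω ∂μ - (∫ ω, X ω ∂μ) * ∫ ω, Y ω ∂μ| ≤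
      4 * C * D * (alphaCoeff μ m₁ m₂).toReal := by
  obtain ⟨ω₀⟩ : Nonempty Ω := nonempty_of_isProbabilityMeasure μ
  have hC : 0 ≤ C := (abs_nonneg _).trans (hXC ω₀)
  have hD : 0 ≤ D := (abs_nonneg _).trans (hYD ω₀)
  have hYi : Integrable Y μ :=
    Integrable.of_bound (hY.mono hm₂ le_rfl).aestronglyMeasurable D
      (ae_of_all _ fun ω => by simpa using hYD ω)
  obtain ⟨A, hA, h1⟩ := exists_sign_abs_cov_le hm₁ hX hXC hYi
  have hA' : MeasurableSet A := hm₁ _ hA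
  have hIi : ∀ {S : Set Ω}, MeasurableSet S →
      Integrable (fun ω => S.indicator (fun _ => (2 : ℝ)) ω - 1) μ := fun hS =>
    ((integrable_const (2 : ℝ)).indicator hS).sub (integrable_const 1)
  obtain ⟨B, hB, h2⟩ := exists_sign_abs_cov_le hm₂ hY hYD (hIi hA')
  have hB' : MeasurableSet B := hm₂ _ hB
  have e1 : ∀ {S : Set Ω}, MeasurableSet S →
      ∫ ω, (S.indicator (fun _ => (2 : ℝ)) ω - 1) ∂μ = 2 * μ.real S - 1 := fun hS => by
    rw [integral_sub ((integrable_const (2 : ℝ)).indicator hS) (integrable_const _),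
      integral_indicator_const _ hS]
    simp [mul_comm]
  have e2 : ∫ ω, (B.indicator (fun _ => (2 : ℝ)) ω - 1) *
      (A.indicator (fun _ => (2 : ℝ)) ω - 1) ∂μ
      = 4 * μ.real (A ∩ B) - 2 * μ.real A - 2 * μ.real B + 1 := by
    have : ∀ ω, (B.indicator (fun _ => (2 : ℝ)) ω - 1) * (A.indicator (fun _ => (2 : ℝ)) ω - 1)
        = (A ∩ B).indicator (fun _ => (4 : ℝ)) ω - A.indicator (fun _ => (2 : ℝ)) ω
          - B.indicator (fun _ => (2 : ℝ)) ω + 1 := by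
      intro ω
      by_cases ha : ω ∈ A <;> by_cases hb : ω ∈ B <;> simp [ha, hb] <;> norm_num
    simp only [this]
    have i1 := (integrable_const (μ := μ) (4 : ℝ)).indicator (hA'.inter hB')
    have i2 := (integrable_const (μ := μ) (2 : ℝ)).indicator hA'
    have i3 := (integrable_const (μ := μ) (2 : ℝ)).indicator hB'
    have i4 : Integrable (fun ω => (A ∩ B).indicator (fun _ => (4 : ℝ)) ω -
      A.indicator (fun _ => (2 : ℝ)) ω) μ := i1.sub i2
    have i5 : Integrable (fun ω => (A ∩ B).indicator (fun _ => (4 : ℝ)) ω -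
      A.indicator (fun _ => (2 : ℝ)) ω - B.indicator (fun _ => (2 : ℝ)) ω) μ := i4.sub i3
    rw [integral_add i5 (integrable_const _), integral_sub i4 i3,
      integral_sub i1 i2, integral_indicator_const _ (hA'.inter hB'),
      integral_indicator_const _ hA', integral_indicator_const _ hB']
    simp [mul_comm]
  have h3 := abs_cov_sets_le_alphaCoeff (μ := μ) hA hB
  rw [e1 hA', e1 hB', e2] at h2
  have e3 : 4 * μ.real (A ∩ B) - 2 * μ.real A - 2 * μ.real B + 1 -
      (2 * μ.real B - 1) * (2 * μ.real A - 1)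
      = 4 * (μ.real (A ∩ B) - μ.real A * μ.real B) := by ring
  rw [e3, abs_mul, abs_of_pos (by norm_num : (0 : ℝ) < 4)] at h2
  rw [e1 hA'] at h1
  have e4 : ∫ ω, (A.indicator (fun _ => (2 : ℝ)) ω - 1) * Y ω ∂μ
      = ∫ ω, Y ω * (A.indicator (fun _ => (2 : ℝ)) ω - 1) ∂μ := by simp only [mul_comm]
  rw [e4, mul_comm (2 * μ.real A - 1)] at h1
  calc _ ≤ _ := h1
    _ ≤ C * (D * (4 * (alphaCoeff μ m₁ m₂).toReal)) :=
        mul_le_mul_of_nonneg_left (h2.trans (by gcongr)) hC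
    _ = _ := by ring

/-- Summing a nonnegative function of the lag. -/
theorem sum_dist_le (a : ℕ → ℝ) (ha : ∀ n, 0 ≤ a n) (n : ℕ) {s : ℕ} (hs : s < n) :
    ∑ t ∈ Finset.range n, a (Nat.dist s t) ≤ 2 * ∑ k ∈ Finset.range n, a k := by
  classical
  rw [← Finset.sum_filter_add_sum_filter_not _ (fun t => t ≤ s), two_mul]
  have aux : ∀ F : Finset ℕ, (∀ t ∈ F, t < n) → Set.InjOn (Nat.dist s) F →
      ∑ t ∈ F, a (Nat.dist s t) ≤ ∑ k ∈ Finset.range n, a k := by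
    intro F hF hinj
    rw [← Finset.sum_image (f := a) hinj]
    refine Finset.sum_le_sum_of_subset_of_nonneg ?_ fun _ _ _ => ha _
    intro k hk
    obtain ⟨t, ht, rfl⟩ := Finset.mem_image.1 hk
    have := hF t ht
    simp only [Finset.mem_range, Nat.dist]
    omega
  refine add_le_add (aux _ ?_ ?_) (aux _ ?_ ?_)
  · intro t ht; simp at ht; omega
  · intro t ht t' ht' h
    simp [Nat.dist] at ht ht' h; omega
  · intro t ht; simp at ht; omega
  · intro t ht t' ht' h
    simp [Nat.dist] at ht ht' h; omega

end Mixing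

/-! ### The law of large numbers -/

section LLN

variable {Ω S : Type*} [MeasurableSpace Ω] [MeasurableSpace S] {μ : Measure Ω}

/-- The average of `g (ξ 0), …, g (ξ (n - 1))`. -/
noncomputable def timeAverage (ξ : ℕ → Ω → S) (g : S → ℝ) (n : ℕ) (ω : Ω) : ℝ :=
  (n : ℝ)⁻¹ * ∑ t ∈ Finset.range n, g (ξ t ω)

/-- A sequence of identically distributed variables with law `ν` such that events at lag `n` have
covariance at most `a n`, where `a n → 0`. -/
structure WeaklyMixing (μ : Measure Ω) (ν : Measure S) (ξ : ℕ → Ω → S) : Prop where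
  measurable : ∀ t, Measurable (ξ t)
  map_eq : ∀ t, μ.map (ξ t) = ν
  mixing : ∃ a : ℕ → ℝ, (∀ n, 0 ≤ a n) ∧ Tendsto a atTop (𝓝 0) ∧
    ∀ A, MeasurableSet A → ∀ s n,
      μ.real (ξ s ⁻¹' A ∩ ξ (s + n) ⁻¹' A) - ν.real A * ν.real A ≤ a n

variable {ν : Measure S} {ξ : ℕ → Ω → S}

theorem WeaklyMixing.integral_comp (hξ : WeaklyMixing μ ν ξ) (t : ℕ) {g : S → ℝ}
    (hg : AEStronglyMeasurable g ν) : ∫ ω, g (ξ t ω) ∂μ = ∫ x, g x ∂ν := by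
  rw [← hξ.map_eq t] at hg ⊢
  exact (integral_map (hξ.measurable t).aemeasurable hg).symm

theorem WeaklyMixing.integrable_comp (hξ : WeaklyMixing μ ν ξ) (t : ℕ) {g : S → ℝ}
    (hg : Integrable g ν) : Integrable (fun ω => g (ξ t ω)) μ := by
  rw [← hξ.map_eq t] at hg
  exact hg.comp_measurable (hξ.measurable t)

theorem WeaklyMixing.integrable_timeAverage (hξ : WeaklyMixing μ ν ξ) {g : S → ℝ}
    (hg : Integrable g ν) (n : ℕ) : Integrable (timeAverage ξ g n) μ :=
  (integrable_finsetSum _ fun t _ => hξ.integrable_comp t hg).const_mul _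

theorem WeaklyMixing.integral_abs_timeAverage_le (hξ : WeaklyMixing μ ν ξ) {g : S → ℝ}
    (hg : Integrable g ν) (n : ℕ) : ∫ ω, |timeAverage ξ g n ω| ∂μ ≤ ∫ x, |g x| ∂ν := by
  have h1 : ∀ ω, |timeAverage ξ g n ω| ≤ (n : ℝ)⁻¹ * ∑ t ∈ Finset.range n, |g (ξ t ω)| := by
    intro ω
    unfold timeAverage
    rw [abs_mul, abs_of_nonneg (by positivity : (0 : ℝ) ≤ (n : ℝ)⁻¹)]
    exact mul_le_mul_of_nonneg_left (Finset.abs_sum_le_sum_abs _ _) (by positivity)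
  have hi : ∀ t, Integrable (fun ω => |g (ξ t ω)|) μ := fun t => (hξ.integrable_comp t hg).abs
  refine (integral_mono (hξ.integrable_timeAverage hg n).abs
    ((integrable_finsetSum _ fun t _ => hi t).const_mul _) h1).trans ?_
  rw [integral_const_mul, integral_finsetSum _ fun t _ => hi t]
  have h2 : ∀ t, ∫ ω, |g (ξ t ω)| ∂μ = ∫ x, |g x| ∂ν := fun t =>
    hξ.integral_comp t (g := fun x => |g x|) hg.abs.aestronglyMeasurable
  simp only [h2, Finset.sum_const, Finset.card_range, nsmul_eq_mul]
  rcases Nat.eq_zero_or_pos n with rfl | hn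
  · simp only [CharP.cast_eq_zero, inv_zero, zero_mul]
    exact integral_nonneg fun _ => abs_nonneg _
  · rw [inv_mul_cancel_left₀ (by positivity)]

variable [IsProbabilityMeasure μ]

/-- The law of large numbers for indicators, from the variance of the time average. -/
theorem WeaklyMixing.tendsto_integral_abs_indicator (hξ : WeaklyMixing μ ν ξ) {A : Set S}
    (hA : MeasurableSet A) :
    Tendsto (fun n => ∫ ω, |timeAverage ξ (A.indicator fun _ => (1 : ℝ)) n ω - ν.real A| ∂μ)
      atTop (𝓝 0) := by
  obtain ⟨a, ha0, ha, hmix⟩ := hξ.mixing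
  have hνp : IsProbabilityMeasure ν := by
    rw [← hξ.map_eq 0]; exact Measure.isProbabilityMeasure_map (hξ.measurable 0).aemeasurable
  set I : S → ℝ := A.indicator fun _ => (1 : ℝ) with hI
  have hIi : Integrable I ν := (integrable_const _).indicator hA
  have hev : ∀ t ω, I (ξ t ω) = (ξ t ⁻¹' A).indicator (fun _ => (1 : ℝ)) ω := fun t ω => rfl
  have hIb : ∀ x, |I x| ≤ 1 := fun x => by by_cases h : x ∈ A <;> simp [hI, h]
  set p := ν.real A with hp
  set D : ℕ → Ω → ℝ := fun t ω => I (ξ t ω) - p with hD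
  have hp1 : p ≤ 1 := measureReal_le_one
  have hp0 : 0 ≤ p := measureReal_nonneg
  have hDi : ∀ t, Integrable (D t) μ := fun t => (hξ.integrable_comp t hIi).sub (integrable_const _)
  have hDb : ∀ t ω, |D t ω| ≤ 2 := fun t ω => by
    have := hIb (ξ t ω)
    simp only [hD]
    rw [abs_le] at this ⊢
    constructor <;> linarith [this.1, this.2]
  have hDDi : ∀ s t, Integrable (fun ω => D s ω * D t ω) μ := fun s t =>
    (hDi t).bdd_mul (hDi s).aestronglyMeasurable (ae_of_all _ fun ω => by simpa using hDb s ω)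
  have hIIi : ∀ s t, Integrable (fun ω => I (ξ s ω) * I (ξ t ω)) μ := fun s t =>
    (hξ.integrable_comp t hIi).bdd_mul (hξ.integrable_comp s hIi).aestronglyMeasurable
      (ae_of_all _ fun ω => by simpa using hIb (ξ s ω))
  have hEI : ∀ t, ∫ ω, I (ξ t ω) ∂μ = p := fun t => by
    rw [hξ.integral_comp t hIi.aestronglyMeasurable, hI, integral_indicator_const _ hA]
    simp [hp]
  have hcov : ∀ s t, ∫ ω, D s ω * D t ω ∂μ =
      μ.real (ξ s ⁻¹' A ∩ ξ t ⁻¹' A) - p * p := by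
    intro s t
    have e : ∀ ω, D s ω * D t ω = I (ξ s ω) * I (ξ t ω) - (p * I (ξ s ω) + p * I (ξ t ω) - p * p) :=
      fun ω => by simp only [hD]; ring
    have e' : ∀ ω, I (ξ s ω) * I (ξ t ω) =
        (ξ s ⁻¹' A ∩ ξ t ⁻¹' A).indicator (fun _ => (1 : ℝ)) ω := fun ω => by
      rw [hev, hev]
      by_cases h : ω ∈ ξ s ⁻¹' A <;> by_cases h' : ω ∈ ξ t ⁻¹' A <;> simp [h, h']
    have j1 := (hξ.integrable_comp s hIi).const_mul p
    have j2 := (hξ.integrable_comp t hIi).const_mul p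
    have j3 : Integrable (fun ω => p * I (ξ s ω) + p * I (ξ t ω)) μ := j1.add j2
    have j4 : Integrable (fun ω => p * I (ξ s ω) + p * I (ξ t ω) - p * p) μ :=
      j3.sub (integrable_const _)
    simp only [e]
    rw [integral_sub (hIIi s t) j4, integral_sub j3 (integrable_const _), integral_add j1 j2,
      integral_const_mul,
      integral_const_mul, hEI, hEI]
    simp only [e']
    rw [integral_indicator_const _ ((hξ.measurable s hA).inter (hξ.measurable t hA))]
    simp
  have hcov' : ∀ s t, ∫ ω, D s ω * D t ω ∂μ ≤ a (Nat.dist s t) := by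
    intro s t
    rw [hcov]
    rcases le_total s t with h | h
    · have := hmix A hA s (t - s)
      rw [Nat.add_sub_cancel' h] at this
      rwa [Nat.dist_eq_sub_of_le h]
    · have := hmix A hA t (s - t)
      rw [Nat.add_sub_cancel' h] at this
      rwa [Nat.dist_eq_sub_of_le_right h, Set.inter_comm]
  -- the variance of the average
  have hvar : ∀ n : ℕ, 0 < n → (∫ ω, |timeAverage ξ I n ω - p| ∂μ) ^ 2 ≤
      2 * ((n : ℝ)⁻¹ * ∑ k ∈ Finset.range n, a k) := by
    intro n hn
    have hn' : (0 : ℝ) < n := by exact_mod_cast hn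
    have e1 : ∀ ω, timeAverage ξ I n ω - p = (n : ℝ)⁻¹ * ∑ t ∈ Finset.range n, D t ω := by
      intro ω
      simp only [timeAverage, hD, Finset.sum_sub_distrib, Finset.sum_const, Finset.card_range,
        nsmul_eq_mul, mul_sub]
      rw [inv_mul_cancel_left₀ hn'.ne']
    have e2 : ∀ ω, |timeAverage ξ I n ω - p| ^ 2 =
        (n : ℝ)⁻¹ ^ 2 * ∑ s ∈ Finset.range n, ∑ t ∈ Finset.range n, D s ω * D t ω := by
      intro ω
      rw [sq_abs, e1, mul_pow, sq (∑ t ∈ Finset.range n, D t ω), Finset.sum_mul_sum]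
    have i2 : Integrable (fun ω => |timeAverage ξ I n ω - p| ^ 2) μ := by
      simp only [e2]
      exact (integrable_finsetSum _ fun s _ => integrable_finsetSum _ fun t _ =>
        hDDi s t).const_mul _
    have i1 : Integrable (fun ω => |timeAverage ξ I n ω - p|) μ :=
      ((hξ.integrable_timeAverage hIi n).sub (integrable_const p)).abs
    have hj : (∫ ω, |timeAverage ξ I n ω - p| ∂μ) ^ 2 ≤
        ∫ ω, |timeAverage ξ I n ω - p| ^ 2 ∂μ := by
      -- `E (|Y| - E |Y|)² ≥ 0`
      set m := ∫ ω, |timeAverage ξ I n ω - p| ∂μ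
      have h0 : 0 ≤ ∫ ω, (|timeAverage ξ I n ω - p| ^ 2 -
          (2 * m * |timeAverage ξ I n ω - p| - m ^ 2)) ∂μ :=
        integral_nonneg fun ω => by
          have := sq_nonneg (|timeAverage ξ I n ω - p| - m)
          simp only [Pi.zero_apply]
          nlinarith
      have i3 : Integrable (fun ω => 2 * m * |timeAverage ξ I n ω - p| - m ^ 2) μ :=
        (i1.const_mul _).sub (integrable_const _)
      rw [integral_sub i2 i3, integral_sub (i1.const_mul _) (integrable_const _),
        integral_const_mul] at h0
      simp only [integral_const, probReal_univ, one_smul] at h0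
      nlinarith
    refine hj.trans ?_
    simp only [e2]
    rw [integral_const_mul, integral_finsetSum _ fun s _ => integrable_finsetSum _ fun t _ =>
        hDDi s t]
    have h3 : ∑ s ∈ Finset.range n, ∫ ω, ∑ t ∈ Finset.range n, D s ω * D t ω ∂μ ≤
        ∑ s ∈ Finset.range n, 2 * ∑ k ∈ Finset.range n, a k := by
      refine Finset.sum_le_sum fun s hs => ?_
      rw [integral_finsetSum _ fun t _ => hDDi s t]
      exact (Finset.sum_le_sum fun t _ => hcov' s t).trans
        (sum_dist_le a ha0 n (Finset.mem_range.1 hs))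
    refine (mul_le_mul_of_nonneg_left h3 (by positivity)).trans (le_of_eq ?_)
    rw [Finset.sum_const, Finset.card_range, nsmul_eq_mul]
    field_simp
  have hlim : Tendsto (fun n : ℕ => Real.sqrt (2 * ((n : ℝ)⁻¹ * ∑ k ∈ Finset.range n, a k)))
      atTop (𝓝 0) := by
    have := (ha.cesaro.const_mul 2).sqrt
    simpa using this
  refine squeeze_zero' (Eventually.of_forall fun n => integral_nonneg fun ω => abs_nonneg _)
    ?_ hlim
  filter_upwards [eventually_gt_atTop 0] with n hn
  exact Real.le_sqrt_of_sq_le (hvar n hn)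

/-- The law of large numbers in `L¹`: it holds for indicators by the variance bound, hence for
simple functions, and averaging contracts the `L¹` norm. -/
theorem WeaklyMixing.tendsto_integral_abs (hξ : WeaklyMixing μ ν ξ) {g : S → ℝ}
    (hg : Integrable g ν) :
    Tendsto (fun n => ∫ ω, |timeAverage ξ g n ω - ∫ x, g x ∂ν| ∂μ) atTop (𝓝 0) := by
  have hνp : IsProbabilityMeasure ν := by
    rw [← hξ.map_eq 0]; exact Measure.isProbabilityMeasure_map (hξ.measurable 0).aemeasurable
  have add_le : ∀ (u v : S → ℝ), Integrable u ν → Integrable v ν → ∀ n,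
      ∫ ω, |timeAverage ξ (u + v) n ω - ∫ x, (u + v) x ∂ν| ∂μ ≤
      ∫ ω, |timeAverage ξ u n ω - ∫ x, u x ∂ν| ∂μ +
      ∫ ω, |timeAverage ξ v n ω - ∫ x, v x ∂ν| ∂μ := by
    intro u v hu hv n
    have i0 : ∀ (u : S → ℝ), Integrable u ν →
        Integrable (fun ω => |timeAverage ξ u n ω - ∫ x, u x ∂ν|) μ := fun u hu =>
      ((hξ.integrable_timeAverage hu n).sub (integrable_const _)).abs
    have i1 := i0 u hu
    have i2 := i0 v hv
    have i3 := i0 (u + v) (hu.add hv)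
    rw [← integral_add i1 i2]
    refine integral_mono i3 (i1.add i2) fun ω => ?_
    have e : timeAverage ξ (u + v) n ω - ∫ x, (u + v) x ∂ν =
        (timeAverage ξ u n ω - ∫ x, u x ∂ν) + (timeAverage ξ v n ω - ∫ x, v x ∂ν) := by
      have : ∫ x, (u + v) x ∂ν = ∫ x, u x ∂ν + ∫ x, v x ∂ν := integral_add hu hv
      rw [this]
      simp only [timeAverage, Pi.add_apply, Finset.sum_add_distrib, mul_add]
      ring
    simp only [e]
    exact abs_add_le _ _
  have simple : ∀ u : SimpleFunc S ℝ,
      Tendsto (fun n => ∫ ω, |timeAverage ξ u n ω - ∫ x, u x ∂ν| ∂μ) atTop (𝓝 0) := by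
    intro u
    induction u using SimpleFunc.induction with
    | const c hs =>
      rename_i s
      have e : ((SimpleFunc.piecewise s hs (SimpleFunc.const S c) (SimpleFunc.const S 0)) : S → ℝ)
          = fun x => c * s.indicator (fun _ => (1 : ℝ)) x := by
        ext x; by_cases h : x ∈ s <;> simp [h]
      have h2 : ∫ x, c * s.indicator (fun _ => (1 : ℝ)) x ∂ν = c * ν.real s := by
        rw [integral_const_mul, integral_indicator_const _ hs]; simp
      have h3 : ∀ n ω, |timeAverage ξ (fun x => c * s.indicator (fun _ => (1 : ℝ)) x) n ω -
          c * ν.real s| = |c| * |timeAverage ξ (s.indicator fun _ => (1 : ℝ)) n ω - ν.real s| := by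
        intro n ω
        rw [← abs_mul]
        congr 1
        simp only [timeAverage, ← Finset.mul_sum]
        ring
      rw [e]
      simp only [h2, h3, integral_const_mul]
      simpa using (hξ.tendsto_integral_abs_indicator hs).const_mul |c|
    | add _ hu hv =>
      rename_i u v _
      refine squeeze_zero (fun n => integral_nonneg fun ω => abs_nonneg _)
        (fun n => ?_) (by simpa using hu.add hv)
      exact add_le u v u.integrable_of_isFiniteMeasure v.integrable_of_isFiniteMeasure n
  rw [Metric.tendsto_atTop]
  intro ε hε
  obtain ⟨u, hu, hui⟩ : ∃ u : SimpleFunc S ℝ, eLpNorm (g - ⇑u) 1 ν < ENNReal.ofReal (ε / 4) ∧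
      MemLp (⇑u) 1 ν := (memLp_one_iff_integrable.2 hg).exists_simpleFunc_eLpNorm_sub_lt
    ENNReal.one_ne_top (ε := ENNReal.ofReal (ε / 4)) (by simpa using hε)
  have hui' := memLp_one_iff_integrable.1 hui
  have hv : Integrable (g - ⇑u) ν := hg.sub hui'
  have hsmall : ∫ x, |(g - ⇑u) x| ∂ν < ε / 4 := by
    rw [eLpNorm_one_eq_lintegral_enorm, ← ofReal_integral_norm_eq_lintegral_enorm hv] at hu
    exact (ENNReal.ofReal_lt_ofReal_iff (by positivity)).1 hu
  obtain ⟨n₀, hn₀⟩ := Metric.tendsto_atTop.1 (simple u) (ε / 4) (by positivity)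
  refine ⟨n₀, fun n hn => ?_⟩
  have h1 := hn₀ n hn
  rw [Real.dist_eq, sub_zero, abs_of_nonneg (integral_nonneg fun ω => abs_nonneg _)] at h1 ⊢
  have h2 := add_le u (g - ⇑u) hui' hv n
  rw [add_sub_cancel] at h2
  have h3 : ∫ ω, |timeAverage ξ (g - ⇑u) n ω - ∫ x, (g - ⇑u) x ∂ν| ∂μ ≤ ε / 4 + ε / 4 := by
    have i1 := (hξ.integrable_timeAverage hv n).abs
    refine (integral_mono (((hξ.integrable_timeAverage hv n).sub (integrable_const _)).abs)
      (i1.add (integrable_const |∫ x, (g - ⇑u) x ∂ν|)) fun ω => abs_sub _ _).trans ?_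
    simp only [Pi.add_apply]
    rw [integral_add i1 (integrable_const _)]
    simp only [integral_const, probReal_univ, one_smul]
    have := hξ.integral_abs_timeAverage_le hv n
    have h4 : |∫ x, (g - ⇑u) x ∂ν| ≤ ∫ x, |(g - ⇑u) x| ∂ν := abs_integral_le_integral_abs
    linarith
  linarith

/-- The law of large numbers in probability. -/
theorem WeaklyMixing.tendsto_measure (hξ : WeaklyMixing μ ν ξ) {g : S → ℝ}
    (hg : Integrable g ν) {κ : ℝ} (hκ : 0 < κ) :
    Tendsto (fun n => μ {ω | κ ≤ |timeAverage ξ g n ω - ∫ x, g x ∂ν|}) atTop (𝓝 0) := by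
  have h := (hξ.tendsto_integral_abs hg).const_mul κ⁻¹
  rw [mul_zero] at h
  have h' := ENNReal.tendsto_ofReal h
  rw [ENNReal.ofReal_zero] at h'
  refine tendsto_of_tendsto_of_tendsto_of_le_of_le tendsto_const_nhds h' (fun _ => zero_le)
    fun n => ?_
  have i1 := ((hξ.integrable_timeAverage hg n).sub (integrable_const (∫ x, g x ∂ν))).abs
  have := mul_meas_ge_le_integral_of_nonneg (ae_of_all _ fun ω => abs_nonneg _) i1 κ
  rw [← ofReal_measureReal (measure_ne_top _ _)]
  refine ENNReal.ofReal_le_ofReal ?_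
  rw [inv_mul_eq_div, le_div_iff₀ hκ, mul_comm]
  exact this

end LLN

/-! ### The likelihood ratio of the binary response -/

section Likelihood

/-- The probability under the distribution function `Φ` of the observed outcome at the index `x`,
when `s = (z, ε)` and the outcome is `1` if `ε ≤ βᵀz`. -/
noncomputable def outcomeProb {E : Type*} [NormedAddCommGroup E] [InnerProductSpace ℝ E]
    (Φ : ℝ → ℝ) (β : E) (s : E × ℝ) (x : ℝ) : ℝ :=
  if s.2 ≤ inner ℝ β s.1 then Φ x else 1 - Φ x

/-- The maximum of `outcomeProb Φ β s` on `[x - σ, x + σ]`, for a monotone `Φ`. -/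
noncomputable def outcomeProbSup {E : Type*} [NormedAddCommGroup E] [InnerProductSpace ℝ E]
    (Φ : ℝ → ℝ) (β : E) (s : E × ℝ) (x σ : ℝ) : ℝ :=
  if s.2 ≤ inner ℝ β s.1 then Φ (x + σ) else 1 - Φ (x - σ)

/-- The inverse of the probability of the observed outcome at the true index. It is integrable,
and it dominates the square roots of the likelihood ratios and the negative log-likelihood at the
true index. -/
noncomputable def invOutcomeProb {E : Type*} [NormedAddCommGroup E] [InnerProductSpace ℝ E]
    (Φ : ℝ → ℝ) (β : E) (s : E × ℝ) : ℝ :=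
  (outcomeProb Φ β s (inner ℝ β s.1))⁻¹

theorem sqrt_le_half {x : ℝ} (hx : 0 ≤ x) : √x ≤ (1 + x) / 2 := by
  nlinarith [sq_nonneg (√x - 1), Real.sq_sqrt hx]

theorem sqrt_lt_half {x : ℝ} (hx : 0 ≤ x) (h1 : x ≠ 1) : √x < (1 + x) / 2 := by
  have h2 : √x - 1 ≠ 0 := fun h => h1 (by
    have : √x = 1 := by linarith
    rw [← Real.sq_sqrt hx, this, one_pow])
  nlinarith [pow_pos (abs_pos.2 h2) 2, sq_abs (√x - 1), Real.sq_sqrt hx]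

/-- The Hellinger affinity of two Bernoulli laws is at most one. -/
theorem affinity_le_one {p q : ℝ} (hp : 0 < p) (hp1 : p < 1) (hq : 0 < q) (hq1 : q < 1) :
    p * √(q / p) + (1 - p) * √((1 - q) / (1 - p)) ≤ 1 := by
  have h1 : 0 < 1 - p := by linarith
  have h2 : 0 < 1 - q := by linarith
  have e1 : p * √(q / p) ≤ (p + q) / 2 := by
    calc _ ≤ p * ((1 + q / p) / 2) := by gcongr; exact sqrt_le_half (by positivity)
      _ = _ := by field_simp
  have e2 : (1 - p) * √((1 - q) / (1 - p)) ≤ ((1 - p) + (1 - q)) / 2 := by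
    calc _ ≤ (1 - p) * ((1 + (1 - q) / (1 - p)) / 2) := by
          gcongr; exact sqrt_le_half (by positivity)
      _ = _ := by field_simp
  linarith

/-- The Hellinger affinity of two different Bernoulli laws is less than one. -/
theorem affinity_lt_one {p q : ℝ} (hp : 0 < p) (hp1 : p < 1) (hq : 0 < q) (hq1 : q < 1)
    (hpq : q ≠ p) : p * √(q / p) + (1 - p) * √((1 - q) / (1 - p)) < 1 := by
  have h1 : 0 < 1 - p := by linarith
  have h2 : 0 < 1 - q := by linarith
  have e1 : p * √(q / p) < (p + q) / 2 := by
    calc _ < p * ((1 + q / p) / 2) := by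
          gcongr
          refine sqrt_lt_half (by positivity) ?_
          rw [Ne, div_eq_one_iff_eq hp.ne']; exact hpq
      _ = _ := by field_simp
  have e2 : (1 - p) * √((1 - q) / (1 - p)) ≤ ((1 - p) + (1 - q)) / 2 := by
    calc _ ≤ (1 - p) * ((1 + (1 - q) / (1 - p)) / 2) := by
          gcongr; exact sqrt_le_half (by positivity)
      _ = _ := by field_simp
  linarith

theorem log_sub_log_le_sqrt {a b : ℝ} (ha : 0 < a) (hb : 0 < b) :
    Real.log a - Real.log b ≤ 2 * √(a / b) - 2 := by
  have h : 0 < a / b := div_pos ha hb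
  have h1 := Real.log_le_sub_one_of_pos (Real.sqrt_pos.2 h)
  rw [Real.log_sqrt h.le, Real.log_div ha.ne' hb.ne'] at h1
  linarith

variable {E : Type*} [NormedAddCommGroup E] [InnerProductSpace ℝ E]
  {Φ : ℝ → ℝ} {β : E}

theorem outcomeProb_pos (h01 : ∀ x, 0 < Φ x ∧ Φ x < 1) (s : E × ℝ) (x : ℝ) :
    0 < outcomeProb Φ β s x := by
  unfold outcomeProb; split_ifs <;> linarith [h01 x]

theorem outcomeProb_le_one (h01 : ∀ x, 0 < Φ x ∧ Φ x < 1) (s : E × ℝ) (x : ℝ) :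
    outcomeProb Φ β s x ≤ 1 := by
  unfold outcomeProb; split_ifs <;> linarith [h01 x]

theorem outcomeProbSup_le_one (h01 : ∀ x, 0 < Φ x ∧ Φ x < 1) (s : E × ℝ) (x σ : ℝ) :
    outcomeProbSup Φ β s x σ ≤ 1 := by
  unfold outcomeProbSup; split_ifs <;> linarith [h01 (x + σ), h01 (x - σ)]

theorem outcomeProb_le_sup (hm : Monotone Φ) (s : E × ℝ) {x x₀ σ : ℝ} (h : |x - x₀| ≤ σ) :
    outcomeProb Φ β s x ≤ outcomeProbSup Φ β s x₀ σ := by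
  rw [abs_le] at h
  have h1 : Φ x ≤ Φ (x₀ + σ) := hm (by linarith)
  have h2 : Φ (x₀ - σ) ≤ Φ x := hm (by linarith)
  unfold outcomeProb outcomeProbSup; split_ifs <;> linarith

theorem one_le_invOutcomeProb (h01 : ∀ x, 0 < Φ x ∧ Φ x < 1) (s : E × ℝ) :
    1 ≤ invOutcomeProb Φ β s :=
  (one_le_inv₀ (outcomeProb_pos h01 s _)).2 (outcomeProb_le_one h01 s _)

theorem neg_log_outcomeProb_le (h01 : ∀ x, 0 < Φ x ∧ Φ x < 1) (s : E × ℝ) :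
    -Real.log (outcomeProb Φ β s (inner ℝ β s.1)) ≤ invOutcomeProb Φ β s := by
  rw [← Real.log_inv]
  have := Real.log_le_sub_one_of_pos (inv_pos.2 (outcomeProb_pos (β := β) h01 s (inner ℝ β s.1)))
  unfold invOutcomeProb
  linarith

theorem abs_inner_add_sub_le {r : ℝ} (hr1 : r ≤ 1) {γ γ₀ z u : E} (hγ : ‖γ - γ₀‖ ≤ r)
    (hu : ‖u‖ ≤ r) : |inner ℝ γ (z + u) - inner ℝ γ₀ z| ≤ r * (‖z‖ + ‖γ₀‖ + 1) := by
  have hr : 0 ≤ r := (norm_nonneg _).trans hγ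
  have e : inner ℝ γ (z + u) - inner ℝ γ₀ z = inner ℝ (γ - γ₀) z + inner ℝ γ u := by
    rw [inner_add_right, inner_sub_left]; ring
  have h1 : ‖γ‖ ≤ ‖γ₀‖ + 1 := by
    have := norm_le_norm_add_norm_sub' γ γ₀
    linarith
  rw [e]
  calc _ ≤ |inner ℝ (γ - γ₀) z| + |inner ℝ γ u| := abs_add_le _ _
    _ ≤ ‖γ - γ₀‖ * ‖z‖ + ‖γ‖ * ‖u‖ :=
        add_le_add (abs_real_inner_le_norm _ _) (abs_real_inner_le_norm _ _)
    _ ≤ r * ‖z‖ + (‖γ₀‖ + 1) * r := by gcongr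
    _ = _ := by ring

theorem outcomeProbSup_zero (s : E × ℝ) (x : ℝ) :
    outcomeProbSup Φ β s x 0 = outcomeProb Φ β s x := by
  simp [outcomeProbSup, outcomeProb]

theorem sqrt_ratio_le (h01 : ∀ x, 0 < Φ x ∧ Φ x < 1) {a : ℝ} (ha : a ≤ 1) (s : E × ℝ) :
    √(a / outcomeProb Φ β s (inner ℝ β s.1)) ≤ invOutcomeProb Φ β s := by
  have h1 := one_le_invOutcomeProb (β := β) h01 s
  rw [Real.sqrt_le_left (by linarith)]
  have h2 : a / outcomeProb Φ β s (inner ℝ β s.1) ≤ invOutcomeProb Φ β s := by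
    unfold invOutcomeProb
    rw [div_eq_mul_inv]
    exact mul_le_of_le_one_left (inv_pos.2 (outcomeProb_pos h01 _ _)).le ha
  nlinarith

section Integral

variable [MeasurableSpace E] [BorelSpace E] [SecondCountableTopology E]
  {P : Measure E} [IsProbabilityMeasure P] {Q : Measure ℝ} [IsProbabilityMeasure Q]

theorem measurableSet_outcome (β : E) : MeasurableSet {s : E × ℝ | s.2 ≤ inner ℝ β s.1} :=
  measurableSet_le measurable_snd (by fun_prop)

theorem measurable_outcomeProbSup (hΦ : Measurable Φ) {x σ : E × ℝ → ℝ} (hx : Measurable x)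
    (hσ : Measurable σ) : Measurable fun s => outcomeProbSup Φ β s (x s) (σ s) := by
  unfold outcomeProbSup
  refine Measurable.ite (measurableSet_outcome β) ?_ ?_
  · exact hΦ.comp (hx.add hσ)
  · exact measurable_const.sub (hΦ.comp (hx.sub hσ))

theorem measurable_outcomeProb (hΦ : Measurable Φ) {x : E × ℝ → ℝ} (hx : Measurable x) :
    Measurable fun s => outcomeProb Φ β s (x s) := by
  simpa only [outcomeProbSup_zero] using
    measurable_outcomeProbSup (β := β) hΦ hx (measurable_const (a := (0 : ℝ)))

theorem measurable_invOutcomeProb (hΦ : Measurable Φ) : Measurable (invOutcomeProb Φ β) :=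
  (measurable_outcomeProb hΦ (by fun_prop)).inv

theorem integral_ite_le (a b c : ℝ) :
    ∫ e, (if e ≤ c then a else b) ∂Q = cdf Q c * a + (1 - cdf Q c) * b := by
  have h : (fun e : ℝ => if e ≤ c then a else b) =
      fun e => (Set.Iic c).indicator (fun _ => a - b) e + b := by
    ext e
    by_cases h : e ≤ c <;> simp [h]
  rw [h, integral_add ((integrable_const _).indicator measurableSet_Iic) (integrable_const _),
    integral_indicator_const _ measurableSet_Iic, cdf_eq_real]
  simp
  ring

theorem integrable_ite_le (a b c : ℝ) : Integrable (fun e : ℝ => if e ≤ c then a else b) Q := by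
  refine Integrable.of_bound (Measurable.ite measurableSet_Iic measurable_const
    measurable_const).aestronglyMeasurable (max |a| |b|) (ae_of_all _ fun e => ?_)
  split_ifs <;> simp

omit [BorelSpace E] in
/-- Integrating the response error out first. -/
theorem integral_prod_ite {a b : E → ℝ}
    (h : Integrable (fun s : E × ℝ => if s.2 ≤ inner ℝ β s.1 then a s.1 else b s.1) (P.prod Q)) :
    ∫ s : E × ℝ, (if s.2 ≤ inner ℝ β s.1 then a s.1 else b s.1) ∂(P.prod Q) =
      ∫ z, (cdf Q (inner ℝ β z) * a z + (1 - cdf Q (inner ℝ β z)) * b z) ∂P := by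
  rw [integral_prod _ h]
  exact integral_congr_ae (ae_of_all _ fun z => integral_ite_le (a z) (b z) (inner ℝ β z))

theorem integrable_invOutcomeProb (h01 : ∀ x, 0 < cdf Q x ∧ cdf Q x < 1) :
    Integrable (invOutcomeProb (cdf Q) β) (P.prod Q) := by
  have hm : Measurable (invOutcomeProb (cdf Q) β) :=
    measurable_invOutcomeProb (monotone_cdf Q).measurable
  have e : ∀ z e, invOutcomeProb (cdf Q) β (z, e) =
      if e ≤ inner ℝ β z then (cdf Q (inner ℝ β z))⁻¹ else (1 - cdf Q (inner ℝ β z))⁻¹ := by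
    intro z e
    unfold invOutcomeProb outcomeProb
    split_ifs <;> rfl
  rw [integrable_prod_iff hm.aestronglyMeasurable]
  constructor
  · refine ae_of_all _ fun z => ?_
    simp only [e]
    exact integrable_ite_le _ _ _
  · have h2 : ∀ z, ∫ y, ‖invOutcomeProb (cdf Q) β (z, y)‖ ∂Q = 2 := by
      intro z
      have : ∀ y, ‖invOutcomeProb (cdf Q) β (z, y)‖ = invOutcomeProb (cdf Q) β (z, y) := fun y =>
        Real.norm_of_nonneg (zero_le_one.trans (one_le_invOutcomeProb h01 _))
      rw [integral_congr_ae (ae_of_all _ this)]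
      simp only [e]
      rw [integral_ite_le, mul_inv_cancel₀ (h01 _).1.ne',
        mul_inv_cancel₀ (by linarith [(h01 (inner ℝ β z)).2])]
      norm_num
    simp only [h2]
    exact integrable_const _

/-- A parameter that induces a different law of the response has an affinity below one with the
true one. -/
theorem integral_affinity_lt_one (h01 : ∀ x, 0 < cdf Q x ∧ cdf Q x < 1) {γ₀ : E}
    (hid : ¬ ∀ᵐ z ∂P, cdf Q (inner ℝ γ₀ z) = cdf Q (inner ℝ β z)) :
    ∫ s : E × ℝ, √(outcomeProb (cdf Q) β s (inner ℝ γ₀ s.1) /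
      outcomeProb (cdf Q) β s (inner ℝ β s.1)) ∂(P.prod Q) < 1 := by
  have hΦm := (monotone_cdf Q).measurable
  set a : E → ℝ := fun z => √(cdf Q (inner ℝ γ₀ z) / cdf Q (inner ℝ β z)) with ha
  set b : E → ℝ := fun z => √((1 - cdf Q (inner ℝ γ₀ z)) / (1 - cdf Q (inner ℝ β z))) with hb
  have e : ∀ s : E × ℝ, √(outcomeProb (cdf Q) β s (inner ℝ γ₀ s.1) /
      outcomeProb (cdf Q) β s (inner ℝ β s.1)) =
      if s.2 ≤ inner ℝ β s.1 then a s.1 else b s.1 := by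
    intro s
    unfold outcomeProb
    split_ifs <;> rfl
  have hint : Integrable (fun s : E × ℝ => if s.2 ≤ inner ℝ β s.1 then a s.1 else b s.1)
      (P.prod Q) := by
    simp only [← e]
    refine (integrable_invOutcomeProb (β := β) h01).mono' ?_ (ae_of_all _ fun s => ?_)
    · exact ((measurable_outcomeProb hΦm (by fun_prop)).div
        (measurable_outcomeProb hΦm (by fun_prop))).sqrt.aestronglyMeasurable
    · rw [Real.norm_of_nonneg (Real.sqrt_nonneg _)]
      exact sqrt_ratio_le h01 (outcomeProb_le_one h01 _ _) s
  simp only [e]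
  rw [integral_prod_ite hint]
  set k : E → ℝ := fun z => cdf Q (inner ℝ β z) * a z + (1 - cdf Q (inner ℝ β z)) * b z with hk
  have hk1 : ∀ z, k z ≤ 1 := fun z => affinity_le_one (h01 _).1 (h01 _).2 (h01 _).1 (h01 _).2
  have hk0 : ∀ z, 0 ≤ k z := fun z => add_nonneg
    (mul_nonneg (h01 _).1.le (Real.sqrt_nonneg _))
    (mul_nonneg (by linarith [(h01 (inner ℝ β z)).2]) (Real.sqrt_nonneg _))
  have c1 : ∀ v : E, Measurable fun z => cdf Q (inner ℝ v z) := fun v =>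
    hΦm.comp (by fun_prop)
  have hkm : Measurable k :=
    ((c1 β).mul ((c1 γ₀).div (c1 β)).sqrt).add ((measurable_const.sub (c1 β)).mul
      ((measurable_const.sub (c1 γ₀)).div (measurable_const.sub (c1 β))).sqrt)
  have hki : Integrable k P := Integrable.of_bound hkm.aestronglyMeasurable 1
    (ae_of_all _ fun z => by rw [Real.norm_of_nonneg (hk0 z)]; exact hk1 z)
  have hpos : 0 < ∫ z, (1 - k z) ∂P := by
    have hki' : Integrable (fun z => 1 - k z) P := (integrable_const _).sub hki
    rw [integral_pos_iff_support_of_nonneg (fun z => by simpa using hk1 z) hki']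
    rw [pos_iff_ne_zero]
    intro h0
    refine hid ?_
    rw [ae_iff]
    refine measure_mono_null (fun z hz => ?_) h0
    have : k z < 1 := affinity_lt_one (h01 _).1 (h01 _).2 (h01 _).1 (h01 _).2 hz
    simp only [Function.mem_support]
    linarith
  rw [integral_sub (integrable_const _) hki] at hpos
  simpa using hpos

end Integral

end Likelihood

/-! ### Uniform separation of the likelihood -/

section Separation

variable {Ω : Type*} [MeasurableSpace Ω] {μ : Measure Ω}
  {E : Type*} [NormedAddCommGroup E] [InnerProductSpace ℝ E]

/-- The log-likelihood of the index `γᵀ(z + u)` minus that of the true index `βᵀz`. -/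
noncomputable def logRatio (Φ : ℝ → ℝ) (β : E) (s : E × ℝ) (γ u : E) : ℝ :=
  Real.log (outcomeProb Φ β s (inner ℝ γ (s.1 + u))) -
    Real.log (outcomeProb Φ β s (inner ℝ β s.1))

/-- On the parameter set `U`, with probability tending to one, the log-likelihood falls short of
its value at `β` by a multiple of the sample size, uniformly over `U` and over perturbations `u t`
of the regressors, up to a multiple of the sum of the `‖u t‖²`. -/
def UniformlyWorse (μ : Measure Ω) (ξ : ℕ → Ω → E × ℝ) (Φ : ℝ → ℝ) (β : E) (U : Set E) : Prop :=
  ∃ κ C : ℝ, 0 < κ ∧ 0 ≤ C ∧ Tendsto (fun n : ℕ => μ {ω | ∃ γ ∈ U, ∃ u : ℕ → E,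
    -κ * n + C * ∑ t ∈ Finset.range n, ‖u t‖ ^ 2 <
      ∑ t ∈ Finset.range n, logRatio Φ β (ξ t ω) γ (u t)}) atTop (𝓝 0)

variable {ξ : ℕ → Ω → E × ℝ} {Φ : ℝ → ℝ} {β : E}

theorem UniformlyWorse.empty : UniformlyWorse μ ξ Φ β ∅ :=
  ⟨1, 0, one_pos, le_rfl, by simp⟩

theorem UniformlyWorse.mono {U V : Set E} (h : U ⊆ V) (hV : UniformlyWorse μ ξ Φ β V) :
    UniformlyWorse μ ξ Φ β U := by
  obtain ⟨κ, C, hκ, hC, hlim⟩ := hV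
  refine ⟨κ, C, hκ, hC, tendsto_of_tendsto_of_tendsto_of_le_of_le tendsto_const_nhds hlim
    (fun _ => zero_le) fun n => measure_mono ?_⟩
  rintro ω ⟨γ, hγ, u, hu⟩
  exact ⟨γ, h hγ, u, hu⟩

theorem UniformlyWorse.union {U V : Set E} (hU : UniformlyWorse μ ξ Φ β U)
    (hV : UniformlyWorse μ ξ Φ β V) : UniformlyWorse μ ξ Φ β (U ∪ V) := by
  obtain ⟨κ, C, hκ, hC, h1⟩ := hU
  obtain ⟨κ', C', hκ', hC', h2⟩ := hV
  refine ⟨min κ κ', max C C', lt_min hκ hκ', le_max_of_le_left hC, ?_⟩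
  have h3 := h1.add h2
  rw [add_zero] at h3
  refine tendsto_of_tendsto_of_tendsto_of_le_of_le tendsto_const_nhds h3
    (fun _ => zero_le) fun n => (measure_mono ?_).trans (measure_union_le _ _)
  rintro ω ⟨γ, hγ, u, hu⟩
  have hS : 0 ≤ ∑ t ∈ Finset.range n, ‖u t‖ ^ 2 := Finset.sum_nonneg fun _ _ => by positivity
  have hn : (0 : ℝ) ≤ n := Nat.cast_nonneg n
  rcases hγ with hγ | hγ
  · refine Or.inl ⟨γ, hγ, u, lt_of_le_of_lt ?_ hu⟩
    have := mul_le_mul_of_nonneg_right (le_max_left C C') hS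
    have := mul_le_mul_of_nonneg_right (min_le_left κ κ') hn
    linarith
  · refine Or.inr ⟨γ, hγ, u, lt_of_le_of_lt ?_ hu⟩
    have := mul_le_mul_of_nonneg_right (le_max_right C C') hS
    have := mul_le_mul_of_nonneg_right (min_le_right κ κ') hn
    linarith

variable [MeasurableSpace E] [IsProbabilityMeasure μ] {ν : Measure (E × ℝ)}

/-- An integrable envelope with negative mean yields uniform separation. -/
theorem UniformlyWorse.of_envelope (hξ : WeaklyMixing μ ν ξ) {U : Set E} {G : E × ℝ → ℝ}
    (hG : Integrable G ν) (hneg : ∫ s, G s ∂ν < 0) {C : ℝ} (hC : 0 ≤ C)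
    (hle : ∀ γ ∈ U, ∀ (u : E) (s : E × ℝ), logRatio Φ β s γ u ≤ G s + C * ‖u‖ ^ 2) :
    UniformlyWorse μ ξ Φ β U := by
  set κ := -(∫ s, G s ∂ν) / 2 with hκdef
  have hκ : 0 < κ := by rw [hκdef]; linarith
  refine ⟨κ, C, hκ, hC, tendsto_of_tendsto_of_tendsto_of_le_of_le tendsto_const_nhds
    (hξ.tendsto_measure hG hκ) (fun _ => zero_le) fun n => measure_mono ?_⟩
  rintro ω ⟨γ, hγ, u, hu⟩
  have h1 : ∑ t ∈ Finset.range n, logRatio Φ β (ξ t ω) γ (u t) ≤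
      ∑ t ∈ Finset.range n, G (ξ t ω) + C * ∑ t ∈ Finset.range n, ‖u t‖ ^ 2 := by
    rw [Finset.mul_sum, ← Finset.sum_add_distrib]
    exact Finset.sum_le_sum fun t _ => hle γ hγ (u t) (ξ t ω)
  have h2 : -κ * n < ∑ t ∈ Finset.range n, G (ξ t ω) := by linarith
  rcases Nat.eq_zero_or_pos n with rfl | hn
  · simp at h2
  have hn' : (0 : ℝ) < n := by exact_mod_cast hn
  have h3 : -κ < timeAverage ξ G n ω := by
    unfold timeAverage
    rw [inv_mul_eq_div, lt_div_iff₀ hn']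
    exact h2
  have h4 := le_abs_self (timeAverage ξ G n ω - ∫ s, G s ∂ν)
  rw [Set.mem_ofPred_eq]
  linarith

variable [BorelSpace E] [FiniteDimensional ℝ E]
  {P : Measure E} [IsProbabilityMeasure P] {Q : Measure ℝ} [IsProbabilityMeasure Q]

/-- Separation near a finite parameter other than the true one: the log-likelihood ratio is at most
twice the square root of the likelihood ratio minus one, whose mean is governed by the Hellinger
affinity. -/
theorem UniformlyWorse.nhds (hξ : WeaklyMixing μ (P.prod Q) ξ)
    (h01 : ∀ x, 0 < cdf Q x ∧ cdf Q x < 1) (hcont : Continuous (cdf Q)) {γ₀ : E}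
    (hid : ¬ ∀ᵐ z ∂P, cdf Q (inner ℝ γ₀ z) = cdf Q (inner ℝ β z)) :
    ∃ U ∈ 𝓝 γ₀, UniformlyWorse μ ξ (cdf Q) β U := by
  have hΦm := (monotone_cdf Q).measurable
  -- the square root of the likelihood ratio, maximized over the indices `γᵀ(z + u)` with `γ` and
  -- `u` within `1 / (n + 1)` of `γ₀` and `0`
  set R : ℕ → E × ℝ → ℝ := fun n s =>
    √(outcomeProbSup (cdf Q) β s (inner ℝ γ₀ s.1) (((n : ℝ) + 1)⁻¹ * (‖s.1‖ + ‖γ₀‖ + 1)) /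
      outcomeProb (cdf Q) β s (inner ℝ β s.1)) with hR
  have hRm : ∀ n, Measurable (R n) := fun n =>
    ((measurable_outcomeProbSup hΦm (by fun_prop) (by fun_prop)).div
      (measurable_outcomeProb hΦm (by fun_prop))).sqrt
  have hRle : ∀ n s, R n s ≤ invOutcomeProb (cdf Q) β s := fun n s =>
    sqrt_ratio_le h01 (outcomeProbSup_le_one h01 _ _ _) s
  have hρ := integrable_invOutcomeProb (P := P) (β := β) h01
  have hRi : ∀ n, Integrable (R n) (P.prod Q) := fun n =>
    hρ.mono' (hRm n).aestronglyMeasurable (ae_of_all _ fun s => by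
      rw [Real.norm_of_nonneg (Real.sqrt_nonneg _)]; exact hRle n s)
  have hlim : Tendsto (fun n => ∫ s, R n s ∂(P.prod Q)) atTop
      (𝓝 (∫ s : E × ℝ, √(outcomeProb (cdf Q) β s (inner ℝ γ₀ s.1) /
        outcomeProb (cdf Q) β s (inner ℝ β s.1)) ∂(P.prod Q))) := by
    refine tendsto_integral_of_dominated_convergence _ (fun n => (hRm n).aestronglyMeasurable) hρ
      (fun n => ae_of_all _ fun s => by
        rw [Real.norm_of_nonneg (Real.sqrt_nonneg _)]; exact hRle n s) (ae_of_all _ fun s => ?_)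
    have h0 : Tendsto (fun n : ℕ => ((n : ℝ) + 1)⁻¹ * (‖s.1‖ + ‖γ₀‖ + 1)) atTop (𝓝 0) := by
      have := (tendsto_one_div_add_atTop_nhds_zero_nat (𝕜 := ℝ)).mul_const (‖s.1‖ + ‖γ₀‖ + 1)
      simpa only [one_div, zero_mul] using this
    have hc : Continuous fun σ : ℝ => outcomeProbSup (cdf Q) β s (inner ℝ γ₀ s.1) σ := by
      unfold outcomeProbSup
      split_ifs <;> fun_prop
    have h1 := (hc.tendsto 0).comp h0
    rw [outcomeProbSup_zero] at h1
    exact (h1.div_const _).sqrt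
  obtain ⟨n, hn⟩ := (hlim.eventually (gt_mem_nhds (integral_affinity_lt_one h01 hid))).exists
  set r : ℝ := ((n : ℝ) + 1)⁻¹ with hr
  have hr0 : 0 < r := by positivity
  have hr1 : r ≤ 1 := inv_le_one_of_one_le₀ (by linarith [(Nat.cast_nonneg n : (0 : ℝ) ≤ n)])
  set I := ∫ s, invOutcomeProb (cdf Q) β s ∂(P.prod Q) with hI
  have hI0 : 0 ≤ I := integral_nonneg fun s => zero_le_one.trans (one_le_invOutcomeProb h01 s)
  set J := ∫ s, R n s ∂(P.prod Q) with hJ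
  -- the weight of the envelope that absorbs the large perturbations
  set a : ℝ := (1 - J) / (I + 1) with ha
  have ha0 : 0 < a := div_pos (by linarith) (by linarith)
  have haI' : a * I ≤ 1 - J := by
    have : a * (I + 1) = 1 - J := by rw [ha]; field_simp
    nlinarith
  refine ⟨Metric.closedBall γ₀ r, Metric.closedBall_mem_nhds _ hr0,
    UniformlyWorse.of_envelope hξ (G := fun s => (2 * R n s - 2) +
      a * invOutcomeProb (cdf Q) β s) (C := a⁻¹ / r ^ 2)
      ((((hRi n).const_mul 2).sub (integrable_const _)).add (hρ.const_mul a)) ?_ (by positivity) ?_⟩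
  · have i1 : Integrable (fun s => 2 * R n s - 2) (P.prod Q) :=
      ((hRi n).const_mul 2).sub (integrable_const _)
    rw [integral_add i1 (hρ.const_mul a), integral_sub ((hRi n).const_mul 2) (integrable_const _),
      integral_const_mul, integral_const_mul]
    simp only [integral_const, probReal_univ, one_smul]
    rw [← hJ, ← hI]
    linarith
  · intro γ hγ u s
    rw [Metric.mem_closedBall, dist_eq_norm] at hγ
    have hρ1 := one_le_invOutcomeProb (β := β) h01 s
    have hR0 : 0 ≤ R n s := Real.sqrt_nonneg _
    have hq0 := outcomeProb_pos (β := β) h01 s (inner ℝ β s.1)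
    have hq := outcomeProb_pos (β := β) h01 s (inner ℝ γ (s.1 + u))
    have hlog := log_sub_log_le_sqrt hq hq0
    unfold logRatio
    rcases le_or_gt ‖u‖ r with hu | hu
    · have h1 : √(outcomeProb (cdf Q) β s (inner ℝ γ (s.1 + u)) /
          outcomeProb (cdf Q) β s (inner ℝ β s.1)) ≤ R n s := by
        refine Real.sqrt_le_sqrt (div_le_div_of_nonneg_right ?_ hq0.le)
        exact outcomeProb_le_sup (monotone_cdf Q) s (abs_inner_add_sub_le hr1 hγ hu)
      have h2 : 0 ≤ a * invOutcomeProb (cdf Q) β s := by positivity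
      have h3 : 0 ≤ a⁻¹ / r ^ 2 * ‖u‖ ^ 2 := by positivity
      linarith
    · have h1 : √(outcomeProb (cdf Q) β s (inner ℝ γ (s.1 + u)) /
          outcomeProb (cdf Q) β s (inner ℝ β s.1)) ≤ √(invOutcomeProb (cdf Q) β s) := by
        refine Real.sqrt_le_sqrt ?_
        unfold invOutcomeProb
        rw [div_eq_mul_inv]
        exact mul_le_of_le_one_left (inv_pos.2 hq0).le (outcomeProb_le_one h01 _ _)
      have h2 : 2 * √(invOutcomeProb (cdf Q) β s) ≤ a * invOutcomeProb (cdf Q) β s + a⁻¹ := by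
        set v := √(invOutcomeProb (cdf Q) β s)
        have hv : v ^ 2 = invOutcomeProb (cdf Q) β s := Real.sq_sqrt (by linarith)
        have h4 : 0 ≤ a⁻¹ * (a * v - 1) ^ 2 := by positivity
        have h5 : a⁻¹ * (a * v - 1) ^ 2 = a * v ^ 2 - 2 * v + a⁻¹ := by field_simp; ring
        rw [← hv]; linarith
      have h3 : a⁻¹ ≤ a⁻¹ / r ^ 2 * ‖u‖ ^ 2 := by
        rw [div_mul_eq_mul_div, le_div_iff₀ (by positivity)]
        gcongr
      linarith

/-- Separation at infinity: along a direction `v` with `vᵀz ≠ 0` on an event of positive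
probability, the outcome contradicts the sign of `vᵀz` with positive probability, and there the
log-likelihood of `ρ v` is arbitrarily small for large `ρ`. -/
theorem UniformlyWorse.cone (hξ : WeaklyMixing μ (P.prod Q) ξ)
    (h01 : ∀ x, 0 < cdf Q x ∧ cdf Q x < 1) {v₀ : E}
    (hv₀ : ¬ ∀ᵐ z ∂P, inner ℝ v₀ z = 0) :
    ∃ U ∈ 𝓝 v₀, ∃ R : ℝ,
      UniformlyWorse μ ξ (cdf Q) β {γ | ∃ ρ : ℝ, R ≤ ρ ∧ ∃ v ∈ U, γ = ρ • v} := by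
  have hΦm := (monotone_cdf Q).measurable
  -- on `W r`, the outcome contradicts the sign of `vᵀ(z + u)` by a margin `r`, whenever `v` and `u`
  -- are within `r` of `v₀` and `0`
  set W : ℝ → Set (E × ℝ) := fun r => {s |
    (s.2 ≤ inner ℝ β s.1 ∧ inner ℝ v₀ s.1 + r * (‖s.1‖ + ‖v₀‖ + 1) ≤ -r) ∨
    (¬ s.2 ≤ inner ℝ β s.1 ∧ r ≤ inner ℝ v₀ s.1 - r * (‖s.1‖ + ‖v₀‖ + 1))} with hW
  have hWm : ∀ r, MeasurableSet (W r) := by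
    intro r
    have h1 : MeasurableSet {s : E × ℝ | inner ℝ v₀ s.1 + r * (‖s.1‖ + ‖v₀‖ + 1) ≤ -r} :=
      measurableSet_le (by fun_prop) (by fun_prop)
    have h2 : MeasurableSet {s : E × ℝ | r ≤ inner ℝ v₀ s.1 - r * (‖s.1‖ + ‖v₀‖ + 1)} :=
      measurableSet_le (by fun_prop) (by fun_prop)
    exact ((measurableSet_outcome β).inter h1).union ((measurableSet_outcome β).compl.inter h2)
  -- some `W r` has positive probability
  obtain ⟨n, hn⟩ : ∃ n : ℕ, (P.prod Q) (W ((n : ℝ) + 1)⁻¹) ≠ 0 := by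
    by_contra! hcon
    refine hv₀ ?_
    have h1 := measure_iUnion_null hcon
    have h2 := Measure.ae_ae_of_ae_prod (measure_eq_zero_iff_ae_notMem.1 h1)
    filter_upwards [h2] with z hz
    by_contra hne
    have hexists : ∃ n : ℕ, ((n : ℝ) + 1)⁻¹ * (‖z‖ + ‖v₀‖ + 2) ≤ |inner ℝ v₀ z| := by
      obtain ⟨n, hn⟩ := exists_nat_gt ((‖z‖ + ‖v₀‖ + 2) / |inner ℝ v₀ z|)
      refine ⟨n, ?_⟩
      rw [div_lt_iff₀ (abs_pos.2 hne)] at hn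
      rw [inv_mul_le_iff₀ (by positivity)]
      nlinarith [abs_nonneg (inner ℝ v₀ z)]
    obtain ⟨n, hn⟩ := hexists
    rcases lt_or_gt_of_ne hne with hneg | hpos
    · have h3 : ∀ᵐ y ∂Q, y ∉ Set.Iic (inner ℝ β z) := by
        filter_upwards [hz] with y hy hy'
        refine hy (Set.mem_iUnion.2 ⟨n, Or.inl ⟨hy', ?_⟩⟩)
        rw [abs_of_neg hneg] at hn
        simp only
        linarith
      have h4 := measure_eq_zero_iff_ae_notMem.2 h3
      have h5 := (h01 (inner ℝ β z)).1
      rw [cdf_eq_real, measureReal_def, h4] at h5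
      simp at h5
    · have h3 : ∀ᵐ y ∂Q, y ∉ (Set.Iic (inner ℝ β z))ᶜ := by
        filter_upwards [hz] with y hy hy'
        refine hy (Set.mem_iUnion.2 ⟨n, Or.inr ⟨hy', ?_⟩⟩)
        rw [abs_of_pos hpos] at hn
        simp only
        linarith
      have h4 := measure_eq_zero_iff_ae_notMem.2 h3
      have h5 := (h01 (inner ℝ β z)).2
      rw [cdf_eq_real, measureReal_def, (prob_compl_eq_zero_iff measurableSet_Iic).1 h4] at h5
      simp at h5
  set r : ℝ := ((n : ℝ) + 1)⁻¹ with hr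
  have hr0 : 0 < r := by positivity
  have hr1 : r ≤ 1 := inv_le_one_of_one_le₀ (by linarith [(Nat.cast_nonneg n : (0 : ℝ) ≤ n)])
  have hπ : 0 < (P.prod Q).real (W r) := ENNReal.toReal_pos hn (measure_ne_top _ _)
  have hρ := integrable_invOutcomeProb (P := P) (β := β) h01
  set I := ∫ s, invOutcomeProb (cdf Q) β s ∂(P.prod Q) with hI
  have hI0 : 0 ≤ I := integral_nonneg fun s => zero_le_one.trans (one_le_invOutcomeProb h01 s)
  -- a loss of `B` on `W r` outweighs the mean of the envelope outside
  set B : ℝ := (I + 1) / (P.prod Q).real (W r) with hB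
  have hB0 : 0 < B := div_pos (by linarith) hπ
  obtain ⟨a, haR⟩ := (((tendsto_cdf_atBot Q).eventually (gt_mem_nhds (Real.exp_pos (-B)))).and
    (eventually_le_atBot (0 : ℝ))).exists
  obtain ⟨b, hbR⟩ := (((tendsto_cdf_atTop Q).eventually (lt_mem_nhds
    (show 1 - Real.exp (-B) < 1 by linarith [Real.exp_pos (-B)]))).and
    (eventually_ge_atTop (0 : ℝ))).exists
  refine ⟨Metric.closedBall v₀ r, Metric.closedBall_mem_nhds _ hr0, max (-a) b / r,
    UniformlyWorse.of_envelope hξ (G := fun s => invOutcomeProb (cdf Q) β s -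
      (W r).indicator (fun _ => B) s) (C := B / r ^ 2)
      (hρ.sub ((integrable_const _).indicator (hWm r))) ?_ (by positivity) ?_⟩
  · rw [integral_sub hρ ((integrable_const _).indicator (hWm r)),
      integral_indicator_const _ (hWm r), ← hI, smul_eq_mul, hB, mul_div_cancel₀ _ hπ.ne']
    linarith
  · rintro γ ⟨ρ, hρR, v, hv, rfl⟩ u s
    rw [Metric.mem_closedBall, dist_eq_norm] at hv
    have hq0 := neg_log_outcomeProb_le (β := β) h01 s
    have hq := outcomeProb_pos (β := β) h01 s (inner ℝ (ρ • v) (s.1 + u))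
    have hq1 : Real.log (outcomeProb (cdf Q) β s (inner ℝ (ρ • v) (s.1 + u))) ≤ 0 :=
      Real.log_nonpos hq.le (outcomeProb_le_one h01 _ _)
    unfold logRatio
    have hBu : 0 ≤ B / r ^ 2 * ‖u‖ ^ 2 := by positivity
    by_cases hs : s ∈ W r
    swap
    · rw [Set.indicator_of_notMem hs]; linarith
    rw [Set.indicator_of_mem hs]
    rcases le_or_gt ‖u‖ r with hu | hu
    · have hd := abs_le.1 (abs_inner_add_sub_le hr1 hv hu (z := s.1))
      rw [div_le_iff₀ hr0] at hρR
      have hρa : -a ≤ ρ * r := (le_max_left _ _).trans hρR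
      have hρb : b ≤ ρ * r := (le_max_right _ _).trans hρR
      have hρ0 : 0 ≤ ρ := by
        by_contra hcon
        nlinarith
      have hlog : Real.log (outcomeProb (cdf Q) β s (inner ℝ (ρ • v) (s.1 + u))) ≤ -B := by
        rw [Real.log_le_iff_le_exp hq, real_inner_smul_left]
        rcases hs with ⟨hy, hs⟩ | ⟨hy, hs⟩
        · have h1 : ρ * inner ℝ v (s.1 + u) ≤ a := by
            have : inner ℝ v (s.1 + u) ≤ -r := by linarith
            nlinarith [mul_le_mul_of_nonneg_left this hρ0]
          unfold outcomeProb
          rw [if_pos hy]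
          exact (monotone_cdf Q h1).trans haR.1.le
        · have h1 : b ≤ ρ * inner ℝ v (s.1 + u) := by
            have : r ≤ inner ℝ v (s.1 + u) := by linarith
            nlinarith [mul_le_mul_of_nonneg_left this hρ0]
          unfold outcomeProb
          rw [if_neg hy]
          linarith [monotone_cdf Q h1]
      linarith
    · have h3 : B ≤ B / r ^ 2 * ‖u‖ ^ 2 := by
        rw [div_mul_eq_mul_div, le_div_iff₀ (by positivity)]
        gcongr
      linarith

/-- Separation outside every ball around the true parameter. -/
theorem UniformlyWorse.compl_ball (hξ : WeaklyMixing μ (P.prod Q) ξ)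
    (h01 : ∀ x, 0 < cdf Q x ∧ cdf Q x < 1) (hcont : Continuous (cdf Q))
    (hid : ∀ γ, γ ≠ β → ¬ ∀ᵐ z ∂P, cdf Q (inner ℝ γ z) = cdf Q (inner ℝ β z))
    (hnc : ∀ v : E, v ≠ 0 → ¬ ∀ᵐ z ∂P, inner ℝ v z = 0) {η : ℝ} (hη : 0 < η) :
    UniformlyWorse μ ξ (cdf Q) β {γ | η ≤ ‖γ - β‖} := by
  -- the cones cover the complement of a large ball
  have h1 : ∃ R : ℝ, UniformlyWorse μ ξ (cdf Q) β
      {γ | ∃ ρ : ℝ, R ≤ ρ ∧ ∃ v ∈ Metric.sphere (0 : E) 1, γ = ρ • v} := by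
    refine (isCompact_sphere (0 : E) 1).induction_on
      (p := fun U => ∃ R : ℝ, UniformlyWorse μ ξ (cdf Q) β
        {γ | ∃ ρ : ℝ, R ≤ ρ ∧ ∃ v ∈ U, γ = ρ • v}) ⟨0, by simpa using UniformlyWorse.empty⟩ ?_ ?_ ?_
    · rintro U V hUV ⟨R, hR⟩
      refine ⟨R, hR.mono ?_⟩
      rintro γ ⟨ρ, hρ, v, hv, rfl⟩
      exact ⟨ρ, hρ, v, hUV hv, rfl⟩
    · rintro U V ⟨R, hR⟩ ⟨R', hR'⟩
      refine ⟨max R R', (hR.union hR').mono ?_⟩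
      rintro γ ⟨ρ, hρ, v, hv | hv, rfl⟩
      · exact Or.inl ⟨ρ, (le_max_left _ _).trans hρ, v, hv, rfl⟩
      · exact Or.inr ⟨ρ, (le_max_right _ _).trans hρ, v, hv, rfl⟩
    · intro v hv
      have hv0 : v ≠ 0 := by
        rintro rfl
        simp at hv
      obtain ⟨U, hU, R, hR⟩ := UniformlyWorse.cone (β := β) hξ h01 (hnc v hv0)
      exact ⟨U, mem_nhdsWithin_of_mem_nhds hU, R, hR⟩
  obtain ⟨R, hR⟩ := h1
  have h2 : UniformlyWorse μ ξ (cdf Q) β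
      (Metric.closedBall (0 : E) (max R 0) ∩ {γ | η ≤ ‖γ - β‖}) := by
    have hc : IsCompact (Metric.closedBall (0 : E) (max R 0) ∩ {γ | η ≤ ‖γ - β‖}) :=
      (isCompact_closedBall (0 : E) (max R 0)).inter_right (isClosed_le (by fun_prop) (by fun_prop))
    refine hc.induction_on UniformlyWorse.empty (fun _ _ h => UniformlyWorse.mono h)
      (fun _ _ h h' => h.union h') fun γ hγ => ?_
    have hγβ : γ ≠ β := by
      rintro rfl
      have : η ≤ ‖γ - γ‖ := hγ.2
      rw [sub_self, norm_zero] at this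
      linarith
    obtain ⟨U, hU, h⟩ := UniformlyWorse.nhds hξ h01 hcont (hid γ hγβ)
    exact ⟨U, mem_nhdsWithin_of_mem_nhds hU, h⟩
  refine (hR.union h2).mono fun γ hγ => ?_
  rcases le_or_gt ‖γ‖ (max R 0) with h | h
  · exact Or.inr ⟨mem_closedBall_zero_iff.2 h, hγ⟩
  · have h0 : γ ≠ 0 := norm_pos_iff.1 ((le_max_right _ _).trans_lt h)
    refine Or.inl ⟨‖γ‖, (le_max_left _ _).trans h.le, ‖γ‖⁻¹ • γ, ?_, ?_⟩
    · simp [norm_smul, h0]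
    · rw [smul_smul, mul_inv_cancel₀ (norm_ne_zero_iff.2 h0), one_smul]

end Separation

/-! ### Smoothness and curvature of the log-likelihood -/

section Calculus

theorem continuous_cdf (Q : Measure ℝ) [IsProbabilityMeasure Q] [NullSingletonClass Q] :
    Continuous (cdf Q) := by
  rw [continuous_iff_continuousAt]
  intro x
  rw [(monotone_cdf Q).continuousAt_iff_leftLim_eq_rightLim, StieltjesFunction.rightLim_eq]
  have h := (cdf Q).measure_singleton x
  rw [measure_cdf, measure_singleton] at h
  have h1 := ENNReal.ofReal_eq_zero.1 h.symm
  exact le_antisymm ((monotone_cdf Q).leftLim_le le_rfl) (by linarith)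

/-- With the convention `log 0 = 0`, the logarithm of a continuous nonnegative function that
vanishes somewhere but not everywhere is discontinuous. -/
theorem pos_of_continuous_log {g : ℝ → ℝ} (hg : Continuous g) (h0 : ∀ x, 0 ≤ g x)
    (hlog : Continuous fun x => Real.log (g x)) {b : ℝ} (hb : 0 < g b) (a : ℝ) : 0 < g a := by
  by_contra ha
  have ha0 : g a = 0 := le_antisymm (not_lt.1 ha) (h0 a)
  obtain ⟨x₀, -, hx₀⟩ := (isCompact_uIcc (a := a) (b := b)).exists_isMinOn
    Set.nonempty_uIcc hlog.continuousOn
  set m := min (g b) (Real.exp (Real.log (g x₀) - 1)) with hm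
  have hm0 : 0 < m := lt_min hb (Real.exp_pos _)
  have hmem : m ∈ Set.uIcc (g a) (g b) := by
    rw [ha0, Set.uIcc_of_le hb.le]
    exact ⟨hm0.le, min_le_left _ _⟩
  obtain ⟨x, hx, hxm⟩ := intermediate_value_uIcc (hg.continuousOn (s := Set.uIcc a b)) hmem
  have h1 : Real.log (g x₀) ≤ Real.log (g x) := hx₀ hx
  have h2 : Real.log (g x) ≤ Real.log (g x₀) - 1 := by
    rw [hxm, Real.log_le_iff_le_exp hm0]
    exact min_le_right _ _
  linarith

theorem eq_of_constant_between {l : ℝ → ℝ} (hl : ContDiff ℝ 2 l) {x₀ x : ℝ}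
    (h : iteratedDeriv 2 l x₀ ≠ 0) (hc : ∀ y ∈ Set.uIcc x₀ x, l y = l x₀) : x = x₀ := by
  by_contra hne
  have hlt : min x₀ x < max x₀ x := min_lt_max.2 (Ne.symm hne)
  have hcl : IsClosed {y | iteratedDeriv 2 l y = 0} :=
    isClosed_eq (hl.continuous_iteratedDeriv 2 le_rfl) continuous_const
  have hsub : Set.Ioo (min x₀ x) (max x₀ x) ⊆ {y | iteratedDeriv 2 l y = 0} := by
    intro y hy
    have he : l =ᶠ[𝓝 y] fun _ => l x₀ := by
      filter_upwards [isOpen_Ioo.mem_nhds hy] with z hz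
      exact hc z (Set.Ioo_subset_Icc_self hz)
    have h2 := he.iteratedDeriv_eq 2
    rw [iteratedDeriv_const] at h2
    simpa using h2
  have hx₀ : x₀ ∈ closure (Set.Ioo (min x₀ x) (max x₀ x)) := by
    rw [closure_Ioo hlt.ne]
    exact Set.left_mem_uIcc
  exact h (closure_minimal hsub hcl hx₀)

/-- The quadratic lower bound of a function whose second derivative is bounded below. -/
theorem sub_ge_of_curvature {l : ℝ → ℝ} (hl : ContDiff ℝ 2 l) {b : ℝ}
    (hb : ∀ x, -iteratedDeriv 2 l x ≤ b) (x u : ℝ) :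
    deriv l x * u - b / 2 * u ^ 2 ≤ l (x + u) - l x := by
  -- subtracting the tangent and adding the parabola leaves a convex function with a critical point
  set m : ℝ → ℝ := fun s => l s + b / 2 * (s - x) ^ 2 with hm
  have hl1 : Differentiable ℝ l := hl.differentiable (by norm_num)
  have hl2 : Differentiable ℝ (deriv l) := by
    have h : ContDiff ℝ (1 + 1) l := by simpa [one_add_one_eq_two] using hl
    exact (contDiff_succ_iff_deriv.1 h).2.2.differentiable (by norm_num)
  have hd1 : ∀ s, HasDerivAt m (deriv l s + b * (s - x)) s := by
    intro s
    have h1 : HasDerivAt (fun s => b / 2 * (s - x) ^ 2) (b * (s - x)) s := by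
      have := (((hasDerivAt_id s).sub_const x).pow 2).const_mul (b / 2)
      refine this.congr_deriv ?_
      simp
      ring
    exact (hl1 s).hasDerivAt.add h1
  have hdm : deriv m = fun s => deriv l s + b * (s - x) := funext fun s => (hd1 s).deriv
  have hd2 : ∀ s, HasDerivAt (deriv m) (deriv (deriv l) s + b) s := by
    intro s
    rw [hdm]
    exact ((hl2 s).hasDerivAt.add (((hasDerivAt_id s).sub_const x).const_mul b)).congr_deriv
      (by simp)
  have hconv : ConvexOn ℝ Set.univ m := by
    refine convexOn_univ_of_deriv2_nonneg (fun s => (hd1 s).differentiableAt)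
      (fun s => (hd2 s).differentiableAt) fun s => ?_
    have h2 := hb s
    rw [iteratedDeriv_eq_iterate] at h2
    simp only [Function.iterate_succ, Function.iterate_zero, Function.comp, id] at h2 ⊢
    rw [(hd2 s).deriv]
    linarith
  have hx : HasDerivAt m (deriv l x) x := by simpa using hd1 x
  have hmx : m x = l x := by simp [hm]
  have hmu : m (x + u) = l (x + u) + b / 2 * u ^ 2 := by simp [hm]
  have key : m x + deriv l x * u ≤ m (x + u) := by
    rcases lt_trichotomy u 0 with hu | rfl | hu
    · have := hconv.slope_le_of_hasDerivAt (Set.mem_univ (x + u)) (Set.mem_univ x)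
        (by linarith) hx
      rw [slope_def_field, div_le_iff₀ (by linarith)] at this
      linarith
    · simp
    · have := hconv.le_slope_of_hasDerivAt (Set.mem_univ x) (Set.mem_univ (x + u))
        (by linarith) hx
      rw [slope_def_field, le_div_iff₀ (by linarith)] at this
      linarith
  linarith

end Calculus

/-! ### Principal components -/

section PCA

theorem frobenius_norm_sq {m n : Type*} [Fintype m] [Fintype n] (A : Matrix m n ℝ) :
    ‖A‖ ^ 2 = ∑ i, ∑ j, A i j ^ 2 := by
  rw [Matrix.frobenius_norm_def, ← Real.sqrt_eq_rpow, Real.sq_sqrt]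
  · simp
  · exact Finset.sum_nonneg fun i _ => Finset.sum_nonneg fun j _ => by positivity

theorem frobenius_norm_sq_eq_trace {m n : Type*} [Fintype m] [Fintype n] (A : Matrix m n ℝ) :
    ‖A‖ ^ 2 = (Aᵀ * A).trace := by
  rw [frobenius_norm_sq, Finset.sum_comm]
  simp [Matrix.trace, Matrix.mul_apply, sq]

theorem abs_entry_le_frobenius_norm {m n : Type*} [Fintype m] [Fintype n] (A : Matrix m n ℝ)
    (i : m) (j : n) : |A i j| ≤ ‖A‖ := by
  refine abs_le_of_sq_le_sq ?_ (norm_nonneg _)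
  rw [frobenius_norm_sq]
  exact (Finset.single_le_sum (f := fun j => A i j ^ 2) (fun _ _ => sq_nonneg _)
    (Finset.mem_univ j)).trans (Finset.single_le_sum (f := fun i => ∑ j, A i j ^ 2)
      (fun _ _ => Finset.sum_nonneg fun _ _ => sq_nonneg _) (Finset.mem_univ i))

/-- A matrix with `d` columns is controlled by its Gram matrix. -/
theorem frobenius_norm_sq_le_gram {m : Type*} [Fintype m] {d : ℕ} (A : Matrix m (Fin d) ℝ) :
    ‖A‖ ^ 2 ≤ d * ‖Aᵀ * A‖ := by
  rw [frobenius_norm_sq_eq_trace, Matrix.trace]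
  calc _ ≤ ∑ _i : Fin d, ‖Aᵀ * A‖ := Finset.sum_le_sum fun i _ =>
        (le_abs_self _).trans (abs_entry_le_frobenius_norm _ i i)
    _ = _ := by simp

theorem frobenius_norm_transpose_mul_self {m n : Type*} [Fintype m] [Fintype n]
    (A : Matrix m n ℝ) : ‖Aᵀ * A‖ = ‖A * Aᵀ‖ := by
  rw [← sq_eq_sq₀ (norm_nonneg _) (norm_nonneg _), frobenius_norm_sq_eq_trace,
    frobenius_norm_sq_eq_trace]
  simp only [Matrix.transpose_mul, Matrix.transpose_transpose]
  rw [Matrix.mul_assoc Aᵀ A (Aᵀ * A), Matrix.trace_mul_comm]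
  simp only [Matrix.mul_assoc]

/-- One half of the Courant–Fischer principle: if the quadratic form is at least `κ ‖x‖²` on a
subspace of dimension larger than `j`, then the `j`-th eigenvalue in descending order, counted from
zero, is at least `κ`. -/
theorem le_eigenvalues_of_le_on_range {E : Type*} [NormedAddCommGroup E] [InnerProductSpace ℝ E]
    [FiniteDimensional ℝ E] {A : E →ₗ[ℝ] E} (hA : A.IsSymmetric) {n : ℕ}
    (hn : Module.finrank ℝ E = n) {V : Type*} [AddCommGroup V] [Module ℝ V]
    [FiniteDimensional ℝ V] (L : V →ₗ[ℝ] E) (hL : Function.Injective L) {κ : ℝ}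
    (h : ∀ c, κ * ‖L c‖ ^ 2 ≤ inner ℝ (L c) (A (L c))) (j : Fin n)
    (hj : j.val < Module.finrank ℝ V) : κ ≤ hA.eigenvalues hn j := by
  set b := hA.eigenvectorBasis hn with hb
  -- a nonzero element orthogonal to the first `j` eigenvectors
  let K : V →ₗ[ℝ] (Fin j.val → ℝ) :=
    LinearMap.pi fun i => (innerₛₗ ℝ (b ⟨i.val, i.isLt.trans j.isLt⟩)).comp L
  have hker : LinearMap.ker K ≠ ⊥ := LinearMap.ker_ne_bot_of_finrank_lt (by simpa using hj)
  obtain ⟨c, hcK, hc0⟩ := (Submodule.ne_bot_iff _).1 hker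
  have horth : ∀ i : Fin n, i < j → inner ℝ (b i) (L c) = 0 := by
    intro i hi
    have := congrFun (LinearMap.mem_ker.1 hcK) ⟨i.val, hi⟩
    simpa [K] using this
  have hx0 : L c ≠ 0 := fun h0 => hc0 (hL (by rw [h0, map_zero]))
  have hAx : inner ℝ (L c) (A (L c)) = ∑ i, hA.eigenvalues hn i * inner ℝ (b i) (L c) ^ 2 := by
    rw [← b.sum_inner_mul_inner]
    refine Finset.sum_congr rfl fun i _ => ?_
    have h1 : inner ℝ (b i) (A (L c)) = hA.eigenvalues hn i * inner ℝ (b i) (L c) := by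
      rw [← hA, hb, hA.apply_eigenvectorBasis, real_inner_smul_left]
      rfl
    rw [h1, real_inner_comm]
    ring
  have hxx : ‖L c‖ ^ 2 = ∑ i, inner ℝ (b i) (L c) ^ 2 := by
    rw [← real_inner_self_eq_norm_sq, ← b.sum_inner_mul_inner]
    refine Finset.sum_congr rfl fun i _ => ?_
    rw [real_inner_comm]
    ring
  have hle : inner ℝ (L c) (A (L c)) ≤ hA.eigenvalues hn j * ‖L c‖ ^ 2 := by
    rw [hAx, hxx, Finset.mul_sum]
    refine Finset.sum_le_sum fun i _ => ?_
    rcases lt_or_ge i j with hij | hij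
    · rw [horth i hij]; simp
    · exact mul_le_mul_of_nonneg_right (hA.eigenvalues_antitone hn hij) (sq_nonneg _)
  have hpos : 0 < ‖L c‖ ^ 2 := by positivity
  exact le_of_mul_le_mul_right ((h c).trans hle) hpos

variable {N T d : ℕ}

/-- The common part of `X Xᵀ / (N T)`. -/
noncomputable def commonPart (F : Matrix (Fin T) (Fin d) ℝ) (Λ : Matrix (Fin N) (Fin d) ℝ) :
    Matrix (Fin T) (Fin T) ℝ :=
  ((N : ℝ) * (T : ℝ))⁻¹ • (F * Λᵀ * (F * Λᵀ)ᵀ)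

theorem norm_pcaMatrix_sub_commonPart_le {F : Matrix (Fin T) (Fin d) ℝ}
    {Λ : Matrix (Fin N) (Fin d) ℝ} {Er : Matrix (Fin T) (Fin N) ℝ} (hN : 0 < N) (hT : 0 < T)
    {C θ : ℝ} (hC : 0 ≤ C) (hθ : 0 ≤ θ) (hF : ‖F‖ ^ 2 ≤ C * T) (hΛ : ‖Λ‖ ^ 2 ≤ C * N)
    (hE : ‖Er * Erᵀ‖ ≤ θ * (N * T)) :
    ‖pcaMatrix (F * Λᵀ + Er) - commonPart F Λ‖ ≤ 2 * C * √(d * θ) + θ := by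
  have hN' : (0 : ℝ) < N := by exact_mod_cast hN
  have hT' : (0 : ℝ) < T := by exact_mod_cast hT
  have e1 : pcaMatrix (F * Λᵀ + Er) - commonPart F Λ =
      ((N : ℝ) * (T : ℝ))⁻¹ • (F * (Er * Λ)ᵀ + (Er * Λ) * Fᵀ + Er * Erᵀ) := by
    unfold pcaMatrix commonPart
    rw [← smul_sub]
    congr 1
    simp only [Matrix.transpose_add, Matrix.transpose_mul, Matrix.transpose_transpose,
      Matrix.add_mul, Matrix.mul_add, Matrix.mul_assoc]
    abel
  have h1 : ‖Er * Λ‖ ^ 2 ≤ d * θ * C * N ^ 2 * T := by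
    calc ‖Er * Λ‖ ^ 2 ≤ d * ‖(Er * Λ)ᵀ * (Er * Λ)‖ := frobenius_norm_sq_le_gram _
      _ = d * ‖Λᵀ * (Erᵀ * Er) * Λ‖ := by
          rw [Matrix.transpose_mul]; simp only [Matrix.mul_assoc]
      _ ≤ d * (‖Λ‖ * ‖Er * Erᵀ‖ * ‖Λ‖) := by
          gcongr
          refine (Matrix.frobenius_norm_mul _ _).trans ?_
          gcongr
          refine (Matrix.frobenius_norm_mul _ _).trans ?_
          rw [Matrix.frobenius_norm_transpose, frobenius_norm_transpose_mul_self]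
      _ = d * (‖Λ‖ ^ 2 * ‖Er * Erᵀ‖) := by ring
      _ ≤ d * ((C * N) * (θ * (N * T))) := by gcongr
      _ = _ := by ring
  have h2 : ‖F‖ * ‖Er * Λ‖ ≤ C * √(d * θ) * (N * T) := by
    refine abs_le_of_sq_le_sq' ?_ (by positivity) |>.2
    calc (‖F‖ * ‖Er * Λ‖) ^ 2 = ‖F‖ ^ 2 * ‖Er * Λ‖ ^ 2 := by ring
      _ ≤ (C * T) * (d * θ * C * N ^ 2 * T) := by gcongr
      _ = (C * √(d * θ) * (N * T)) ^ 2 := by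
          rw [mul_pow, mul_pow, Real.sq_sqrt (by positivity)]; ring
  rw [e1, norm_smul, Real.norm_of_nonneg (by positivity), inv_mul_le_iff₀ (by positivity)]
  have h3 : ‖F * (Er * Λ)ᵀ‖ ≤ ‖F‖ * ‖Er * Λ‖ := by
    have := Matrix.frobenius_norm_mul F (Er * Λ)ᵀ
    rwa [Matrix.frobenius_norm_transpose] at this
  have h4 : ‖(Er * Λ) * Fᵀ‖ ≤ ‖F‖ * ‖Er * Λ‖ := by
    rw [mul_comm ‖F‖]
    simpa [Matrix.frobenius_norm_transpose] using Matrix.frobenius_norm_mul (Er * Λ) Fᵀ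
  calc _ ≤ ‖F * (Er * Λ)ᵀ‖ + ‖(Er * Λ) * Fᵀ‖ + ‖Er * Erᵀ‖ := norm_add₃_le
    _ ≤ _ := by linarith

/-- The quadratic form of the common part on the column space of `F`. -/
theorem commonPart_form_ge {F : Matrix (Fin T) (Fin d) ℝ} {Λ : Matrix (Fin N) (Fin d) ℝ}
    (hN : 0 < N) (hT : 0 < T) {κ : ℝ} (hκ : 0 < κ)
    (hF : ∀ c : Matrix (Fin d) Unit ℝ, κ * T * ‖c‖ ^ 2 ≤ ‖F * c‖ ^ 2)
    (hΛ : ∀ c : Matrix (Fin d) Unit ℝ, κ * N * ‖c‖ ^ 2 ≤ ‖Λ * c‖ ^ 2)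
    (c : Matrix (Fin d) Unit ℝ) :
    κ ^ 2 * ‖F * c‖ ^ 2 ≤ ((F * c)ᵀ * commonPart F Λ * (F * c)) () () := by
  have hN' : (0 : ℝ) < N := by exact_mod_cast hN
  have hT' : (0 : ℝ) < T := by exact_mod_cast hT
  set x := F * c with hx
  have hunit : ∀ {m : ℕ} (a : Matrix (Fin m) Unit ℝ), (aᵀ * a) () () = ‖a‖ ^ 2 := by
    intro m a
    rw [frobenius_norm_sq_eq_trace]
    simp [Matrix.trace]
  -- `‖x‖² = cᵀ Fᵀ x ≤ ‖c‖ ‖Fᵀ x‖`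
  have h1 : ‖x‖ ^ 2 ≤ ‖c‖ * ‖Fᵀ * x‖ := by
    have : (xᵀ * x) () () = (cᵀ * (Fᵀ * x)) () () := by
      rw [← Matrix.mul_assoc cᵀ Fᵀ x, ← Matrix.transpose_mul, ← hx]
    rw [← hunit, this]
    refine (le_abs_self _).trans ((abs_entry_le_frobenius_norm _ _ _).trans ?_)
    simpa [Matrix.frobenius_norm_transpose] using Matrix.frobenius_norm_mul cᵀ (Fᵀ * x)
  have h2 : κ * T * ‖x‖ ^ 2 ≤ ‖Fᵀ * x‖ ^ 2 := by
    rcases eq_or_ne x 0 with h0 | h0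
    · rw [h0]; simp
    have hxp : 0 < ‖x‖ ^ 2 := by positivity
    have h3 : (‖x‖ ^ 2) ^ 2 ≤ ‖c‖ ^ 2 * ‖Fᵀ * x‖ ^ 2 := by
      rw [← mul_pow]; gcongr
    have h4 := hF c
    refine le_of_mul_le_mul_right ?_ hxp
    calc κ * T * ‖x‖ ^ 2 * ‖x‖ ^ 2 = κ * T * (‖x‖ ^ 2) ^ 2 := by ring
      _ ≤ κ * T * (‖c‖ ^ 2 * ‖Fᵀ * x‖ ^ 2) := by gcongr
      _ = (κ * T * ‖c‖ ^ 2) * ‖Fᵀ * x‖ ^ 2 := by ring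
      _ ≤ ‖x‖ ^ 2 * ‖Fᵀ * x‖ ^ 2 := by gcongr
      _ = _ := by ring
  have h5 : (xᵀ * commonPart F Λ * x) () () =
      ((N : ℝ) * (T : ℝ))⁻¹ * ‖Λ * (Fᵀ * x)‖ ^ 2 := by
    rw [← hunit]
    unfold commonPart
    rw [Matrix.mul_smul, Matrix.smul_mul, Matrix.smul_apply, smul_eq_mul]
    congr 3
    simp only [Matrix.transpose_mul, Matrix.transpose_transpose, Matrix.mul_assoc]
  rw [h5, le_inv_mul_iff₀ (by positivity)]
  calc (N : ℝ) * T * (κ ^ 2 * ‖x‖ ^ 2) = κ * N * (κ * T * ‖x‖ ^ 2) := by ring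
    _ ≤ κ * N * ‖Fᵀ * x‖ ^ 2 := by gcongr
    _ ≤ _ := hΛ _

/-- A lower bound for the `d` largest eigenvalues of `X Xᵀ / (N T)`. -/
theorem pcaEigenvalues_ge {F : Matrix (Fin T) (Fin d) ℝ} {Λ : Matrix (Fin N) (Fin d) ℝ}
    {X : Matrix (Fin T) (Fin N) ℝ} (hN : 0 < N) (hT : 0 < T) (hdT : d ≤ T) {κ τ : ℝ} (hκ : 0 < κ)
    (hF : ∀ c : Matrix (Fin d) Unit ℝ, κ * T * ‖c‖ ^ 2 ≤ ‖F * c‖ ^ 2)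
    (hΛ : ∀ c : Matrix (Fin d) Unit ℝ, κ * N * ‖c‖ ^ 2 ≤ ‖Λ * c‖ ^ 2)
    (hτ : ‖pcaMatrix X - commonPart F Λ‖ ≤ τ) (j : Fin d) :
    κ ^ 2 - τ ≤ pcaEigenvalues d X j := by
  have hT' : (0 : ℝ) < T := by exact_mod_cast hT
  have hjT : j.val < Fintype.card (Fin T) := by simpa using j.isLt.trans_le hdT
  unfold pcaEigenvalues
  rw [dif_pos hjT]
  unfold Matrix.IsHermitian.eigenvalues₀
  let L : (Fin d → ℝ) →ₗ[ℝ] EuclideanSpace ℝ (Fin T) :=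
    (WithLp.linearEquiv 2 ℝ (Fin T → ℝ)).symm.toLinearMap ∘ₗ Matrix.mulVecLin F
  have hcol : ∀ c : Fin d → ℝ, F * Matrix.replicateCol Unit c =
      Matrix.replicateCol Unit (F *ᵥ c) := fun c => (Matrix.replicateCol_mulVec _ _).symm
  have hLn : ∀ c, ‖L c‖ = ‖F * Matrix.replicateCol Unit c‖ := by
    intro c
    rw [hcol, Matrix.frobenius_norm_replicateCol]
    rfl
  refine le_eigenvalues_of_le_on_range _ _ L ?_ ?_ _ (by simp)
  · rw [← LinearMap.ker_eq_bot, LinearMap.ker_eq_bot']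
    intro c hc
    have h1 := hF (Matrix.replicateCol Unit c)
    rw [← hLn, hc, norm_zero, Matrix.frobenius_norm_replicateCol] at h1
    have h2 : ‖WithLp.toLp 2 c‖ ^ 2 ≤ 0 := by
      have : 0 < κ * T := by positivity
      nlinarith
    have h3 : ‖WithLp.toLp 2 c‖ = 0 := by nlinarith [norm_nonneg (WithLp.toLp 2 c)]
    have h4 : WithLp.toLp 2 c = 0 := norm_eq_zero.1 h3
    simpa using h4
  · intro c
    set x := F * Matrix.replicateCol Unit c with hx
    have h1 : inner ℝ (L c) (Matrix.toEuclideanLin (pcaMatrix X) (L c)) =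
        (xᵀ * pcaMatrix X * x) () () := by
      rw [hx, hcol, Matrix.mul_assoc, ← Matrix.replicateCol_mulVec, Matrix.transpose_replicateCol,
        Matrix.replicateRow_mul_replicateCol_apply, EuclideanSpace.inner_eq_star_dotProduct,
        dotProduct_comm]
      simp [L]
    have h2 := commonPart_form_ge hN hT hκ hF hΛ (Matrix.replicateCol Unit c)
    rw [← hx] at h2
    have h3 : |(xᵀ * (pcaMatrix X - commonPart F Λ) * x) () ()| ≤ τ * ‖x‖ ^ 2 := by
      refine (abs_entry_le_frobenius_norm _ _ _).trans ?_
      calc _ ≤ ‖xᵀ‖ * ‖pcaMatrix X - commonPart F Λ‖ * ‖x‖ :=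
            (Matrix.frobenius_norm_mul _ _).trans (by
              gcongr; exact Matrix.frobenius_norm_mul _ _)
        _ ≤ ‖xᵀ‖ * τ * ‖x‖ := by gcongr
        _ = _ := by rw [Matrix.frobenius_norm_transpose]; ring
    rw [Matrix.mul_sub, Matrix.sub_mul, Matrix.sub_apply] at h3
    rw [h1, hLn, ← hx]
    have := (abs_le.1 h3).1
    linarith

/-- The principal components estimate the rotated factors, with an error controlled by the distance
of `X Xᵀ / (N T)` from its common part. -/
theorem pca_consistency {F Ft : Matrix (Fin T) (Fin d) ℝ} {Λ : Matrix (Fin N) (Fin d) ℝ}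
    {X : Matrix (Fin T) (Fin N) ℝ} (hN : 0 < N) (hT : 0 < T) (hdT : d ≤ T) {κ τ C : ℝ} (hκ : 0 < κ)
    (hF : ∀ c : Matrix (Fin d) Unit ℝ, κ * T * ‖c‖ ^ 2 ≤ ‖F * c‖ ^ 2)
    (hΛ : ∀ c : Matrix (Fin d) Unit ℝ, κ * N * ‖c‖ ^ 2 ≤ ‖Λ * c‖ ^ 2)
    (hC : 0 ≤ C) (hFC : ‖F‖ ^ 2 ≤ C * T)
    (hτ : ‖pcaMatrix X - commonPart F Λ‖ ≤ τ) (hτκ : τ ≤ κ ^ 2 / 2)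
    (hτd : 4 * (d : ℝ) ^ 2 * τ ≤ κ ^ 2) (hFt : IsPCAFactor X Ft) :
    IsUnit (pcaV d X) ∧ IsUnit (pcaRotation Λ F Ft (pcaV d X)) ∧
      ‖(pcaRotation Λ F Ft (pcaV d X))⁻¹‖ ≤ 2 * √(d * C) ∧
      ‖Ft * (pcaRotation Λ F Ft (pcaV d X))⁻¹ - F‖ ^ 2 ≤
        16 * (d : ℝ) ^ 3 * C / κ ^ 4 * τ ^ 2 * T := by
  have hT' : (0 : ℝ) < T := by exact_mod_cast hT
  have hτ0 : 0 ≤ τ := (norm_nonneg _).trans hτ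
  have hκ2 : 0 < κ ^ 2 := by positivity
  set V := pcaV d X with hV
  set H := pcaRotation Λ F Ft V with hH
  have hev : ∀ j, κ ^ 2 / 2 ≤ pcaEigenvalues d X j := fun j =>
    le_trans (by linarith) (pcaEigenvalues_ge hN hT hdT hκ hF hΛ hτ j)
  have hev0 : ∀ j, 0 < pcaEigenvalues d X j := fun j => lt_of_lt_of_le (by positivity) (hev j)
  have hVu : IsUnit V := by
    rw [Matrix.isUnit_iff_isUnit_det, hV, pcaV, Matrix.det_diagonal, isUnit_iff_ne_zero]
    exact Finset.prod_ne_zero_iff.2 fun j _ => (hev0 j).ne'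
  have hVd : IsUnit V.det := (Matrix.isUnit_iff_isUnit_det _).1 hVu
  have hVinv : ‖V⁻¹‖ ≤ 2 * √d / κ ^ 2 := by
    have e : V⁻¹ = Matrix.diagonal fun j => (pcaEigenvalues d X j)⁻¹ := by
      refine Matrix.inv_eq_right_inv ?_
      rw [hV, pcaV, Matrix.diagonal_mul_diagonal, ← Matrix.diagonal_one]
      congr 1
      ext j
      exact mul_inv_cancel₀ (hev0 j).ne'
    refine abs_le_of_sq_le_sq' ?_ (by positivity) |>.2
    rw [e, frobenius_norm_sq]
    have h1 : ∀ i, ∑ j, (Matrix.diagonal fun j => (pcaEigenvalues d X j)⁻¹) i j ^ 2 ≤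
        (2 / κ ^ 2) ^ 2 := by
      intro i
      rw [Finset.sum_eq_single i (fun j _ hj => by simp [Matrix.diagonal_apply_ne' _ hj])
        (by simp), Matrix.diagonal_apply_eq]
      refine pow_le_pow_left₀ (inv_pos.2 (hev0 i)).le ?_ 2
      rw [inv_le_comm₀ (hev0 i) (by positivity), inv_div]
      exact hev i
    calc _ ≤ ∑ _i : Fin d, (2 / κ ^ 2) ^ 2 := Finset.sum_le_sum fun i _ => h1 i
      _ = (2 * √d / κ ^ 2) ^ 2 := by
          simp only [Finset.sum_const, Finset.card_univ, Fintype.card_fin, nsmul_eq_mul]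
          rw [div_pow, div_pow, mul_pow, Real.sq_sqrt (Nat.cast_nonneg d)]
          ring
  have hFtn : ‖Ft‖ ^ 2 = T * d := by
    have h1 : Ftᵀ * Ft = (T : ℝ) • (1 : Matrix (Fin d) (Fin d) ℝ) := by
      rw [← hFt.2, smul_smul, mul_inv_cancel₀ hT'.ne', one_smul]
    rw [frobenius_norm_sq_eq_trace, h1, Matrix.trace_smul, Matrix.trace_one]
    simp
  have hFtn' : ‖Ft‖ = √T * √d := by
    rw [← Real.sqrt_mul hT'.le, ← hFtn, Real.sqrt_sq (norm_nonneg _)]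
  -- `Ft - F H = (X Xᵀ / (N T) - F Λᵀ Λ Fᵀ / (N T)) Ft V⁻¹`
  have hD : Ft - F * H = (pcaMatrix X - commonPart F Λ) * Ft * V⁻¹ := by
    have e1 : pcaMatrix X * Ft * V⁻¹ = Ft := by
      rw [hFt.1, Matrix.mul_assoc, Matrix.mul_nonsing_inv _ hVd, Matrix.mul_one]
    have e2 : commonPart F Λ * Ft * V⁻¹ = F * H := by
      rw [hH, pcaRotation, commonPart, mul_inv, mul_comm (N : ℝ)⁻¹]
      simp only [Matrix.transpose_mul, Matrix.transpose_transpose, Matrix.mul_assoc,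
        Matrix.smul_mul, Matrix.mul_smul, smul_smul]
    rw [Matrix.sub_mul, Matrix.sub_mul, e1, e2]
  have hDn : ‖Ft - F * H‖ ≤ √T * (2 * d * τ / κ ^ 2) := by
    rw [hD]
    calc _ ≤ ‖pcaMatrix X - commonPart F Λ‖ * ‖Ft‖ * ‖V⁻¹‖ :=
          (Matrix.frobenius_norm_mul _ _).trans (by
            gcongr; exact Matrix.frobenius_norm_mul _ _)
      _ ≤ τ * (√T * √d) * (2 * √d / κ ^ 2) := by rw [hFtn']; gcongr
      _ = √T * (2 * (√d * √d) * τ / κ ^ 2) := by ring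
      _ = _ := by rw [Real.mul_self_sqrt (Nat.cast_nonneg d)]
  -- `G H = 1 - P` with `‖P‖ ≤ 1 / 2`, so that `H` is invertible and `‖H⁻¹‖ ≤ 2 ‖G‖`
  set P : Matrix (Fin d) (Fin d) ℝ := (T : ℝ)⁻¹ • (Ftᵀ * (Ft - F * H)) with hP
  set G : Matrix (Fin d) (Fin d) ℝ := (T : ℝ)⁻¹ • (Ftᵀ * F) with hG
  have hPn : ‖P‖ ≤ 1 / 2 := by
    have hd1 : √d * d ≤ (d : ℝ) ^ 2 := by
      rcases Nat.eq_zero_or_pos d with h0 | h0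
      · simp [h0]
      have h1 : (1 : ℝ) ≤ d := by exact_mod_cast h0
      have h2 : √d ≤ (d : ℝ) := Real.sqrt_le_iff.2 ⟨by positivity, by nlinarith⟩
      nlinarith
    rw [hP, norm_smul, Real.norm_of_nonneg (by positivity), inv_mul_le_iff₀ hT']
    calc _ ≤ ‖Ftᵀ‖ * ‖Ft - F * H‖ := Matrix.frobenius_norm_mul _ _
      _ ≤ (√T * √d) * (√T * (2 * d * τ / κ ^ 2)) := by
          rw [Matrix.frobenius_norm_transpose, hFtn']; gcongr
      _ = (√T * √T) * (2 * (√d * d) * τ / κ ^ 2) := by ring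
      _ ≤ T * (2 * (d : ℝ) ^ 2 * τ / κ ^ 2) := by
          rw [Real.mul_self_sqrt hT'.le]; gcongr
      _ ≤ T * (1 / 2) := by
          refine mul_le_mul_of_nonneg_left ?_ hT'.le
          rw [div_le_iff₀ hκ2]
          linarith
  have hGH : G * H = 1 - P := by
    rw [hP, hG, Matrix.mul_sub, smul_sub, hFt.2, Matrix.smul_mul, Matrix.mul_assoc]
    abel
  have hGHu : IsUnit (G * H) := by
    rw [hGH]
    exact isUnit_one_sub_of_norm_lt_one (lt_of_le_of_lt hPn (by norm_num))
  have hHu : IsUnit H := by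
    rw [Matrix.isUnit_iff_isUnit_det] at hGHu ⊢
    rw [Matrix.det_mul] at hGHu
    exact isUnit_of_mul_isUnit_right hGHu
  have hHd : IsUnit H.det := (Matrix.isUnit_iff_isUnit_det _).1 hHu
  have hHinv : ‖H⁻¹‖ ≤ 2 * √(d * C) := by
    have h1 : G = H⁻¹ - P * H⁻¹ := by
      calc G = G * H * H⁻¹ := by
            rw [Matrix.mul_assoc, Matrix.mul_nonsing_inv _ hHd, Matrix.mul_one]
        _ = _ := by rw [hGH, Matrix.sub_mul, Matrix.one_mul]
    have h2 : ‖H⁻¹‖ ≤ ‖G‖ + ‖P * H⁻¹‖ := by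
      calc ‖H⁻¹‖ = ‖G + P * H⁻¹‖ := by rw [h1]; congr 1; simp
        _ ≤ _ := norm_add_le _ _
    have h3 : ‖P * H⁻¹‖ ≤ 1 / 2 * ‖H⁻¹‖ :=
      (Matrix.frobenius_norm_mul _ _).trans (by gcongr)
    have hFs : ‖F‖ ≤ √C * √T := by
      rw [← Real.sqrt_mul hC]
      exact Real.le_sqrt_of_sq_le hFC
    have h4 : ‖G‖ ≤ √(d * C) := by
      rw [hG, norm_smul, Real.norm_of_nonneg (by positivity), inv_mul_le_iff₀ hT']
      calc _ ≤ ‖Ftᵀ‖ * ‖F‖ := Matrix.frobenius_norm_mul _ _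
        _ ≤ (√T * √d) * (√C * √T) := by
            rw [Matrix.frobenius_norm_transpose, hFtn']; gcongr
        _ = (√T * √T) * (√d * √C) := by ring
        _ = _ := by rw [Real.mul_self_sqrt hT'.le, Real.sqrt_mul (Nat.cast_nonneg d)]
    linarith
  refine ⟨hVu, hHu, hHinv, ?_⟩
  have e : Ft * H⁻¹ - F = (Ft - F * H) * H⁻¹ := by
    rw [Matrix.sub_mul, Matrix.mul_assoc F, Matrix.mul_nonsing_inv _ hHd, Matrix.mul_one]
  rw [e]
  have h5 : ‖(Ft - F * H) * H⁻¹‖ ≤ √T * (2 * d * τ / κ ^ 2) * (2 * √(d * C)) :=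
    (Matrix.frobenius_norm_mul _ _).trans (by gcongr)
  calc _ ≤ (√T * (2 * d * τ / κ ^ 2) * (2 * √(d * C))) ^ 2 := by gcongr
    _ = (√T) ^ 2 * (2 * d * τ / κ ^ 2) ^ 2 * (4 * (√(d * C)) ^ 2) := by ring
    _ = _ := by
        rw [Real.sq_sqrt hT'.le, Real.sq_sqrt (by positivity)]
        field_simp
        ring

end PCA

/-! ### The error matrix -/

section ErrorMatrix

variable {Ω : Type*} {mΩ : MeasurableSpace Ω} {μ : Measure Ω} [IsProbabilityMeasure μ]

theorem integrable_norm_pow_four {F : Type*} [NormedAddCommGroup F] {X : Ω → F}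
    (hX : AEStronglyMeasurable X μ) {δ : ℝ} (hδ : 0 < δ) {M : ℝ≥0}
    (hM : ∫⁻ ω, ‖X ω‖ₑ ^ (4 + δ) ∂μ ≤ M) :
    Integrable (fun ω => ‖X ω‖ ^ 4) μ ∧ ∫ ω, ‖X ω‖ ^ 4 ∂μ ≤ 1 + M := by
  have h1 : ∫⁻ ω, ‖‖X ω‖ ^ 4‖ₑ ∂μ ≤ 1 + M := by
    calc ∫⁻ ω, ‖‖X ω‖ ^ 4‖ₑ ∂μ ≤ ∫⁻ ω, (1 + ‖X ω‖ₑ ^ (4 + δ)) ∂μ := by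
          refine lintegral_mono fun ω => ?_
          rw [enorm_pow, enorm_norm]
          rcases le_total ‖X ω‖ₑ 1 with h | h
          · exact (pow_le_one₀ zero_le h).trans le_self_add
          · refine le_trans ?_ le_add_self
            rw [← ENNReal.rpow_natCast]
            exact ENNReal.rpow_le_rpow_of_exponent_le h (by norm_num; exact hδ.le)
      _ = 1 + ∫⁻ ω, ‖X ω‖ₑ ^ (4 + δ) ∂μ := by
          rw [lintegral_add_left measurable_const]
          simp
      _ ≤ 1 + M := by gcongr
  have hm : AEStronglyMeasurable (fun ω => ‖X ω‖ ^ 4) μ := hX.norm.pow 4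
  have hi : Integrable (fun ω => ‖X ω‖ ^ 4) μ :=
    ⟨hm, h1.trans_lt (by simp)⟩
  refine ⟨hi, ?_⟩
  have h2 := ofReal_integral_norm_eq_lintegral_enorm hi
  have h3 : ∫ ω, ‖‖X ω‖ ^ 4‖ ∂μ = ∫ ω, ‖X ω‖ ^ 4 ∂μ := by simp
  rw [h3] at h2
  have h4 : ENNReal.ofReal (∫ ω, ‖X ω‖ ^ 4 ∂μ) ≤ ENNReal.ofReal (1 + M) := by
    rw [h2, ENNReal.ofReal_add zero_le_one M.coe_nonneg]
    simpa using h1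
  exact (ENNReal.ofReal_le_ofReal_iff (by positivity)).1 h4

theorem integrable_norm_sq_of_pow_four {F : Type*} [NormedAddCommGroup F] {X : Ω → F}
    (hX : AEStronglyMeasurable X μ) (h4 : Integrable (fun ω => ‖X ω‖ ^ 4) μ) :
    Integrable (fun ω => ‖X ω‖ ^ 2) μ ∧ ∫ ω, ‖X ω‖ ^ 2 ∂μ ≤ 1 + ∫ ω, ‖X ω‖ ^ 4 ∂μ := by
  have hle : ∀ ω, ‖X ω‖ ^ 2 ≤ 1 + ‖X ω‖ ^ 4 := fun ω => by
    nlinarith [sq_nonneg (‖X ω‖ ^ 2 - 1)]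
  have hi : Integrable (fun ω => ‖X ω‖ ^ 2) μ :=
    ((integrable_const 1).add h4).mono' (hX.norm.pow 2) (ae_of_all _ fun ω => by
      rw [Real.norm_of_nonneg (by positivity)]; exact hle ω)
  refine ⟨hi, ?_⟩
  have := integral_mono hi ((integrable_const (1 : ℝ)).add h4) hle
  simp only [Pi.add_apply] at this
  rw [integral_add (integrable_const _) h4] at this
  simpa using this

/-- Truncation of a real number to `[-K, K]`. -/
def clamp (K v : ℝ) : ℝ := max (-K) (min v K)

theorem abs_clamp_le {K : ℝ} (hK : 0 ≤ K) (v : ℝ) : |clamp K v| ≤ K :=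
  abs_le.2 ⟨le_max_left _ _, max_le (by linarith) (min_le_right _ _)⟩

theorem measurable_clamp (K : ℝ) : Measurable (clamp K) :=
  measurable_const.max (measurable_id.min measurable_const)

theorem sq_sub_clamp_le {K : ℝ} (hK : 0 < K) (v : ℝ) :
    (v - clamp K v) ^ 2 ≤ (K ^ 2)⁻¹ * v ^ 4 := by
  have h1 : |v - clamp K v| ≤ K⁻¹ * v ^ 2 := by
    rw [le_inv_mul_iff₀ hK]
    unfold clamp
    rcases le_total v K with h | h
    · rw [min_eq_left h]
      rcases le_total (-K) v with h' | h'
      · rw [max_eq_right h']; simpa using sq_nonneg v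
      · rw [max_eq_left h', abs_of_nonpos (by linarith)]; nlinarith
    · rw [min_eq_right h, max_eq_right (by linarith), abs_of_nonneg (by linarith)]; nlinarith
  calc (v - clamp K v) ^ 2 = |v - clamp K v| ^ 2 := (sq_abs _).symm
    _ ≤ (K⁻¹ * v ^ 2) ^ 2 := by gcongr
    _ = _ := by rw [mul_pow, inv_pow]; ring

theorem integral_sub_mean_sq_le {Y : Ω → ℝ} (hY : Integrable Y μ)
    (hY2 : Integrable (fun ω => Y ω ^ 2) μ) :
    Integrable (fun ω => (Y ω - ∫ ω, Y ω ∂μ) ^ 2) μ ∧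
      ∫ ω, (Y ω - ∫ ω, Y ω ∂μ) ^ 2 ∂μ ≤ ∫ ω, Y ω ^ 2 ∂μ := by
  set m := ∫ ω, Y ω ∂μ with hm
  have e : ∀ ω, (Y ω - m) ^ 2 = Y ω ^ 2 - (2 * m * Y ω - m ^ 2) := fun ω => by ring
  have i1 : Integrable (fun ω => 2 * m * Y ω - m ^ 2) μ :=
    (hY.const_mul _).sub (integrable_const _)
  simp only [e]
  refine ⟨hY2.sub i1, ?_⟩
  rw [integral_sub hY2 i1, integral_sub (hY.const_mul _) (integrable_const _), integral_const_mul,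
    ← hm]
  simp only [integral_const, probReal_univ, one_smul]
  nlinarith [sq_nonneg m]

/-- The truncated and centred error. -/
noncomputable def truncErr (μ : Measure Ω) (e : ℕ → ℕ → Ω → ℝ) (K : ℝ) (i t : ℕ) (ω : Ω) : ℝ :=
  clamp K (e i t ω) - ∫ ω, clamp K (e i t ω) ∂μ

/-- The matrix of the variables `x i t`, with the time index first. -/
def panelMatrix (N T : ℕ) (x : ℕ → ℕ → ℝ) : Matrix (Fin T) (Fin N) ℝ :=
  Matrix.of fun (t : Fin T) (i : Fin N) => x i t

variable {e : ℕ → ℕ → Ω → ℝ}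

theorem integrable_clamp (he : ∀ i t, Measurable (e i t)) {K : ℝ} (hK : 0 ≤ K) (i t : ℕ) :
    Integrable (fun ω => clamp K (e i t ω)) μ :=
  Integrable.of_bound ((measurable_clamp K).comp (he i t)).aestronglyMeasurable K
    (ae_of_all _ fun _ => abs_clamp_le hK _)

theorem abs_truncErr_le {K : ℝ} (hK : 0 ≤ K) (i t : ℕ) (ω : Ω) :
    |truncErr μ e K i t ω| ≤ 2 * K := by
  have h1 := abs_clamp_le hK (e i t ω)
  have h2 : |∫ ω, clamp K (e i t ω) ∂μ| ≤ K := by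
    have := norm_integral_le_of_norm_le_const (μ := μ) (f := fun ω => clamp K (e i t ω))
      (ae_of_all _ fun ω => abs_clamp_le hK (e i t ω))
    simpa using this
  unfold truncErr
  calc _ ≤ |clamp K (e i t ω)| + |∫ ω, clamp K (e i t ω) ∂μ| := abs_sub _ _
    _ ≤ _ := by linarith

theorem integral_truncErr (he : ∀ i t, Measurable (e i t)) {K : ℝ} (hK : 0 ≤ K) (i t : ℕ) :
    ∫ ω, truncErr μ e K i t ω ∂μ = 0 := by
  unfold truncErr
  rw [integral_sub (integrable_clamp he hK i t) (integrable_const _)]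
  simp

omit [IsProbabilityMeasure μ] in
theorem measurable_truncErr_sigmaOn (K : ℝ) (i t : ℕ) {I : Set ℕ} (ht : t ∈ I) :
    Measurable[sigmaOn (e i) I] (truncErr μ e K i t) := by
  have h := measurable_sigmaOn (e i) ht
  exact ((measurable_clamp K).comp h).sub measurable_const

omit [IsProbabilityMeasure μ] in
theorem measurable_truncErr (he : ∀ i t, Measurable (e i t)) (K : ℝ) (i t : ℕ) :
    Measurable (truncErr μ e K i t) :=
  ((measurable_clamp K).comp (he i t)).sub measurable_const

/-- The mixing coefficient of a series with itself, with the trivial bound at lag zero. -/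
noncomputable def serialCoeff (μ : Measure Ω) (e : ℕ → ℕ → Ω → ℝ) (i n : ℕ) : ℝ :=
  if n = 0 then 1 else (mixCoeff μ (e i) (e i) n).toReal

omit [IsProbabilityMeasure μ] in
theorem serialCoeff_nonneg (i n : ℕ) : 0 ≤ serialCoeff μ e i n := by
  unfold serialCoeff
  split_ifs
  · exact zero_le_one
  · exact ENNReal.toReal_nonneg

theorem abs_integral_truncErr_mul_le (he : ∀ i t, Measurable (e i t)) {K : ℝ} (hK : 0 ≤ K)
    (i t s : ℕ) : |∫ ω, truncErr μ e K i t ω * truncErr μ e K i s ω ∂μ| ≤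
      16 * K ^ 2 * serialCoeff μ e i (Nat.dist t s) := by
  unfold serialCoeff
  split_ifs with h
  · have h1 := norm_integral_le_of_norm_le_const (μ := μ)
      (f := fun ω => truncErr μ e K i t ω * truncErr μ e K i s ω) (C := 2 * K * (2 * K))
      (ae_of_all _ fun ω => by
        rw [Real.norm_eq_abs, abs_mul]
        exact mul_le_mul (abs_truncErr_le hK i t ω) (abs_truncErr_le hK i s ω) (abs_nonneg _)
          (by positivity))
    rw [Real.norm_eq_abs, probReal_univ] at h1
    nlinarith [sq_nonneg K]
  · have h1 := abs_cov_le_alphaCoeff (μ := μ) (sigmaOn_le (he i) {t}) (sigmaOn_le (he i) {s})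
      (measurable_truncErr_sigmaOn (μ := μ) K i t (Set.mem_singleton t)) (abs_truncErr_le hK i t)
      (measurable_truncErr_sigmaOn (μ := μ) K i s (Set.mem_singleton s)) (abs_truncErr_le hK i s)
    rw [integral_truncErr he hK, zero_mul, sub_zero] at h1
    have h2 := alphaCoeff_toReal_le_mixCoeff (μ := μ) (e i) (e i) (n := Nat.dist t s)
      (Set.ordConnected_singleton (a := t)) (Set.ordConnected_singleton (a := s))
      (by
        rintro _ rfl _ rfl
        simp only [Nat.dist]
        omega)
    calc _ ≤ _ := h1
      _ ≤ 4 * (2 * K) * (2 * K) * (mixCoeff μ (e i) (e i) (Nat.dist t s)).toReal := by gcongr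
      _ = _ := by ring

theorem integral_truncErr_four_le (he : ∀ i t, Measurable (e i t)) {K : ℝ} (hK : 0 ≤ K)
    (i j t s : ℕ) :
    ∫ ω, (truncErr μ e K i t ω * truncErr μ e K i s ω) *
      (truncErr μ e K j t ω * truncErr μ e K j s ω) ∂μ ≤
      64 * K ^ 4 * ((mixCoeff μ (e i) (e j) 0).toReal + serialCoeff μ e i (Nat.dist t s)) := by
  have hb : ∀ i ω, |truncErr μ e K i t ω * truncErr μ e K i s ω| ≤ 4 * K ^ 2 := fun i ω => by
    rw [abs_mul]
    calc _ ≤ 2 * K * (2 * K) :=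
          mul_le_mul (abs_truncErr_le hK i t ω) (abs_truncErr_le hK i s ω) (abs_nonneg _)
            (by positivity)
      _ = _ := by ring
  have h1 := abs_cov_le_alphaCoeff (μ := μ) (sigmaOn_le (he i) Set.univ)
    (sigmaOn_le (he j) Set.univ)
    ((measurable_truncErr_sigmaOn (μ := μ) K i t (Set.mem_univ t)).mul
      (measurable_truncErr_sigmaOn (μ := μ) K i s (Set.mem_univ s))) (hb i)
    ((measurable_truncErr_sigmaOn (μ := μ) K j t (Set.mem_univ t)).mul
      (measurable_truncErr_sigmaOn (μ := μ) K j s (Set.mem_univ s))) (hb j)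
  have h2 := alphaCoeff_toReal_le_mixCoeff (μ := μ) (e i) (e j) (n := 0)
    Set.ordConnected_univ Set.ordConnected_univ (by intro s _ t _; omega)
  have h3 := abs_integral_truncErr_mul_le (μ := μ) he hK i t s
  have h4 : |∫ ω, truncErr μ e K j t ω * truncErr μ e K j s ω ∂μ| ≤ 4 * K ^ 2 := by
    have := norm_integral_le_of_norm_le_const (μ := μ)
      (f := fun ω => truncErr μ e K j t ω * truncErr μ e K j s ω) (ae_of_all _ fun ω => hb j ω)
    simpa using this
  have h5 : |(∫ ω, truncErr μ e K i t ω * truncErr μ e K i s ω ∂μ) *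
      ∫ ω, truncErr μ e K j t ω * truncErr μ e K j s ω ∂μ| ≤
      16 * K ^ 2 * serialCoeff μ e i (Nat.dist t s) * (4 * K ^ 2) := by
    rw [abs_mul]
    exact mul_le_mul h3 h4 (abs_nonneg _)
      (mul_nonneg (by positivity) (serialCoeff_nonneg _ _))
  have h6 : 4 * (4 * K ^ 2) * (4 * K ^ 2) *
      (alphaCoeff μ (sigmaOn (e i) Set.univ) (sigmaOn (e j) Set.univ)).toReal ≤
      64 * K ^ 4 * (mixCoeff μ (e i) (e j) 0).toReal := by
    calc _ = 64 * K ^ 4 * (alphaCoeff μ (sigmaOn (e i) Set.univ)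
          (sigmaOn (e j) Set.univ)).toReal := by ring
      _ ≤ _ := by gcongr
  have h7 := (abs_le.1 h1).2
  have h8 := (abs_le.1 h5).2
  simp only [Pi.mul_apply] at h7
  linarith

theorem norm_panel_mul_transpose_sq (N T : ℕ) (x : ℕ → ℕ → ℝ) :
    ‖panelMatrix N T x * (panelMatrix N T x)ᵀ‖ ^ 2 =
      ∑ t ∈ Finset.range T, ∑ s ∈ Finset.range T, ∑ i ∈ Finset.range N, ∑ j ∈ Finset.range N,
        (x i t * x i s) * (x j t * x j s) := by
  rw [frobenius_norm_sq, ← Fin.sum_univ_eq_sum_range (fun t => ∑ s ∈ Finset.range T,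
    ∑ i ∈ Finset.range N, ∑ j ∈ Finset.range N, (x i t * x i s) * (x j t * x j s))]
  refine Finset.sum_congr rfl fun t _ => ?_
  rw [← Fin.sum_univ_eq_sum_range (fun s => ∑ i ∈ Finset.range N, ∑ j ∈ Finset.range N,
    (x i t * x i s) * (x j t * x j s))]
  refine Finset.sum_congr rfl fun s _ => ?_
  have : (panelMatrix N T x * (panelMatrix N T x)ᵀ) t s =
      ∑ i ∈ Finset.range N, x i t * x i s := by
    rw [← Fin.sum_univ_eq_sum_range (fun i => x i t * x i s)]
    simp [panelMatrix, Matrix.mul_apply]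
  rw [this, sq, Finset.sum_mul_sum]

theorem norm_panel_sq (N T : ℕ) (x : ℕ → ℕ → ℝ) :
    ‖panelMatrix N T x‖ ^ 2 = ∑ t ∈ Finset.range T, ∑ i ∈ Finset.range N, x i t ^ 2 := by
  rw [frobenius_norm_sq, ← Fin.sum_univ_eq_sum_range (fun t => ∑ i ∈ Finset.range N, x i t ^ 2)]
  refine Finset.sum_congr rfl fun t _ => ?_
  rw [← Fin.sum_univ_eq_sum_range (fun i => x i t ^ 2)]
  rfl

/-- The second moment of the Gram matrix of the truncated errors: weak dependence across units
controls the fluctuations, weak dependence over time controls the means. -/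
theorem integral_norm_truncPanel_le (he : ∀ i t, Measurable (e i t)) {K : ℝ} (hK : 0 ≤ K)
    {C D : ℝ} {N T : ℕ}
    (hC : ∑ i ∈ Finset.range N, ∑ j ∈ Finset.range N, (mixCoeff μ (e i) (e j) 0).toReal ≤ C * N)
    (hD : ∀ i n, ∑ k ∈ Finset.range n, serialCoeff μ e i k ≤ D) :
    Integrable (fun ω => ‖panelMatrix N T (fun i t => truncErr μ e K i t ω) *
        (panelMatrix N T fun i t => truncErr μ e K i t ω)ᵀ‖ ^ 2) μ ∧
    ∫ ω, ‖panelMatrix N T (fun i t => truncErr μ e K i t ω) *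
        (panelMatrix N T fun i t => truncErr μ e K i t ω)ᵀ‖ ^ 2 ∂μ ≤
      64 * K ^ 4 * (C * N * T ^ 2 + 2 * D * N ^ 2 * T) := by
  have hi : ∀ i j t s, Integrable (fun ω => (truncErr μ e K i t ω * truncErr μ e K i s ω) *
      (truncErr μ e K j t ω * truncErr μ e K j s ω)) μ := fun i j t s => by
    have hm := measurable_truncErr (μ := μ) he K
    refine Integrable.of_bound (((hm i t).mul (hm i s)).mul
      ((hm j t).mul (hm j s))).aestronglyMeasurable ((2 * K * (2 * K)) * (2 * K * (2 * K)))
      (ae_of_all _ fun ω => ?_)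
    simp only [norm_mul, Real.norm_eq_abs]
    have hb := fun i t => abs_truncErr_le (μ := μ) (e := e) hK i t ω
    gcongr <;> exact hb _ _
  simp only [norm_panel_mul_transpose_sq]
  have hi1 := fun t s i => integrable_finsetSum (Finset.range N) fun j _ => hi i j t s
  have hi2 := fun t s => integrable_finsetSum (Finset.range N) fun i _ => hi1 t s i
  have hi3 := fun t => integrable_finsetSum (Finset.range T) fun s _ => hi2 t s
  refine ⟨integrable_finsetSum _ fun t _ => hi3 t, ?_⟩
  rw [integral_finsetSum _ fun t _ => hi3 t]
  have h1 : ∀ t ∈ Finset.range T, ∫ ω, ∑ s ∈ Finset.range T, ∑ i ∈ Finset.range N,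
      ∑ j ∈ Finset.range N, (truncErr μ e K i t ω * truncErr μ e K i s ω) *
      (truncErr μ e K j t ω * truncErr μ e K j s ω) ∂μ ≤
      64 * K ^ 4 * (T * (C * N) + N * (N * (2 * D))) := by
    intro t ht
    rw [integral_finsetSum _ fun s _ => hi2 t s]
    have h2 : ∀ s ∈ Finset.range T, ∫ ω, ∑ i ∈ Finset.range N,
        ∑ j ∈ Finset.range N, (truncErr μ e K i t ω * truncErr μ e K i s ω) *
        (truncErr μ e K j t ω * truncErr μ e K j s ω) ∂μ ≤
        64 * K ^ 4 * (C * N + N * ∑ i ∈ Finset.range N, serialCoeff μ e i (Nat.dist t s)) := by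
      intro s _
      rw [integral_finsetSum _ fun i _ => hi1 t s i]
      calc _ ≤ ∑ i ∈ Finset.range N, ∑ j ∈ Finset.range N, 64 * K ^ 4 *
            ((mixCoeff μ (e i) (e j) 0).toReal + serialCoeff μ e i (Nat.dist t s)) := by
            refine Finset.sum_le_sum fun i _ => ?_
            rw [integral_finsetSum _ fun j _ => hi i j t s]
            exact Finset.sum_le_sum fun j _ => integral_truncErr_four_le he hK i j t s
        _ = 64 * K ^ 4 * (∑ i ∈ Finset.range N, ∑ j ∈ Finset.range N,
            (mixCoeff μ (e i) (e j) 0).toReal +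
            N * ∑ i ∈ Finset.range N, serialCoeff μ e i (Nat.dist t s)) := by
            simp only [← Finset.mul_sum, Finset.sum_add_distrib, Finset.sum_const,
              Finset.card_range, nsmul_eq_mul]
        _ ≤ _ := by gcongr
    calc _ ≤ _ := Finset.sum_le_sum h2
      _ = 64 * K ^ 4 * (T * (C * N) + N * ∑ i ∈ Finset.range N, ∑ s ∈ Finset.range T,
          serialCoeff μ e i (Nat.dist t s)) := by
          rw [← Finset.mul_sum, Finset.sum_add_distrib, Finset.sum_const, ← Finset.mul_sum,
            Finset.sum_comm (s := Finset.range T)]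
          simp
      _ ≤ 64 * K ^ 4 * (T * (C * N) + N * ∑ i ∈ Finset.range N, 2 * D) := by
          gcongr with i _
          refine (sum_dist_le _ (serialCoeff_nonneg i) T (Finset.mem_range.1 ht)).trans ?_
          linarith [hD i T]
      _ = _ := by simp
  calc _ ≤ _ := Finset.sum_le_sum h1
    _ = _ := by
      simp only [Finset.sum_const, Finset.card_range, nsmul_eq_mul]
      ring

/-- Splitting a Gram matrix along `A = B + R`, in a form that is linear in expectations. -/
theorem norm_gram_le {m n : Type*} [Fintype m] [Fintype n] (A B : Matrix m n ℝ) {a c : ℝ}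
    (ha : 0 < a) (hc : 0 < c) :
    c⁻¹ * ‖A * Aᵀ‖ ≤ a + a⁻¹ * (c ^ 2)⁻¹ * ‖B * Bᵀ‖ ^ 2 + a * c⁻¹ * ‖A‖ ^ 2 +
      (1 + a⁻¹) * c⁻¹ * ‖A - B‖ ^ 2 := by
  have e : A * Aᵀ = B * Bᵀ + A * (A - B)ᵀ + (A - B) * Aᵀ - (A - B) * (A - B)ᵀ := by
    simp only [Matrix.transpose_sub, Matrix.mul_sub, Matrix.sub_mul]
    abel
  have h1 : ‖A * (A - B)ᵀ‖ ≤ ‖A‖ * ‖A - B‖ := by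
    simpa only [Matrix.frobenius_norm_transpose] using Matrix.frobenius_norm_mul A (A - B)ᵀ
  have h2 : ‖(A - B) * Aᵀ‖ ≤ ‖A - B‖ * ‖A‖ := by
    simpa only [Matrix.frobenius_norm_transpose] using Matrix.frobenius_norm_mul (A - B) Aᵀ
  have h3 : ‖(A - B) * (A - B)ᵀ‖ ≤ ‖A - B‖ * ‖A - B‖ := by
    simpa only [Matrix.frobenius_norm_transpose] using
      Matrix.frobenius_norm_mul (A - B) (A - B)ᵀ
  have h4 : ‖A * Aᵀ‖ ≤ ‖B * Bᵀ‖ + 2 * (‖A‖ * ‖A - B‖) + ‖A - B‖ ^ 2 := by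
    rw [e]
    refine (norm_sub_le _ _).trans ?_
    have := norm_add₃_le (a := B * Bᵀ) (b := A * (A - B)ᵀ) (c := (A - B) * Aᵀ)
    nlinarith
  have h5 : 2 * (‖A‖ * ‖A - B‖) ≤ a * ‖A‖ ^ 2 + a⁻¹ * ‖A - B‖ ^ 2 := by
    have : 0 ≤ a⁻¹ * (a * ‖A‖ - ‖A - B‖) ^ 2 := by positivity
    have h : a⁻¹ * (a * ‖A‖ - ‖A - B‖) ^ 2 =
        a * ‖A‖ ^ 2 - 2 * (‖A‖ * ‖A - B‖) + a⁻¹ * ‖A - B‖ ^ 2 := by field_simp; ring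
    linarith
  have h6 : c⁻¹ * ‖B * Bᵀ‖ ≤ a + a⁻¹ * (c ^ 2)⁻¹ * ‖B * Bᵀ‖ ^ 2 := by
    set v := c⁻¹ * ‖B * Bᵀ‖
    have : a⁻¹ * (c ^ 2)⁻¹ * ‖B * Bᵀ‖ ^ 2 = a⁻¹ * v ^ 2 := by
      simp only [v, mul_pow, inv_pow]; ring
    rw [this]
    have h : 0 ≤ a⁻¹ * (v - a) ^ 2 + v := by positivity
    have h' : a⁻¹ * (v - a) ^ 2 = a⁻¹ * v ^ 2 - 2 * v + a := by field_simp; ring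
    linarith
  have h7 : c⁻¹ * ‖A * Aᵀ‖ ≤ c⁻¹ * (‖B * Bᵀ‖ + (a * ‖A‖ ^ 2 + a⁻¹ * ‖A - B‖ ^ 2) +
      ‖A - B‖ ^ 2) := by
    gcongr
    linarith
  refine h7.trans ?_
  have : c⁻¹ * (‖B * Bᵀ‖ + (a * ‖A‖ ^ 2 + a⁻¹ * ‖A - B‖ ^ 2) + ‖A - B‖ ^ 2) =
      c⁻¹ * ‖B * Bᵀ‖ + a * c⁻¹ * ‖A‖ ^ 2 + (1 + a⁻¹) * c⁻¹ * ‖A - B‖ ^ 2 := by ring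
  rw [this]
  linarith

/-- The Gram matrix of weakly dependent errors is of smaller order than `N T`, in probability. The
errors are truncated at a high level: the truncated part has a small second moment by mixing, and
the remainder has a small variance. -/
theorem tendsto_measure_norm_errorGram (he : ∀ i t, Measurable (e i t)) {C D M : ℝ}
    (hC : ∀ N, ∑ i ∈ Finset.range N, ∑ j ∈ Finset.range N,
      (mixCoeff μ (e i) (e j) 0).toReal ≤ C * N)
    (hD : ∀ i n, ∑ k ∈ Finset.range n, serialCoeff μ e i k ≤ D)
    (hint : ∀ i t, Integrable (fun ω => e i t ω ^ 4) μ)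
    (hM : ∀ i t, ∫ ω, e i t ω ^ 4 ∂μ ≤ M)
    (hmean : ∀ i t, ∫ ω, e i t ω ∂μ = 0) {θ : ℝ} (hθ : 0 < θ) :
    Tendsto (fun q : ℕ × ℕ => μ {ω | θ * ((q.1 : ℝ) * q.2) <
      ‖panelMatrix q.1 q.2 (fun i t => e i t ω) *
        (panelMatrix q.1 q.2 fun i t => e i t ω)ᵀ‖}) atTop (𝓝 0) := by
  have hM0 : 0 ≤ M := (integral_nonneg fun ω => by positivity).trans (hM 0 0)
  have hint2 : ∀ i t, Integrable (fun ω => e i t ω ^ 2) μ ∧ ∫ ω, e i t ω ^ 2 ∂μ ≤ 1 + M := by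
    intro i t
    have h4 : Integrable (fun ω => ‖e i t ω‖ ^ 4) μ := by
      refine (hint i t).congr (ae_of_all _ fun ω => ?_)
      simp only [Real.norm_eq_abs]
      rw [← abs_pow, abs_of_nonneg (by positivity)]
    have := integrable_norm_sq_of_pow_four (he i t).aestronglyMeasurable h4
    have e4 : ∀ ω, |e i t ω| ^ 4 = e i t ω ^ 4 := fun ω => by
      rw [← abs_pow, abs_of_nonneg (by positivity)]
    simp only [Real.norm_eq_abs, sq_abs, e4] at this
    exact ⟨this.1, this.2.trans (by linarith [hM i t])⟩
  have hint1 : ∀ i t, Integrable (e i t) μ := fun i t => by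
    refine ((integrable_const (1 : ℝ)).add (hint2 i t).1).mono' (he i t).aestronglyMeasurable
      (ae_of_all _ fun ω => ?_)
    simp only [Pi.add_apply, Real.norm_eq_abs]
    nlinarith [sq_nonneg (|e i t ω| - 1), sq_abs (e i t ω), abs_nonneg (e i t ω)]
  -- the variance of the remainder
  have hrem : ∀ K : ℝ, 0 < K → ∀ i t, Integrable (fun ω => (e i t ω - truncErr μ e K i t ω) ^ 2) μ ∧
      ∫ ω, (e i t ω - truncErr μ e K i t ω) ^ 2 ∂μ ≤ (K ^ 2)⁻¹ * M := by
    intro K hK i t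
    have hc := integrable_clamp (μ := μ) he hK.le i t
    set Y : Ω → ℝ := fun ω => e i t ω - clamp K (e i t ω) with hY
    have hYi : Integrable Y μ := (hint1 i t).sub hc
    have hYm : ∫ ω, Y ω ∂μ = -∫ ω, clamp K (e i t ω) ∂μ := by
      rw [hY, integral_sub (hint1 i t) hc, hmean, zero_sub]
    have hY2 : Integrable (fun ω => Y ω ^ 2) μ :=
      ((hint i t).const_mul (K ^ 2)⁻¹).mono' (hYi.aestronglyMeasurable.pow 2)
        (ae_of_all _ fun ω => by
          rw [Real.norm_of_nonneg (by positivity)]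
          exact sq_sub_clamp_le hK _)
    have e1 : ∀ ω, (e i t ω - truncErr μ e K i t ω) ^ 2 = (Y ω - ∫ ω, Y ω ∂μ) ^ 2 := fun ω => by
      rw [hYm]; simp only [hY, truncErr]; ring
    simp only [e1]
    have h1 := integral_sub_mean_sq_le hYi hY2
    refine ⟨h1.1, h1.2.trans ?_⟩
    calc _ ≤ ∫ ω, (K ^ 2)⁻¹ * e i t ω ^ 4 ∂μ :=
          integral_mono hY2 ((hint i t).const_mul _) fun ω => sq_sub_clamp_le hK _
      _ = (K ^ 2)⁻¹ * ∫ ω, e i t ω ^ 4 ∂μ := integral_const_mul _ _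
      _ ≤ _ := by gcongr; exact hM i t
  have hsum : ∀ (x : ℕ → ℕ → Ω → ℝ) (B : ℝ),
      (∀ i t, Integrable (fun ω => x i t ω ^ 2) μ ∧ ∫ ω, x i t ω ^ 2 ∂μ ≤ B) → ∀ N T : ℕ,
      Integrable (fun ω => ‖panelMatrix N T fun i t => x i t ω‖ ^ 2) μ ∧
      ∫ ω, ‖panelMatrix N T fun i t => x i t ω‖ ^ 2 ∂μ ≤ N * T * B := by
    intro x B hx N T
    simp only [norm_panel_sq]
    have hi := fun t => integrable_finsetSum (Finset.range N) fun i _ => (hx i t).1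
    refine ⟨integrable_finsetSum _ fun t _ => hi t, ?_⟩
    rw [integral_finsetSum _ fun t _ => hi t]
    calc _ ≤ ∑ t ∈ Finset.range T, ∑ i ∈ Finset.range N, B := by
          refine Finset.sum_le_sum fun t _ => ?_
          rw [integral_finsetSum _ fun i _ => (hx i t).1]
          exact Finset.sum_le_sum fun i _ => (hx i t).2
      _ = _ := by simp; ring
  -- the expectation bound
  have hexp : ∀ a : ℝ, 0 < a → ∀ K : ℝ, 0 < K → ∀ N T : ℕ, 0 < N → 0 < T →
      μ.real {ω | θ * ((N : ℝ) * T) < ‖panelMatrix N T (fun i t => e i t ω) *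
        (panelMatrix N T fun i t => e i t ω)ᵀ‖} ≤
      θ⁻¹ * (a + a⁻¹ * (64 * K ^ 4 * (C * (N : ℝ)⁻¹ + 2 * D * (T : ℝ)⁻¹)) + a * (1 + M) +
        (1 + a⁻¹) * ((K ^ 2)⁻¹ * M)) := by
    intro a ha K hK N T hN hT
    have hN' : (0 : ℝ) < N := by exact_mod_cast hN
    have hT' : (0 : ℝ) < T := by exact_mod_cast hT
    set c : ℝ := (N : ℝ) * T with hc
    have hc0 : 0 < c := by positivity
    obtain ⟨j1, b1⟩ := integral_norm_truncPanel_le (μ := μ) (T := T) he hK.le (hC N) hD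
    obtain ⟨j2, b2⟩ := hsum e (1 + M) hint2 N T
    obtain ⟨j3, b3⟩ := hsum (fun i t ω => e i t ω - truncErr μ e K i t ω) _ (hrem K hK) N T
    set G : Ω → ℝ := fun ω => a + a⁻¹ * (c ^ 2)⁻¹ *
      ‖panelMatrix N T (fun i t => truncErr μ e K i t ω) *
        (panelMatrix N T fun i t => truncErr μ e K i t ω)ᵀ‖ ^ 2 +
      a * c⁻¹ * ‖panelMatrix N T fun i t => e i t ω‖ ^ 2 + (1 + a⁻¹) * c⁻¹ *
      ‖panelMatrix N T fun i t => e i t ω - truncErr μ e K i t ω‖ ^ 2 with hG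
    have k0 : Integrable (fun _ : Ω => a) μ := integrable_const a
    have k1 := k0.add (j1.const_mul (a⁻¹ * (c ^ 2)⁻¹))
    have k2 := k1.add (j2.const_mul (a * c⁻¹))
    have k3 := k2.add (j3.const_mul ((1 + a⁻¹) * c⁻¹))
    have hGi : Integrable G μ := k3
    have hGe : ∫ ω, G ω ∂μ ≤ a + a⁻¹ * (64 * K ^ 4 * (C * (N : ℝ)⁻¹ + 2 * D * (T : ℝ)⁻¹)) +
        a * (1 + M) + (1 + a⁻¹) * ((K ^ 2)⁻¹ * M) := by
      have e0 : ∫ ω, G ω ∂μ = a + a⁻¹ * (c ^ 2)⁻¹ * (∫ ω,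
          ‖panelMatrix N T (fun i t => truncErr μ e K i t ω) *
          (panelMatrix N T fun i t => truncErr μ e K i t ω)ᵀ‖ ^ 2 ∂μ) +
          a * c⁻¹ * (∫ ω, ‖panelMatrix N T fun i t => e i t ω‖ ^ 2 ∂μ) + (1 + a⁻¹) * c⁻¹ *
          ∫ ω, ‖panelMatrix N T fun i t => e i t ω - truncErr μ e K i t ω‖ ^ 2 ∂μ := by
        rw [hG]
        refine (integral_add k2 (j3.const_mul _)).trans ?_
        rw [integral_const_mul]
        congr 1
        refine (integral_add k1 (j2.const_mul _)).trans ?_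
        rw [integral_const_mul]
        congr 1
        refine (integral_add k0 (j1.const_mul _)).trans ?_
        rw [integral_const_mul]
        simp
      rw [e0]
      have f1 : a⁻¹ * (c ^ 2)⁻¹ * (∫ ω, ‖panelMatrix N T (fun i t => truncErr μ e K i t ω) *
          (panelMatrix N T fun i t => truncErr μ e K i t ω)ᵀ‖ ^ 2 ∂μ) ≤
          a⁻¹ * (64 * K ^ 4 * (C * (N : ℝ)⁻¹ + 2 * D * (T : ℝ)⁻¹)) := by
        calc _ ≤ a⁻¹ * (c ^ 2)⁻¹ * (64 * K ^ 4 * (C * N * T ^ 2 + 2 * D * N ^ 2 * T)) := by gcongr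
          _ = _ := by rw [hc]; field_simp
      have f2 : a * c⁻¹ * (∫ ω, ‖panelMatrix N T fun i t => e i t ω‖ ^ 2 ∂μ) ≤ a * (1 + M) := by
        calc _ ≤ a * c⁻¹ * (N * T * (1 + M)) := by gcongr
          _ = _ := by rw [← hc]; field_simp
      have f3 : (1 + a⁻¹) * c⁻¹ *
          (∫ ω, ‖panelMatrix N T fun i t => e i t ω - truncErr μ e K i t ω‖ ^ 2 ∂μ) ≤
          (1 + a⁻¹) * ((K ^ 2)⁻¹ * M) := by
        calc _ ≤ (1 + a⁻¹) * c⁻¹ * (N * T * ((K ^ 2)⁻¹ * M)) := by gcongr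
          _ = _ := by rw [← hc]; field_simp
      linarith
    have hG0 : ∀ ω, 0 ≤ G ω := fun ω => by positivity
    have hmk := mul_meas_ge_le_integral_of_nonneg (ae_of_all _ hG0) hGi θ
    rw [← div_eq_inv_mul, le_div_iff₀ hθ, mul_comm]
    refine (mul_le_mul_of_nonneg_left (measureReal_mono ?_) hθ.le).trans (hmk.trans hGe)
    intro ω hω
    have h1 := norm_gram_le (panelMatrix N T fun i t => e i t ω)
      (panelMatrix N T fun i t => truncErr μ e K i t ω) ha hc0
    have h2 : panelMatrix N T (fun i t => e i t ω) -
        panelMatrix N T (fun i t => truncErr μ e K i t ω) =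
        panelMatrix N T fun i t => e i t ω - truncErr μ e K i t ω := by
      ext t i; rfl
    rw [h2] at h1
    refine le_trans ?_ h1
    rw [le_inv_mul_iff₀ hc0, mul_comm]
    have hω' : θ * c < _ := hω
    exact hω'.le
  rw [ENNReal.tendsto_nhds_zero]
  intro ε hε
  rcases eq_or_ne ε ∞ with rfl | hεt
  · simp
  set r := ε.toReal with hr
  have hr0 : 0 < r := ENNReal.toReal_pos hε.ne' hεt
  -- the weight, then the truncation level
  set a : ℝ := θ * r / (4 * (2 + M)) with ha
  have ha0 : 0 < a := by positivity
  have hlimK : Tendsto (fun K : ℝ => (1 + a⁻¹) * ((K ^ 2)⁻¹ * M)) atTop (𝓝 0) := by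
    have := (tendsto_inv_atTop_zero.comp (tendsto_pow_atTop (α := ℝ) two_ne_zero)).mul_const M
    simpa using this.const_mul (1 + a⁻¹)
  obtain ⟨K, hK1, hK0⟩ := ((hlimK.eventually (gt_mem_nhds (show 0 < θ * r / 4 by positivity))).and
    (eventually_gt_atTop 0)).exists
  have hlimq : Tendsto (fun q : ℕ × ℕ => a⁻¹ * (64 * K ^ 4 * (C * (q.1 : ℝ)⁻¹ +
      2 * D * (q.2 : ℝ)⁻¹))) atTop (𝓝 0) := by
    rw [← prod_atTop_atTop_eq]
    have t1 : Tendsto (fun q : ℕ × ℕ => (q.1 : ℝ)⁻¹) (atTop ×ˢ atTop) (𝓝 0) :=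
      tendsto_inv_atTop_nhds_zero_nat.comp tendsto_fst
    have t2 : Tendsto (fun q : ℕ × ℕ => (q.2 : ℝ)⁻¹) (atTop ×ˢ atTop) (𝓝 0) :=
      tendsto_inv_atTop_nhds_zero_nat.comp tendsto_snd
    simpa using (((t1.const_mul C).add (t2.const_mul (2 * D))).const_mul
      (64 * K ^ 4)).const_mul a⁻¹
  have hpos : ∀ᶠ q : ℕ × ℕ in atTop, 0 < q.1 ∧ 0 < q.2 := by
    rw [← prod_atTop_atTop_eq]
    exact (eventually_gt_atTop 0).prod_mk (eventually_gt_atTop 0)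
  filter_upwards [hlimq.eventually (gt_mem_nhds (show 0 < θ * r / 4 by positivity)), hpos]
    with q hq hq0
  rw [← ofReal_measureReal (measure_ne_top _ _)]
  refine ENNReal.ofReal_le_of_le_toReal ((hexp a ha0 K hK0 q.1 q.2 hq0.1 hq0.2).trans ?_)
  rw [inv_mul_le_iff₀ hθ, ← hr]
  have := mul_pos hθ hr0
  have : a + a * (1 + M) = θ * r / 4 := by rw [ha]; field_simp; ring
  linarith

end ErrorMatrix

/-! ### The likelihood with estimated factors -/

section EstimatedFactors

variable {p d : ℕ}

theorem logLik_response (Φ : ℝ → ℝ) (β z : EuclideanSpace ℝ (Coord p d)) (ε x : ℝ) :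
    logLik Φ (response β z ε) x = Real.log (outcomeProb Φ β (z, ε) x) := by
  unfold logLik response outcomeProb
  by_cases h : ε ≤ inner ℝ β z
  · rw [if_pos (by linarith), if_pos h]; ring
  · rw [if_neg (by linarith), if_neg h]; ring

/-- The error `(0, 0, (Ft H⁻¹) t - f t)` in the regressors at time `t`, zero out of the sample. -/
noncomputable def factorError (p : ℕ) {T : ℕ} (f : ℕ → EuclideanSpace ℝ (Fin d))
    (Ft : Matrix (Fin T) (Fin d) ℝ) (H : Matrix (Fin d) (Fin d) ℝ) (t : ℕ) :
    EuclideanSpace ℝ (Coord p d) :=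
  WithLp.toLp 2 (Sum.elim (fun _ => 0) fun j =>
    if ht : t < T then (Ft * H⁻¹ - factorMatrix T f) ⟨t, ht⟩ j else 0)

theorem sum_norm_factorError_sq_le {T n : ℕ} (hn : n ≤ T) (f : ℕ → EuclideanSpace ℝ (Fin d))
    (Ft : Matrix (Fin T) (Fin d) ℝ) (H : Matrix (Fin d) (Fin d) ℝ) :
    ∑ t ∈ Finset.range n, ‖factorError p f Ft H t‖ ^ 2 ≤ ‖Ft * H⁻¹ - factorMatrix T f‖ ^ 2 := by
  calc _ ≤ ∑ t ∈ Finset.range T, ‖factorError p f Ft H t‖ ^ 2 :=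
        Finset.sum_le_sum_of_subset_of_nonneg (Finset.range_subset_range.2 hn)
          fun _ _ _ => by positivity
    _ = _ := by
        rw [← Fin.sum_univ_eq_sum_range (fun t => ‖factorError p f Ft H t‖ ^ 2),
          frobenius_norm_sq]
        refine Finset.sum_congr rfl fun t _ => ?_
        rw [EuclideanSpace.norm_sq_eq, Fintype.sum_sum_type]
        simp [factorError]

/-- The index at the rotated coefficients is the index at the original coefficients with perturbed
regressors. -/
theorem inner_rotationExt_mulVec {T : ℕ} (w : EuclideanSpace ℝ (Fin p))
    (f : ℕ → EuclideanSpace ℝ (Fin d)) (Ft : Matrix (Fin T) (Fin d) ℝ)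
    (H : Matrix (Fin d) (Fin d) ℝ) (γ : EuclideanSpace ℝ (Coord p d)) (t : Fin T) :
    inner ℝ (WithLp.toLp 2 (rotationExt p H *ᵥ γ.ofLp)) (regressor w (WithLp.toLp 2 (Ft t))) =
      inner ℝ γ (regressor w (f t) + factorError p f Ft H t) := by
  have e1 : ∀ v x : EuclideanSpace ℝ (Coord p d), inner ℝ v x =
      ∑ i, v (Sum.inl i) * x (Sum.inl i) + ∑ j, v (Sum.inr j) * x (Sum.inr j) := fun v x => by
    rw [PiLp.inner_apply, Fintype.sum_sum_type]
    simp [mul_comm]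
  rw [e1, e1]
  refine congrArg₂ (· + ·) ?_ ?_
  · refine Finset.sum_congr rfl fun i _ => ?_
    simp [rotationExt, regressor, factorError, Matrix.mulVec, dotProduct, Matrix.one_apply]
  · have h1 : ∀ j : Fin d, (rotationExt p H *ᵥ γ.ofLp) (Sum.inr j) =
        ∑ k, H⁻¹ j k * γ (Sum.inr k) := fun j => by
      simp [rotationExt, Matrix.mulVec, dotProduct]
    have h2 : ∀ j : Fin d, (regressor w (f t) + factorError p f Ft H t) (Sum.inr j) =
        ∑ k, Ft t k * H⁻¹ k j := fun j => by
      simp [regressor, factorError, factorMatrix, Matrix.mul_apply]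
    simp only [h1, h2]
    simp only [regressor, Sum.elim_inr, Finset.sum_mul, Finset.mul_sum]
    rw [Finset.sum_comm]
    refine Finset.sum_congr rfl fun j _ => Finset.sum_congr rfl fun k _ => ?_
    ring

theorem sum_filter_add_lt (h T : ℕ) (G : ℕ → ℝ) :
    ∑ t : Fin T with t.val + h < T, G t = ∑ t ∈ Finset.range (T - h), G t := by
  rw [Finset.sum_filter, Fin.sum_univ_eq_sum_range (fun t => if t + h < T then G t else 0) T,
    ← Finset.sum_filter]
  refine Finset.sum_congr ?_ fun _ _ => rfl
  ext t
  simp only [Finset.mem_filter, Finset.mem_range]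
  omega

theorem sampleLogLik_rotationExt {h T : ℕ} (Φ : ℝ → ℝ) (β : EuclideanSpace ℝ (Coord p d))
    (w : ℕ → EuclideanSpace ℝ (Fin p)) (f : ℕ → EuclideanSpace ℝ (Fin d)) (eps y : ℕ → ℝ)
    (hy : ∀ t, y (t + h) = response β (regressor (w t) (f t)) (eps (t + h)))
    (Ft : Matrix (Fin T) (Fin d) ℝ) (H : Matrix (Fin d) (Fin d) ℝ)
    (γ : EuclideanSpace ℝ (Coord p d)) :
    sampleLogLik h T Φ y w Ft (WithLp.toLp 2 (rotationExt p H *ᵥ γ.ofLp)) =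
      ∑ t ∈ Finset.range (T - h), Real.log (outcomeProb Φ β (regressor (w t) (f t), eps (t + h))
        (inner ℝ γ (regressor (w t) (f t) + factorError p f Ft H t))) := by
  rw [← sum_filter_add_lt]
  unfold sampleLogLik
  refine Finset.sum_congr rfl fun t _ => ?_
  rw [inner_rotationExt_mulVec (w t) f, hy, logLik_response]

theorem rotationExt_mulVec_surjective {H : Matrix (Fin d) (Fin d) ℝ} (hH : IsUnit H)
    (b : EuclideanSpace ℝ (Coord p d)) :
    ∃ γ : EuclideanSpace ℝ (Coord p d), b = WithLp.toLp 2 (rotationExt p H *ᵥ γ.ofLp) := by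
  refine ⟨WithLp.toLp 2 (Matrix.fromBlocks 1 0 0 H *ᵥ b.ofLp), ?_⟩
  have hd : IsUnit H.det := (Matrix.isUnit_iff_isUnit_det _).1 hH
  have e : rotationExt p H * Matrix.fromBlocks 1 0 0 H = 1 := by
    rw [rotationExt, Matrix.fromBlocks_multiply]
    simp [Matrix.nonsing_inv_mul _ hd]
  rw [Matrix.mulVec_mulVec, e, Matrix.one_mulVec]

theorem norm_toLp_mulVec_le {m n : Type*} [Fintype m] [Fintype n] (A : Matrix m n ℝ)
    (v : n → ℝ) : ‖WithLp.toLp 2 (A *ᵥ v)‖ ≤ ‖A‖ * ‖WithLp.toLp 2 v‖ := by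
  rw [← Matrix.frobenius_norm_replicateCol (ι := Unit), Matrix.replicateCol_mulVec,
    ← Matrix.frobenius_norm_replicateCol (ι := Unit) v]
  exact Matrix.frobenius_norm_mul _ _

theorem norm_rotationExt_sq (p : ℕ) (H : Matrix (Fin d) (Fin d) ℝ) :
    ‖rotationExt p H‖ ^ 2 = 1 + p + ‖H⁻¹‖ ^ 2 := by
  rw [frobenius_norm_sq, frobenius_norm_sq, Fintype.sum_sum_type]
  congr 1
  · simp [rotationExt, Matrix.fromBlocks, Matrix.one_apply]
  · simp [rotationExt]

theorem continuous_sampleLogLik {h T : ℕ} {Φ : ℝ → ℝ} {y : ℕ → ℝ}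
    (hc : ∀ t, t + h < T → Continuous (logLik Φ (y (t + h)))) (w : ℕ → EuclideanSpace ℝ (Fin p))
    (Ft : Matrix (Fin T) (Fin d) ℝ) : Continuous (sampleLogLik h T Φ y w Ft) := by
  unfold sampleLogLik
  refine continuous_finsetSum _ fun t ht => ?_
  exact (hc t (by simpa using ht)).comp (by fun_prop)

/-- On samples where the likelihood separates `β` from the parameters at distance `η` and where the
factors are well estimated, the maximum likelihood estimator exists and is close to the rotated
coefficients. -/
theorem mle_close_of_separation {h T : ℕ} {Φ : ℝ → ℝ} {β : EuclideanSpace ℝ (Coord p d)}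
    {w : ℕ → EuclideanSpace ℝ (Fin p)} {f : ℕ → EuclideanSpace ℝ (Fin d)} {eps y : ℕ → ℝ}
    (hy : ∀ t, y (t + h) = response β (regressor (w t) (f t)) (eps (t + h)))
    {Ft : Matrix (Fin T) (Fin d) ℝ} {H : Matrix (Fin d) (Fin d) ℝ}
    (hl : ∀ y : ℝ, y = 0 ∨ y = 1 → ContDiff ℝ 2 (logLik Φ y)) {Ξ : Set ℝ} {M bU : ℝ}
    (hM : ∀ y : ℝ, y = 0 ∨ y = 1 → ∀ x ∈ Ξ, |deriv (logLik Φ y) x| ≤ M)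
    (hU : ∀ y : ℝ, y = 0 ∨ y = 1 → ∀ x, -iteratedDeriv 2 (logLik Φ y) x ≤ bU)
    (hM0 : 0 ≤ M) (hU0 : 0 ≤ bU)
    (hΞ : ∀ t, t + h < T → inner ℝ β (regressor (w t) (f t)) ∈ Ξ) (hT : 2 * h < T)
    {κ C ζ η B : ℝ} (hκ : 0 < κ) (hC : 0 ≤ C) (hη : 0 < η)
    (hsep : ∀ γ, η ≤ ‖γ - β‖ → ∀ u : ℕ → EuclideanSpace ℝ (Coord p d),
      ∑ t ∈ Finset.range (T - h), logRatio Φ β (regressor (w t) (f t), eps (t + h)) γ (u t) ≤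
        -κ * (T - h : ℕ) + C * ∑ t ∈ Finset.range (T - h), ‖u t‖ ^ 2)
    (hH : IsUnit H) (hB : ‖H⁻¹‖ ≤ B) (hFt : ‖Ft * H⁻¹ - factorMatrix T f‖ ^ 2 ≤ ζ * T)
    (hζ0 : 0 ≤ ζ) (hζC : 4 * C * ζ ≤ κ)
    (hζL : 16 * (2 * (M * ‖β‖) ^ 2 / κ + bU / 2 * ‖β‖ ^ 2) * ζ ≤ κ) :
    (∃ b, IsMLE h T Φ y w Ft b) ∧ ∀ b, IsMLE h T Φ y w Ft b →
      ‖b - WithLp.toLp 2 (rotationExt p H *ᵥ β.ofLp)‖ ≤ √(1 + p + B ^ 2) * η := by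
  set n := T - h with hn
  have hn0 : 0 < n := by omega
  have hn' : (0 : ℝ) < n := by exact_mod_cast hn0
  have hTn : (T : ℝ) ≤ 2 * n := by
    have : T ≤ 2 * n := by omega
    exact_mod_cast this
  set u := factorError p f Ft H with hu
  set S := ∑ t ∈ Finset.range n, ‖u t‖ ^ 2 with hS
  have hSle : S ≤ 2 * ζ * n := by
    calc S ≤ _ := sum_norm_factorError_sq_le (Nat.sub_le T h) f Ft H
      _ ≤ ζ * T := hFt
      _ ≤ ζ * (2 * n) := by gcongr
      _ = _ := by ring
  set s : ℕ → EuclideanSpace ℝ (Coord p d) × ℝ :=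
    fun t => (regressor (w t) (f t), eps (t + h)) with hs
  -- the log-likelihood at the rotation of `γ`, relative to that at the true indices
  set D : EuclideanSpace ℝ (Coord p d) → ℝ := fun γ =>
    ∑ t ∈ Finset.range n, logRatio Φ β (s t) γ (u t) with hD
  set R : EuclideanSpace ℝ (Coord p d) → EuclideanSpace ℝ (Coord p d) := fun γ =>
    WithLp.toLp 2 (rotationExt p H *ᵥ γ.ofLp) with hR
  have hLD : ∀ γ, sampleLogLik h T Φ y w Ft (R γ) = D γ +
      ∑ t ∈ Finset.range n, Real.log (outcomeProb Φ β (s t) (inner ℝ β (s t).1)) := by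
    intro γ
    rw [hR, sampleLogLik_rotationExt Φ β w f eps y hy Ft H γ, hD, ← Finset.sum_add_distrib]
    refine Finset.sum_congr rfl fun t _ => ?_
    simp only [logRatio, hs, hu]
    ring
  have hfar : ∀ γ, η ≤ ‖γ - β‖ → D γ ≤ -(κ / 2) * n := by
    intro γ hγ
    have h1 := hsep γ hγ u
    have h2 : C * S ≤ κ / 2 * n := by
      calc C * S ≤ C * (2 * ζ * n) := by gcongr
        _ = (4 * C * ζ) * n / 2 := by ring
        _ ≤ κ * n / 2 := by gcongr
        _ = _ := by ring
    simp only [hD]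
    linarith
  set L := 2 * (M * ‖β‖) ^ 2 / κ + bU / 2 * ‖β‖ ^ 2 with hL
  have hL0 : 0 ≤ L := by positivity
  -- the estimated factors cost little at the true coefficients, by a second order expansion
  have hnear : -(κ / 4) * n ≤ D β := by
    have h1 : ∀ t ∈ Finset.range n, -(κ / 8) - L * ‖u t‖ ^ 2 ≤ logRatio Φ β (s t) β (u t) := by
      intro t ht
      have htT : t + h < T := by
        have := Finset.mem_range.1 ht
        omega
      have hy01 : y (t + h) = 0 ∨ y (t + h) = 1 := by
        rw [hy]; unfold response; split_ifs <;> simp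
      have e : logRatio Φ β (s t) β (u t) =
          logLik Φ (y (t + h)) (inner ℝ β (s t).1 + inner ℝ β (u t)) -
          logLik Φ (y (t + h)) (inner ℝ β (s t).1) := by
        unfold logRatio
        rw [hy, logLik_response, logLik_response, inner_add_right]
      have h2 := sub_ge_of_curvature (hl _ hy01) (hU _ hy01) (inner ℝ β (s t).1)
        (inner ℝ β (u t))
      have h3 := hM _ hy01 _ (hΞ t htT)
      have h4 : |inner ℝ β (u t)| ≤ ‖β‖ * ‖u t‖ := abs_real_inner_le_norm _ _
      have h5 : -(M * (‖β‖ * ‖u t‖)) ≤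
          deriv (logLik Φ (y (t + h))) (inner ℝ β (s t).1) * inner ℝ β (u t) := by
        have : |deriv (logLik Φ (y (t + h))) (inner ℝ β (s t).1) * inner ℝ β (u t)| ≤
            M * (‖β‖ * ‖u t‖) := by
          rw [abs_mul]
          exact mul_le_mul h3 h4 (abs_nonneg _) hM0
        exact (abs_le.1 this).1
      have h6 : (inner ℝ β (u t)) ^ 2 ≤ ‖β‖ ^ 2 * ‖u t‖ ^ 2 := by
        rw [← mul_pow, ← sq_abs]
        gcongr
      have h7 : M * (‖β‖ * ‖u t‖) ≤ κ / 8 + 2 * (M * ‖β‖) ^ 2 / κ * ‖u t‖ ^ 2 := by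
        have h8 : 0 ≤ κ / 8 * (1 - 4 * (M * ‖β‖) * ‖u t‖ / κ) ^ 2 := by positivity
        have h9 : κ / 8 * (1 - 4 * (M * ‖β‖) * ‖u t‖ / κ) ^ 2 =
            κ / 8 - M * (‖β‖ * ‖u t‖) + 2 * (M * ‖β‖) ^ 2 / κ * ‖u t‖ ^ 2 := by
          field_simp; ring
        linarith
      have h10 : bU / 2 * (inner ℝ β (u t)) ^ 2 ≤ bU / 2 * (‖β‖ ^ 2 * ‖u t‖ ^ 2) := by gcongr
      rw [e, hL]
      linarith
    have h2 := Finset.sum_le_sum h1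
    rw [Finset.sum_sub_distrib, ← Finset.mul_sum] at h2
    simp only [Finset.sum_const, Finset.card_range, nsmul_eq_mul] at h2
    have h3 : L * S ≤ κ / 8 * n := by
      calc L * S ≤ L * (2 * ζ * n) := by gcongr
        _ = (16 * L * ζ) * n / 8 := by ring
        _ ≤ κ * n / 8 := by gcongr
        _ = _ := by ring
    simp only [hD]
    linarith
  have hsepD : ∀ γ, η ≤ ‖γ - β‖ → D γ < D β := fun γ hγ => by
    have h1 := hfar γ hγ
    have h2 : 0 < κ * n := by positivity
    linarith
  constructor
  · have hcont : Continuous (sampleLogLik h T Φ y w Ft) := by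
      refine continuous_sampleLogLik (fun t _ => ?_) w Ft
      refine (hl _ ?_).continuous
      rw [hy]; unfold response; split_ifs <;> simp
    have hRc : Continuous R := by
      simp only [hR]
      fun_prop
    obtain ⟨γ₀, hγ₀, hmax⟩ := (isCompact_closedBall β η).exists_isMaxOn
      ⟨β, Metric.mem_closedBall_self hη.le⟩ (hcont.comp hRc).continuousOn
    refine ⟨R γ₀, fun b => ?_⟩
    obtain ⟨γ, rfl⟩ := rotationExt_mulVec_surjective hH b
    rcases le_total ‖γ - β‖ η with hγ | hγ
    · exact hmax (by rwa [Metric.mem_closedBall, dist_eq_norm])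
    · have h1 : sampleLogLik h T Φ y w Ft (R β) ≤ sampleLogLik h T Φ y w Ft (R γ₀) :=
        hmax (Metric.mem_closedBall_self hη.le)
      have h2 := hsepD γ hγ
      have h3 := hLD γ
      have h4 := hLD β
      change sampleLogLik h T Φ y w Ft (R γ) ≤ _
      linarith
  · intro b hb
    obtain ⟨γ, rfl⟩ := rotationExt_mulVec_surjective hH b
    have hγ : ‖γ - β‖ < η := by
      by_contra hcon
      have h1 := hb (R β)
      have h2 := hsepD γ (not_lt.1 hcon)
      have h3 := hLD γ
      have h4 := hLD β
      change _ ≤ sampleLogLik h T Φ y w Ft (R γ) at h1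
      linarith
    have e : WithLp.toLp 2 (rotationExt p H *ᵥ γ.ofLp) -
        WithLp.toLp 2 (rotationExt p H *ᵥ β.ofLp) =
        WithLp.toLp 2 (rotationExt p H *ᵥ (γ - β).ofLp) := by
      rw [WithLp.ofLp_sub, Matrix.mulVec_sub, WithLp.toLp_sub]
    rw [e]
    have hRn : ‖rotationExt p H‖ ≤ √(1 + p + B ^ 2) := by
      refine Real.le_sqrt_of_sq_le ?_
      rw [norm_rotationExt_sq]
      gcongr
    calc _ ≤ ‖rotationExt p H‖ * ‖γ - β‖ := norm_toLp_mulVec_le _ _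
      _ ≤ _ := by gcongr

end EstimatedFactors

/-! ### Events with probability tending to one -/

section HighProbability

variable {Ω ι : Type*} [MeasurableSpace Ω] {μ : Measure Ω} {l : Filter ι}

/-- The events `A q` hold with probability tending to one along `l`. It is stated for the outer
measure of the complements, since the events may fail to be measurable. -/
def WithHighProb (μ : Measure Ω) (l : Filter ι) (A : ι → Ω → Prop) : Prop :=
  Tendsto (fun q => μ {ω | ¬ A q ω}) l (𝓝 0)

theorem WithHighProb.mono {A B : ι → Ω → Prop} (hA : WithHighProb μ l A)
    (h : ∀ᶠ q in l, ∀ ω, A q ω → B q ω) : WithHighProb μ l B := by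
  refine tendsto_of_tendsto_of_tendsto_of_le_of_le' tendsto_const_nhds hA
    (Eventually.of_forall fun _ => zero_le) ?_
  filter_upwards [h] with q hq
  exact measure_mono fun ω hω hA' => hω (hq ω hA')

theorem WithHighProb.and {A B : ι → Ω → Prop} (hA : WithHighProb μ l A)
    (hB : WithHighProb μ l B) : WithHighProb μ l fun q ω => A q ω ∧ B q ω := by
  have h := hA.add hB
  rw [add_zero] at h
  refine tendsto_of_tendsto_of_tendsto_of_le_of_le tendsto_const_nhds h (fun _ => zero_le)
    fun q => (measure_mono ?_).trans (measure_union_le _ _)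
  intro ω hω
  by_cases hA' : A q ω
  · exact Or.inr fun hB' => hω ⟨hA', hB'⟩
  · exact Or.inl hA'

theorem WithHighProb.comp {ι' : Type*} {l' : Filter ι'} {A : ι → Ω → Prop}
    (hA : WithHighProb μ l A) {g : ι' → ι} (hg : Tendsto g l' l) :
    WithHighProb μ l' fun q => A (g q) :=
  Tendsto.comp (g := fun q => μ {ω | ¬ A q ω}) (f := g) hA hg

theorem WithHighProb.forall_fintype {J : Type*} [Fintype J] {A : J → ι → Ω → Prop}
    (hA : ∀ j, WithHighProb μ l (A j)) : WithHighProb μ l fun q ω => ∀ j, A j q ω := by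
  have h := tendsto_finsetSum Finset.univ fun j _ => hA j
  rw [Finset.sum_const_zero] at h
  refine tendsto_of_tendsto_of_tendsto_of_le_of_le tendsto_const_nhds h (fun _ => zero_le)
    fun q => (measure_mono ?_).trans (measure_iUnion_fintype_le μ fun j => {ω | ¬ A j q ω})
  intro ω hω
  obtain ⟨j, hj⟩ := not_forall.1 hω
  exact Set.mem_iUnion.2 ⟨j, hj⟩

end HighProbability

/-! ### Gram matrices of the factors and of the loadings -/

section Gram

variable {d : ℕ}

theorem exists_form_lower_bound (S : Matrix (Fin d) (Fin d) ℝ)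
    (hS : ∀ c : Matrix (Fin d) Unit ℝ, c ≠ 0 → 0 < (cᵀ * S * c) () ()) :
    ∃ κ : ℝ, 0 < κ ∧ ∀ c : Matrix (Fin d) Unit ℝ, κ * ‖c‖ ^ 2 ≤ (cᵀ * S * c) () () := by
  have hscale : ∀ (a : ℝ) (c : Matrix (Fin d) Unit ℝ),
      ((a • c)ᵀ * S * (a • c)) () () = a ^ 2 * (cᵀ * S * c) () () := by
    intro a c
    rw [Matrix.transpose_smul, Matrix.smul_mul, Matrix.smul_mul, Matrix.mul_smul, smul_smul,
      Matrix.smul_apply, smul_eq_mul, sq]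
  have hunit : ∀ c : Matrix (Fin d) Unit ℝ, c ≠ 0 → ‖c‖⁻¹ • c ∈
      Metric.sphere (0 : Matrix (Fin d) Unit ℝ) 1 := fun c hc => by
    simp [norm_smul, inv_mul_cancel₀ (norm_ne_zero_iff.2 hc)]
  rcases (Metric.sphere (0 : Matrix (Fin d) Unit ℝ) 1).eq_empty_or_nonempty with h | h
  · refine ⟨1, one_pos, fun c => ?_⟩
    by_cases hc : c = 0
    · rw [hc]; simp
    · have := hunit c hc
      rw [h] at this
      exact this.elim
  · have hcont : Continuous fun c : Matrix (Fin d) Unit ℝ => (cᵀ * S * c) () () := by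
      simp only [Matrix.mul_apply, Matrix.transpose_apply]
      fun_prop
    obtain ⟨c₀, hc₀, hmin⟩ := (isCompact_sphere (0 : Matrix (Fin d) Unit ℝ) 1).exists_isMinOn h
      hcont.continuousOn
    have hc₀' : c₀ ≠ 0 := by
      rintro rfl
      simp at hc₀
    refine ⟨_, hS c₀ hc₀', fun c => ?_⟩
    by_cases hc : c = 0
    · rw [hc]; simp
    · have h1 : (c₀ᵀ * S * c₀) () () ≤
          ((‖c‖⁻¹ • c)ᵀ * S * (‖c‖⁻¹ • c)) () () := hmin (hunit c hc)
      have h2 : 0 < ‖c‖ := norm_pos_iff.2 hc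
      rw [hscale, inv_pow, le_inv_mul_iff₀ (by positivity)] at h1
      linarith

/-- If the Gram matrices `AᵀA / m` are close to a positive definite limit, then `A` is bounded above
and below. -/
theorem exists_gram_bounds (S : Matrix (Fin d) (Fin d) ℝ)
    (hS : ∀ c : Matrix (Fin d) Unit ℝ, c ≠ 0 → 0 < (cᵀ * S * c) () ()) :
    ∃ κ r C : ℝ, 0 < κ ∧ 0 < r ∧ 0 ≤ C ∧ ∀ (m : ℕ) (A : Matrix (Fin m) (Fin d) ℝ), 0 < m →
      ‖(m : ℝ)⁻¹ • (Aᵀ * A) - S‖ ≤ r →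
      (∀ c : Matrix (Fin d) Unit ℝ, κ * m * ‖c‖ ^ 2 ≤ ‖A * c‖ ^ 2) ∧ ‖A‖ ^ 2 ≤ C * m := by
  obtain ⟨κ, hκ, hform⟩ := exists_form_lower_bound S hS
  refine ⟨κ / 2, κ / 2, d * (‖S‖ + κ / 2), by positivity, by positivity, by positivity,
    fun m A hm h => ?_⟩
  have hm' : (0 : ℝ) < m := by exact_mod_cast hm
  set G := (m : ℝ)⁻¹ • (Aᵀ * A) with hG
  have hGA : Aᵀ * A = (m : ℝ) • G := by
    rw [hG, smul_smul, mul_inv_cancel₀ hm'.ne', one_smul]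
  constructor
  · intro c
    have h1 : ‖A * c‖ ^ 2 = m * (cᵀ * G * c) () () := by
      rw [frobenius_norm_sq_eq_trace, Matrix.transpose_mul, Matrix.mul_assoc,
        ← Matrix.mul_assoc Aᵀ, hGA, Matrix.smul_mul, Matrix.mul_smul, ← Matrix.mul_assoc]
      simp [Matrix.trace]
    have h2 : |(cᵀ * (G - S) * c) () ()| ≤ κ / 2 * ‖c‖ ^ 2 := by
      refine (abs_entry_le_frobenius_norm _ _ _).trans ?_
      calc _ ≤ ‖cᵀ‖ * ‖G - S‖ * ‖c‖ := (Matrix.frobenius_norm_mul _ _).trans (by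
            gcongr; exact Matrix.frobenius_norm_mul _ _)
        _ ≤ ‖cᵀ‖ * (κ / 2) * ‖c‖ := by gcongr
        _ = _ := by rw [Matrix.frobenius_norm_transpose]; ring
    rw [Matrix.mul_sub, Matrix.sub_mul, Matrix.sub_apply] at h2
    have h3 := (abs_le.1 h2).1
    have h4 := hform c
    rw [h1]
    calc κ / 2 * m * ‖c‖ ^ 2 = m * (κ / 2 * ‖c‖ ^ 2) := by ring
      _ ≤ _ := by gcongr; linarith
  · refine (frobenius_norm_sq_le_gram A).trans ?_
    have h1 : ‖G‖ ≤ ‖S‖ + κ / 2 := by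
      have := norm_le_norm_add_norm_sub' G S
      linarith
    rw [hGA, norm_smul, Real.norm_of_nonneg hm'.le]
    calc (d : ℝ) * (m * ‖G‖) = d * ‖G‖ * m := by ring
      _ ≤ _ := by gcongr

theorem frobenius_norm_le_of_entries {A : Matrix (Fin d) (Fin d) ℝ} {r : ℝ} (hr : 0 ≤ r)
    (h : ∀ j k, |A j k| ≤ r) : ‖A‖ ≤ d * r := by
  refine abs_le_of_sq_le_sq' ?_ (by positivity) |>.2
  rw [frobenius_norm_sq]
  calc _ ≤ ∑ _j : Fin d, ∑ _k : Fin d, r ^ 2 :=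
        Finset.sum_le_sum fun j _ => Finset.sum_le_sum fun k _ => sq_le_sq' (abs_le.1 (h j k)).1
          (abs_le.1 (h j k)).2
    _ = _ := by simp; ring

/-- The deterministic principal components bound with a single tolerance on the error matrix. -/
theorem exists_pca_tolerance (d : ℕ) {κ C ζ : ℝ} (hκ : 0 < κ) (hC : 0 ≤ C) (hζ : 0 < ζ) :
    ∃ θ : ℝ, 0 < θ ∧ ∀ (N T : ℕ) (F Ft : Matrix (Fin T) (Fin d) ℝ) (Λ : Matrix (Fin N) (Fin d) ℝ)
      (Er : Matrix (Fin T) (Fin N) ℝ), 0 < N → 0 < T → d ≤ T →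
      (∀ c : Matrix (Fin d) Unit ℝ, κ * T * ‖c‖ ^ 2 ≤ ‖F * c‖ ^ 2) →
      (∀ c : Matrix (Fin d) Unit ℝ, κ * N * ‖c‖ ^ 2 ≤ ‖Λ * c‖ ^ 2) →
      ‖F‖ ^ 2 ≤ C * T → ‖Λ‖ ^ 2 ≤ C * N → ‖Er * Erᵀ‖ ≤ θ * (N * T) →
      IsPCAFactor (F * Λᵀ + Er) Ft →
      IsUnit (pcaV d (F * Λᵀ + Er)) ∧ IsUnit (pcaRotation Λ F Ft (pcaV d (F * Λᵀ + Er))) ∧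
      ‖(pcaRotation Λ F Ft (pcaV d (F * Λᵀ + Er)))⁻¹‖ ≤ 2 * √(d * C) ∧
      ‖Ft * (pcaRotation Λ F Ft (pcaV d (F * Λᵀ + Er)))⁻¹ - F‖ ^ 2 ≤ ζ * T := by
  set τ : ℝ → ℝ := fun θ => 2 * C * √(d * θ) + θ with hτ
  have hτc : Continuous τ := by fun_prop
  have hτ0 : τ 0 = 0 := by simp [hτ]
  have hκ2 : 0 < κ ^ 2 := by positivity
  have h1 : ∀ᶠ θ in 𝓝 (0 : ℝ), τ θ < κ ^ 2 / 2 :=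
    hτc.tendsto' _ _ hτ0 |>.eventually (gt_mem_nhds (by positivity))
  have h2 : ∀ᶠ θ in 𝓝 (0 : ℝ), 4 * (d : ℝ) ^ 2 * τ θ < κ ^ 2 :=
    (hτc.const_mul (4 * (d : ℝ) ^ 2)).tendsto' _ _ (by simp [hτ0])
      |>.eventually (gt_mem_nhds hκ2)
  have h3 : ∀ᶠ θ in 𝓝 (0 : ℝ), 16 * (d : ℝ) ^ 3 * C / κ ^ 4 * τ θ ^ 2 < ζ :=
    ((hτc.pow 2).const_mul (16 * (d : ℝ) ^ 3 * C / κ ^ 4)).tendsto' _ _ (by simp [hτ0])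
      |>.eventually (gt_mem_nhds hζ)
  obtain ⟨θ, ⟨⟨hθ1, hθ2⟩, hθ3⟩, hθ0⟩ :=
    ((((h1.and h2).and h3).filter_mono nhdsWithin_le_nhds).and
      (self_mem_nhdsWithin (s := Set.Ioi (0 : ℝ)))).exists
  refine ⟨θ, hθ0, fun N T F Ft Λ Er hN hT hdT hF hΛ hFC hΛC hE hFt => ?_⟩
  have h4 := norm_pcaMatrix_sub_commonPart_le hN hT hC (le_of_lt hθ0) hFC hΛC hE
  obtain ⟨a1, a2, a3, a4⟩ := pca_consistency hN hT hdT hκ hF hΛ hC hFC h4 hθ1.le hθ2.le hFt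
  refine ⟨a1, a2, a3, a4.trans ?_⟩
  gcongr

end Gram

/-! ### Consequences of the assumptions -/

section Assumptions

variable {Ω : Type*} {mΩ : MeasurableSpace Ω} {μ : Measure Ω} [IsProbabilityMeasure μ] {p d : ℕ}

theorem measurable_regressor :
    Measurable fun x : EuclideanSpace ℝ (Fin p) × EuclideanSpace ℝ (Fin d) =>
      regressor x.1 x.2 := by
  unfold regressor
  refine (WithLp.measurable_toLp 2 _).comp (measurable_pi_lambda _ fun i => ?_)
  rcases i with (i | i) | i
  · exact measurable_const
  · simp only [Sum.elim_inl, Sum.elim_inr]; fun_prop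
  · simp only [Sum.elim_inr]; fun_prop

theorem self_le_rpow_of_le_one {x : ℝ≥0∞} (hx : x ≤ 1) {δ : ℝ} (hδ : 0 < δ) :
    x ≤ x ^ (δ / (4 + δ)) := by
  calc x = x ^ (1 : ℝ) := (ENNReal.rpow_one x).symm
    _ ≤ _ := ENNReal.rpow_le_rpow_of_exponent_ge hx (by rw [div_le_one (by linarith)]; linarith)

theorem tendsto_mixCoeff_toReal {S : Type*} [MeasurableSpace S] {Z : ℕ → Ω → S} {δ : ℝ}
    (hδ : 0 < δ) (hmix : ∑' t : ℕ, mixCoeff μ Z Z t ^ (δ / (4 + δ)) < ∞) :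
    Tendsto (fun n => (mixCoeff μ Z Z n).toReal) atTop (𝓝 0) := by
  have h1 := ENNReal.tendsto_atTop_zero_of_tsum_ne_top hmix.ne
  have h2 : Tendsto (fun n => mixCoeff μ Z Z n) atTop (𝓝 0) :=
    tendsto_of_tendsto_of_tendsto_of_le_of_le tendsto_const_nhds h1 (fun _ => zero_le)
      fun n => self_le_rpow_of_le_one (mixCoeff_le_one Z Z n) hδ
  have h3 := (ENNReal.tendsto_toReal ENNReal.zero_ne_top).comp h2
  rwa [ENNReal.toReal_zero] at h3

/-- The pairs of the regressor and of the error of the response that it explains satisfy the law of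
large numbers, and the two components are independent. -/
theorem weaklyMixing_sample {w : ℕ → Ω → EuclideanSpace ℝ (Fin p)}
    {f : ℕ → Ω → EuclideanSpace ℝ (Fin d)} {eps : ℕ → Ω → ℝ}
    {lam : ℕ → Ω → EuclideanSpace ℝ (Fin d)} {e : ℕ → ℕ → Ω → ℝ} {δ : ℝ}
    {Sigma : Matrix (Fin d) (Fin d) ℝ} (hA : FactorAssumptions μ w f eps lam e δ Sigma)
    (hlaw : ∀ t, μ.map (eps t) = μ.map (eps 0)) (h : ℕ) :
    WeaklyMixing μ ((μ.map fun ω => regressor (w 0 ω) (f 0 ω)).prod (μ.map (eps 0)))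
      fun t ω => (regressor (w t ω) (f t ω), eps (t + h) ω) := by
  set Z : ℕ → Ω → EuclideanSpace ℝ (Fin p) × EuclideanSpace ℝ (Fin d) × ℝ :=
    fun t ω => (w t ω, f t ω, eps t ω) with hZ
  have hZm : ∀ t, Measurable (Z t) := fun t =>
    (hA.measurable_w t).prodMk ((hA.measurable_f t).prodMk (hA.measurable_eps t))
  have hzm : ∀ t, Measurable fun ω => regressor (w t ω) (f t ω) := fun t =>
    measurable_regressor.comp ((hA.measurable_w t).prodMk (hA.measurable_f t))
  have hξm : ∀ t, Measurable fun ω => (regressor (w t ω) (f t ω), eps (t + h) ω) := fun t =>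
    (hzm t).prodMk (hA.measurable_eps _)
  -- the pair at time `t` as a function of the path shifted by `t`
  set g : (ℕ → EuclideanSpace ℝ (Fin p) × EuclideanSpace ℝ (Fin d) × ℝ) →
      EuclideanSpace ℝ (Coord p d) × ℝ := fun z => (regressor (z 0).1 (z 0).2.1, (z h).2.2) with hg
  have hgm : Measurable g := by
    refine Measurable.prodMk (measurable_regressor.comp (?_ : Measurable fun z :
      ℕ → EuclideanSpace ℝ (Fin p) × EuclideanSpace ℝ (Fin d) × ℝ => ((z 0).1, (z 0).2.1))) ?_
    · fun_prop
    · fun_prop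
  have hmapg : ∀ t, μ.map (fun ω => (regressor (w t ω) (f t ω), eps (t + h) ω)) =
      (μ.map fun ω s => Z (s + t) ω).map g := by
    intro t
    rw [Measure.map_map hgm (measurable_pi_lambda _ fun s => hZm _)]
    congr 1
    ext ω
    · simp [hg]
    · simp [hg, add_comm]
  have hstat : ∀ t, μ.map (fun ω => (regressor (w t ω) (f t ω), eps (t + h) ω)) =
      μ.map (fun ω => (regressor (w 0 ω) (f 0 ω), eps (0 + h) ω)) := by
    intro t
    rw [hmapg t, hmapg 0]
    have := hA.stationary t
    simp only [hZ, add_zero]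
    rw [this]
  have hmap : ∀ t, μ.map (fun ω => (regressor (w t ω) (f t ω), eps (t + h) ω)) =
      (μ.map fun ω => regressor (w 0 ω) (f 0 ω)).prod (μ.map (eps 0)) := by
    intro t
    rw [hstat t, ← hlaw (0 + h)]
    refine (indepFun_iff_map_prod_eq_prod_map_map (hzm 0).aemeasurable
      (hA.measurable_eps _).aemeasurable).1 ?_
    have hi : Indep (sigmaOn w Set.univ ⊔ sigmaOn lam Set.univ ⊔ sigmaOn f Set.univ)
        (sigmaOn eps Set.univ) μ := hA.indep.indep (i := 0) (j := 2) (by decide)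
    refine indep_of_indep_of_le_left (indep_of_indep_of_le_right hi ?_) ?_
    · exact measurable_iff_comap_le.1 (measurable_sigmaOn eps (Set.mem_univ _))
    · rw [← measurable_iff_comap_le]
      refine measurable_regressor.comp (Measurable.prodMk ?_ ?_)
      · exact (measurable_sigmaOn w (Set.mem_univ 0)).mono
          (le_sup_left.trans le_sup_left) le_rfl
      · exact (measurable_sigmaOn f (Set.mem_univ 0)).mono le_sup_right le_rfl
  refine ⟨hξm, hmap, fun n => if n < h then 1 else (mixCoeff μ Z Z (n - h)).toReal, ?_, ?_, ?_⟩
  · intro n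
    beta_reduce
    split_ifs
    · exact zero_le_one
    · exact ENNReal.toReal_nonneg
  · refine ((tendsto_mixCoeff_toReal hA.delta_pos hA.mixing).comp (tendsto_sub_atTop_nat h)).congr'
      ?_
    filter_upwards [eventually_ge_atTop h] with n hn
    rw [if_neg (not_lt.2 hn)]
    rfl
  · intro A hAm s n
    have hν : ∀ t, μ.real ((fun ω => (regressor (w t ω) (f t ω), eps (t + h) ω)) ⁻¹' A) =
        ((μ.map fun ω => regressor (w 0 ω) (f 0 ω)).prod (μ.map (eps 0))).real A := fun t => by
      rw [← hmap t, map_measureReal_apply (hξm t) hAm]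
    have hmeas : ∀ t, MeasurableSet[sigmaOn Z (Set.Icc t (t + h))]
        ((fun ω => (regressor (w t ω) (f t ω), eps (t + h) ω)) ⁻¹' A) := by
      intro t
      have h0 : Measurable[sigmaOn Z (Set.Icc t (t + h))] (Z t) :=
        measurable_sigmaOn Z ⟨le_rfl, Nat.le_add_right t h⟩
      have h1 : Measurable[sigmaOn Z (Set.Icc t (t + h))] (Z (t + h)) :=
        measurable_sigmaOn Z ⟨Nat.le_add_right t h, le_rfl⟩
      have h2 : Measurable[sigmaOn Z (Set.Icc t (t + h))]
          (fun ω => (regressor (w t ω) (f t ω), eps (t + h) ω)) :=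
        (measurable_regressor.comp (h0.fst.prodMk h0.snd.fst)).prodMk h1.snd.snd
      exact h2 hAm
    rw [← hν s]
    nth_rw 2 [hν s]
    rw [← hν (s + n)]
    beta_reduce
    split_ifs with hn
    · exact (le_abs_self _).trans (abs_cov_sets_le_one _ _)
    · refine (le_abs_self _).trans ((abs_cov_sets_le_alphaCoeff (hmeas s) (hmeas (s + n))).trans ?_)
      refine alphaCoeff_toReal_le_mixCoeff Z Z Set.ordConnected_Icc Set.ordConnected_Icc ?_
      rintro a ⟨-, ha⟩ b ⟨hb, -⟩
      left
      omega

theorem sum_mixCoeff_zero_le {e : ℕ → ℕ → Ω → ℝ} {δ : ℝ} (hδ : 0 < δ) {C : ℝ≥0}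
    (hC : ∀ N : ℕ, ∑ i ∈ Finset.range N, ∑ j ∈ Finset.range N,
      ∑' t : ℕ, mixCoeff μ (e i) (e j) t ^ (δ / (4 + δ)) ≤ C * N) (N : ℕ) :
    ∑ i ∈ Finset.range N, ∑ j ∈ Finset.range N, (mixCoeff μ (e i) (e j) 0).toReal ≤ C * N := by
  have h1 : ∑ i ∈ Finset.range N, ∑ j ∈ Finset.range N, mixCoeff μ (e i) (e j) 0 ≤ C * N := by
    refine le_trans (Finset.sum_le_sum fun i _ => Finset.sum_le_sum fun j _ => ?_) (hC N)
    exact (self_le_rpow_of_le_one (mixCoeff_le_one _ _ _) hδ).trans (ENNReal.le_tsum 0)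
  have h2 := ENNReal.toReal_mono (ENNReal.mul_ne_top ENNReal.coe_ne_top (ENNReal.natCast_ne_top N))
    h1
  rw [ENNReal.toReal_sum fun i _ => (ENNReal.sum_ne_top.2 fun j _ => mixCoeff_ne_top _ _ _)] at h2
  simp only [ENNReal.toReal_sum fun j _ => mixCoeff_ne_top _ _ _] at h2
  simpa using h2

theorem sum_serialCoeff_le {e : ℕ → ℕ → Ω → ℝ} {δ : ℝ} (hδ : 0 < δ) {C : ℝ≥0}
    (hC : ∀ i : ℕ, ∑' t : ℕ, mixCoeff μ (e i) (e i) (t + 1) ^ (δ / (4 + δ)) ≤ C) (i n : ℕ) :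
    ∑ k ∈ Finset.range n, serialCoeff μ e i k ≤ 1 + C := by
  rcases n with _ | m
  · simp
    positivity
  rw [Finset.sum_range_succ']
  have h1 : ∑ k ∈ Finset.range m, mixCoeff μ (e i) (e i) (k + 1) ≤ C := by
    refine le_trans (Finset.sum_le_sum fun k _ =>
      self_le_rpow_of_le_one (mixCoeff_le_one _ _ _) hδ) ?_
    exact (ENNReal.sum_le_tsum _).trans (hC i)
  have h2 := ENNReal.toReal_mono ENNReal.coe_ne_top h1
  rw [ENNReal.toReal_sum fun k _ => mixCoeff_ne_top _ _ _] at h2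
  have h3 : ∀ k, serialCoeff μ e i (k + 1) = (mixCoeff μ (e i) (e i) (k + 1)).toReal := fun k => by
    simp [serialCoeff]
  simp only [h3]
  have h4 : serialCoeff μ e i 0 = 1 := by simp [serialCoeff]
  rw [h4, add_comm]
  gcongr
  simpa using h2

end Assumptions

section Consistency

variable {Ω : Type*} {mΩ : MeasurableSpace Ω} {μ : Measure Ω} [IsProbabilityMeasure μ] {p d h : ℕ}
  {w : ℕ → Ω → EuclideanSpace ℝ (Fin p)} {f : ℕ → Ω → EuclideanSpace ℝ (Fin d)}
  {eps : ℕ → Ω → ℝ} {lam : ℕ → Ω → EuclideanSpace ℝ (Fin d)} {e : ℕ → ℕ → Ω → ℝ} {δ : ℝ}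
  {Sigma : Matrix (Fin d) (Fin d) ℝ} {β : EuclideanSpace ℝ (Coord p d)} {φ Φ : ℝ → ℝ}
  {Ξl Ξu : ℕ → ℝ}

/-! ### The factor model -/

theorem FactorAssumptions.withHighProb_errorGram
    (hA : FactorAssumptions μ w f eps lam e δ Sigma) {θ : ℝ} (hθ : 0 < θ) :
    WithHighProb μ atTop fun (q : ℕ × ℕ) ω => ‖panelMatrix q.1 q.2 (fun i t => e i t ω) *
      (panelMatrix q.1 q.2 fun i t => e i t ω)ᵀ‖ ≤ θ * ((q.1 : ℝ) * q.2) := by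
  obtain ⟨C, hC⟩ := hA.mixing_e
  obtain ⟨D, hD⟩ := hA.mixing_e_diag
  obtain ⟨M, hM⟩ := hA.moment_e
  have h4 : ∀ i t, Integrable (fun ω => e i t ω ^ 4) μ ∧ ∫ ω, e i t ω ^ 4 ∂μ ≤ 1 + M := by
    intro i t
    have := integrable_norm_pow_four (hA.measurable_e i t).aestronglyMeasurable hA.delta_pos
      (hM i t)
    simpa only [Real.norm_eq_abs, (show Even 4 by decide).pow_abs] using this
  have := tendsto_measure_norm_errorGram hA.measurable_e (sum_mixCoeff_zero_le hA.delta_pos hC)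
    (sum_serialCoeff_le hA.delta_pos hD) (fun i t => (h4 i t).1) (fun i t => (h4 i t).2)
    hA.mean_e hθ
  unfold WithHighProb
  simpa only [not_le] using this

omit [IsProbabilityMeasure μ] in
theorem FactorAssumptions.withHighProb_loadings
    (hA : FactorAssumptions μ w f eps lam e δ Sigma) {r : ℝ} (hr : 0 < r) :
    WithHighProb μ atTop fun (N : ℕ) ω => ‖(N : ℝ)⁻¹ • ((loadingMatrix N fun i => lam i ω)ᵀ *
      loadingMatrix N fun i => lam i ω) - Sigma‖ ≤ r := by
  refine ENNReal.tendsto_nhds_zero.2 fun ε hε => ?_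
  by_cases hε' : ε = ∞
  · simp [hε']
  obtain ⟨K, hK⟩ := hA.loadings ε.toReal (ENNReal.toReal_pos hε.ne' hε')
  have hlim : Tendsto (fun N : ℕ => K * (1 / √(N : ℝ))) atTop (𝓝 0) := by
    have h1 : Tendsto (fun N : ℕ => √(N : ℝ)) atTop atTop :=
      Real.tendsto_sqrt_atTop.comp tendsto_natCast_atTop_atTop
    simpa using h1.inv_tendsto_atTop.const_mul K
  filter_upwards [hK, hlim.eventually (gt_mem_nhds hr)] with N hN hNr
  rw [ENNReal.ofReal_toReal hε'] at hN
  refine (measure_mono fun ω hω => ?_).trans hN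
  rw [Set.mem_ofPred_eq, not_le] at hω
  exact hNr.trans (hω.trans_le (le_abs_self _))

/-- The matrix `E[f fᵀ]`. -/
noncomputable def factorSecondMoment (μ : Measure Ω) (f : ℕ → Ω → EuclideanSpace ℝ (Fin d)) :
    Matrix (Fin d) (Fin d) ℝ :=
  Matrix.of fun j k => ∫ ω, f 0 ω j * f 0 ω k ∂μ

theorem FactorAssumptions.integrable_factor_mul
    (hA : FactorAssumptions μ w f eps lam e δ Sigma) (j k : Fin d) :
    Integrable (fun ω => f 0 ω j * f 0 ω k) μ := by
  obtain ⟨M, hM⟩ := hA.moment_f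
  have h4 := (integrable_norm_pow_four (hA.measurable_f 0).aestronglyMeasurable hA.delta_pos
    (hM 0)).1
  have h2 := (integrable_norm_sq_of_pow_four (hA.measurable_f 0).aestronglyMeasurable h4).1
  have hm := hA.measurable_f 0
  refine h2.mono' (by fun_prop) (ae_of_all _ fun ω => ?_)
  rw [norm_mul, sq]
  exact mul_le_mul (PiLp.norm_apply_le _ j) (PiLp.norm_apply_le _ k) (norm_nonneg _)
    (norm_nonneg _)

theorem FactorAssumptions.withHighProb_factors
    (hA : FactorAssumptions μ w f eps lam e δ Sigma)
    (hlaw : ∀ t, μ.map (eps t) = μ.map (eps 0)) {r : ℝ} (hr : 0 < r) :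
    WithHighProb μ atTop fun (T : ℕ) ω => ‖(T : ℝ)⁻¹ • ((factorMatrix T fun t => f t ω)ᵀ *
      factorMatrix T fun t => f t ω) - factorSecondMoment μ f‖ ≤ r := by
  have hξ := weaklyMixing_sample hA hlaw 0
  set g : Fin d → Fin d → EuclideanSpace ℝ (Coord p d) × ℝ → ℝ := fun j k s =>
    s.1 (Sum.inr j) * s.1 (Sum.inr k) with hg
  have hgm : ∀ j k, Measurable (g j k) := fun j k => by fun_prop
  have hgi : ∀ j k, Integrable (g j k)
      ((μ.map fun ω => regressor (w 0 ω) (f 0 ω)).prod (μ.map (eps 0))) := fun j k => by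
    rw [← hξ.map_eq 0, integrable_map_measure (hgm j k).aestronglyMeasurable
      (hξ.measurable 0).aemeasurable]
    exact hA.integrable_factor_mul j k
  have hr' : 0 < r / (d + 1) := by positivity
  have h1 : WithHighProb μ atTop fun (T : ℕ) ω => ∀ jk : Fin d × Fin d,
      ¬ r / (d + 1) ≤ |timeAverage (fun t ω => (regressor (w t ω) (f t ω), eps (t + 0) ω))
        (g jk.1 jk.2) T ω - ∫ s, g jk.1 jk.2 s ∂
          ((μ.map fun ω => regressor (w 0 ω) (f 0 ω)).prod (μ.map (eps 0)))| := by
    refine WithHighProb.forall_fintype fun jk => ?_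
    have := hξ.tendsto_measure (hgi jk.1 jk.2) hr'
    unfold WithHighProb
    simpa only [not_not] using this
  refine h1.mono (Eventually.of_forall fun T ω hω => ?_)
  refine (frobenius_norm_le_of_entries hr'.le fun j k => ?_).trans ?_
  · have h2 := (not_le.1 (hω (j, k))).le
    rw [← hξ.integral_comp 0 (hgm j k).aestronglyMeasurable] at h2
    refine le_of_eq_of_le ?_ h2
    simp only [timeAverage, factorSecondMoment, factorMatrix, Matrix.sub_apply, Matrix.smul_apply,
      Matrix.mul_apply, Matrix.transpose_apply, Matrix.of_apply, smul_eq_mul, hg]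
    rw [← Fin.sum_univ_eq_sum_range (fun t => (regressor (w t ω) (f t ω)) (Sum.inr j) *
      (regressor (w t ω) (f t ω)) (Sum.inr k))]
    rfl
  · rw [mul_div_assoc', div_le_iff₀ (by positivity)]
    nlinarith

theorem FactorAssumptions.factorSecondMoment_pos
    (hA : FactorAssumptions μ w f eps lam e δ Sigma)
    (hz : ∀ v : EuclideanSpace ℝ (Coord p d),
      (∀ᵐ ω ∂μ, inner ℝ v (regressor (w 0 ω) (f 0 ω)) = 0) → v = 0)
    {c : Matrix (Fin d) Unit ℝ} (hc : c ≠ 0) : 0 < (cᵀ * factorSecondMoment μ f * c) () () := by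
  set v : EuclideanSpace ℝ (Coord p d) :=
    WithLp.toLp 2 (Sum.elim (fun _ => 0) fun j => c j ()) with hv
  have hin : ∀ ω, inner ℝ v (regressor (w 0 ω) (f 0 ω)) = ∑ j, c j () * f 0 ω j := by
    intro ω
    simp [hv, regressor, PiLp.inner_apply, mul_comm]
  have hsq : ∀ ω, inner ℝ v (regressor (w 0 ω) (f 0 ω)) ^ 2 =
      ∑ k, ∑ j, c j () * c k () * (f 0 ω j * f 0 ω k) := by
    intro ω
    rw [hin, sq, Finset.sum_mul_sum, Finset.sum_comm]
    exact Finset.sum_congr rfl fun _ _ => Finset.sum_congr rfl fun _ _ => by ring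
  have hi : ∀ j k, Integrable (fun ω => c j () * c k () * (f 0 ω j * f 0 ω k)) μ := fun j k =>
    (hA.integrable_factor_mul j k).const_mul _
  have hform : (cᵀ * factorSecondMoment μ f * c) () () =
      ∫ ω, inner ℝ v (regressor (w 0 ω) (f 0 ω)) ^ 2 ∂μ := by
    simp only [hsq]
    rw [integral_finsetSum _ fun k _ => integrable_finsetSum _ fun j _ => hi j k]
    simp only [integral_finsetSum _ fun j _ => hi j _, Matrix.mul_apply, Matrix.transpose_apply,
      factorSecondMoment, Matrix.of_apply, integral_const_mul, Finset.sum_mul]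
    exact Finset.sum_congr rfl fun _ _ => Finset.sum_congr rfl fun _ _ => by ring
  have hint : Integrable (fun ω => inner ℝ v (regressor (w 0 ω) (f 0 ω)) ^ 2) μ := by
    simp only [hsq]
    exact integrable_finsetSum _ fun k _ => integrable_finsetSum _ fun j _ => hi j k
  rw [hform]
  refine (integral_nonneg fun ω => sq_nonneg _).lt_of_ne' fun h0 => hc ?_
  have h1 := (integral_eq_zero_iff_of_nonneg (fun ω => sq_nonneg _) hint).1 h0
  have h2 : v = 0 := hz v (h1.mono fun ω hω => by simpa using hω)
  ext j k
  have := congrArg (fun x : EuclideanSpace ℝ (Coord p d) => x (Sum.inr j)) h2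
  simpa [hv] using this

/-- With probability tending to one, the estimated factors, rotated back, are close to the factors
in mean square, and the rotations are invertible with bounded inverses. -/
theorem FactorAssumptions.exists_withHighProb_pca
    (hA : FactorAssumptions μ w f eps lam e δ Sigma)
    (hlaw : ∀ t, μ.map (eps t) = μ.map (eps 0))
    (hz : ∀ v : EuclideanSpace ℝ (Coord p d),
      (∀ᵐ ω ∂μ, inner ℝ v (regressor (w 0 ω) (f 0 ω)) = 0) → v = 0)
    {X : (N T : ℕ) → Ω → Matrix (Fin T) (Fin N) ℝ}
    (hX : ∀ N T ω, X N T ω = predictorMatrix N T (fun t => f t ω) (fun i => lam i ω)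
      (fun i t => e i t ω))
    {Ft : (N T : ℕ) → Ω → Matrix (Fin T) (Fin d) ℝ}
    (hFt : ∀ N T ω, d ≤ T → IsPCAFactor (X N T ω) (Ft N T ω))
    {H : (N T : ℕ) → Ω → Matrix (Fin d) (Fin d) ℝ}
    (hH : ∀ N T ω, H N T ω = pcaRotation (loadingMatrix N fun i => lam i ω)
      (factorMatrix T fun t => f t ω) (Ft N T ω) (pcaV d (X N T ω))) :
    ∃ B : ℝ, ∀ ζ : ℝ, 0 < ζ → WithHighProb μ atTop fun (q : ℕ × ℕ) ω =>
      IsUnit (pcaV d (X q.1 q.2 ω)) ∧ IsUnit (H q.1 q.2 ω) ∧ ‖(H q.1 q.2 ω)⁻¹‖ ≤ B ∧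
      ‖Ft q.1 q.2 ω * (H q.1 q.2 ω)⁻¹ - factorMatrix q.2 fun t => f t ω‖ ^ 2 ≤ ζ * q.2 := by
  obtain ⟨κ₁, r₁, C₁, hκ₁, hr₁, hC₁, hF⟩ := exists_gram_bounds (factorSecondMoment μ f)
    fun c hc => hA.factorSecondMoment_pos hz hc
  obtain ⟨κ₂, r₂, C₂, hκ₂, hr₂, hC₂, hL⟩ := exists_gram_bounds Sigma fun c hc => by
    have h1 : (fun j => c j ()) ≠ 0 := fun h0 => hc (by ext j k; exact congrFun h0 j)
    have h2 := hA.sigma_posDef.dotProduct_mulVec_pos h1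
    simp only [star_trivial, dotProduct, Matrix.mulVec] at h2
    rw [Matrix.mul_assoc]
    simpa [Matrix.mul_apply] using h2
  refine ⟨2 * √(d * max C₁ C₂), fun ζ hζ => ?_⟩
  obtain ⟨θ, hθ, hpca⟩ := exists_pca_tolerance d (lt_min hκ₁ hκ₂) (le_max_of_le_left hC₁) hζ
  have e1 := (hA.withHighProb_factors hlaw hr₁).comp
    (tendsto_snd (f := (atTop : Filter ℕ)) (g := (atTop : Filter ℕ)))
  have e2 := (hA.withHighProb_loadings hr₂).comp
    (tendsto_fst (f := (atTop : Filter ℕ)) (g := (atTop : Filter ℕ)))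
  rw [prod_atTop_atTop_eq] at e1 e2
  refine ((e1.and e2).and (hA.withHighProb_errorGram hθ)).mono ?_
  filter_upwards [eventually_ge_atTop ((1, max 1 d) : ℕ × ℕ)] with ⟨N, T⟩ hNT ω ⟨⟨hω1, hω2⟩, hω3⟩
  have hN : 0 < N := hNT.1
  have hT : 0 < T := (le_max_left 1 d).trans hNT.2
  have hdT : d ≤ T := (le_max_right 1 d).trans hNT.2
  obtain ⟨f1, f2⟩ := hF T _ hT hω1
  obtain ⟨l1, l2⟩ := hL N _ hN hω2
  have hFt' := hFt N T ω hdT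
  have hH' := hH N T ω
  have hX' : X N T ω = factorMatrix T (fun t => f t ω) * (loadingMatrix N fun i => lam i ω)ᵀ +
    panelMatrix N T fun i t => e i t ω := hX N T ω
  rw [hX'] at hFt' hH'
  dsimp only
  rw [hX', hH']
  refine hpca N T _ _ _ _ hN hT hdT (fun c => le_trans ?_ (f1 c)) (fun c => le_trans ?_ (l1 c))
    (f2.trans ?_) (l2.trans ?_) hω3 hFt'
  · gcongr; exact min_le_left _ _
  · gcongr; exact min_le_right _ _
  · gcongr; exact le_max_left _ _
  · gcongr; exact le_max_right _ _

/-! ### The response equation -/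

theorem LikelihoodAssumptions.eq_cdf (hB : LikelihoodAssumptions μ h β w f eps φ Φ Ξl Ξu)
    (hm : Measurable (eps 0)) : Φ = ProbabilityTheory.cdf (μ.map (eps 0)) := by
  have : IsProbabilityMeasure (μ.map (eps 0)) := Measure.isProbabilityMeasure_map hm.aemeasurable
  ext x
  rw [cdf_eq_real, map_measureReal_apply hm measurableSet_Iic, hB.cdf 0 x]
  rfl

theorem LikelihoodAssumptions.continuous_cdf
    (hB : LikelihoodAssumptions μ h β w f eps φ Φ Ξl Ξu) (hm : Measurable (eps 0)) :
    Continuous Φ := by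
  have : IsProbabilityMeasure (μ.map (eps 0)) := Measure.isProbabilityMeasure_map hm.aemeasurable
  have : NullSingletonClass (μ.map (eps 0)) := by
    rw [hB.pdf 0]
    infer_instance
  rw [hB.eq_cdf hm]
  exact _root_.continuous_cdf _

/-- Since the logarithms of `Φ` and `1 - Φ` are assumed smooth on the whole line, the errors have
full support. -/
theorem LikelihoodAssumptions.cdf_mem_Ioo (hB : LikelihoodAssumptions μ h β w f eps φ Φ Ξl Ξu)
    (hm : Measurable (eps 0)) (x : ℝ) : 0 < Φ x ∧ Φ x < 1 := by
  have hc := hB.continuous_cdf hm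
  have h01 : ∀ x, 0 ≤ Φ x ∧ Φ x ≤ 1 := fun x => by
    rw [hB.cdf 0 x]
    exact ⟨measureReal_nonneg, measureReal_le_one⟩
  obtain ⟨h1, h2, h3⟩ := hB.cdf_Ξ 0
  constructor
  · refine pos_of_continuous_log hc (fun x => (h01 x).1) ?_ h1 x
    exact (hB.logLik_smooth 1 (Or.inr rfl)).continuous.congr fun x => by simp [logLik]
  · rw [← sub_pos]
    refine pos_of_continuous_log (g := fun x => 1 - Φ x) (by fun_prop)
      (fun x => sub_nonneg.2 (h01 x).2) ?_ (sub_pos.2 h3) x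
    exact (hB.logLik_smooth 0 (Or.inl rfl)).continuous.congr fun x => by simp [logLik]

theorem LikelihoodAssumptions.ae_mem (hB : LikelihoodAssumptions μ h β w f eps φ Φ Ξl Ξu)
    (hw : Measurable (w 0)) (hf : Measurable (f 0)) :
    ∀ᵐ ω ∂μ, ∃ T, inner ℝ β (regressor (w 0 ω) (f 0 ω)) ∈ Set.Icc (Ξl T) (Ξu T) := by
  have hz : Measurable fun ω => regressor (w 0 ω) (f 0 ω) :=
    measurable_regressor.comp (hw.prodMk hf)
  have hms : MeasurableSet
      {ω | ∃ T, inner ℝ β (regressor (w 0 ω) (f 0 ω)) ∈ Set.Icc (Ξl T) (Ξu T)} := by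
    simp only [Set.ofPred_exists]
    exact MeasurableSet.iUnion fun T =>
      (measurableSet_Icc (a := Ξl T) (b := Ξu T)).preimage (by fun_prop)
  refine (prob_compl_eq_zero_iff hms).2 (le_antisymm prob_le_one ?_)
  refine le_of_tendsto hB.support ?_
  filter_upwards [eventually_gt_atTop h] with T hT
  exact measure_mono fun ω hω => ⟨T, hω 0 (by simpa using hT)⟩

theorem LikelihoodAssumptions.eq_of_cdf_eq
    (hB : LikelihoodAssumptions μ h β w f eps φ Φ Ξl Ξu) (hm : Measurable (eps 0)) {x x₀ : ℝ}
    {T : ℕ} (hx₀ : x₀ ∈ Set.Icc (Ξl T) (Ξu T)) (hx : Φ x = Φ x₀) : x = x₀ := by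
  obtain ⟨bL, bU, hbL, -, hcurv⟩ := hB.curvature
  have hmono : Monotone Φ := by
    rw [hB.eq_cdf hm]
    exact monotone_cdf _
  refine eq_of_constant_between
    ((hB.logLik_smooth 1 (Or.inr rfl)).of_le (by norm_num)) ?_ (fun y hy => ?_)
  · have := (hcurv 1 (Or.inr rfl)).1 T x₀ hx₀
    intro h0
    rw [h0] at this
    linarith
  · have hy' : Φ y = Φ x₀ := by
      rcases le_total x₀ x with hle | hle
      · rw [Set.uIcc_of_le hle] at hy
        exact le_antisymm ((hmono hy.2).trans_eq hx) (hmono hy.1)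
      · rw [Set.uIcc_of_ge hle] at hy
        exact le_antisymm (hmono hy.2) (hx.symm.trans_le (hmono hy.1))
    simp [logLik, hy']

theorem LikelihoodAssumptions.withHighProb_support
    (hB : LikelihoodAssumptions μ h β w f eps φ Φ Ξl Ξu)
    (hw : ∀ t, Measurable (w t)) (hf : ∀ t, Measurable (f t)) :
    WithHighProb μ atTop fun (T : ℕ) ω => ∀ t : ℕ, t + h < T →
      inner ℝ β (regressor (w t ω) (f t ω)) ∈ Set.Icc (Ξl T) (Ξu T) := by
  have hms : ∀ T : ℕ, MeasurableSet {ω | ∀ t : ℕ, t + h < T →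
      inner ℝ β (regressor (w t ω) (f t ω)) ∈ Set.Icc (Ξl T) (Ξu T)} := by
    intro T
    simp only [Set.ofPred_forall]
    refine MeasurableSet.iInter fun t => MeasurableSet.iInter fun _ => ?_
    have hz : Measurable fun ω => regressor (w t ω) (f t ω) :=
      measurable_regressor.comp ((hw t).prodMk (hf t))
    exact (measurableSet_Icc (a := Ξl T) (b := Ξu T)).preimage (by fun_prop)
  have h1 := ENNReal.Tendsto.sub tendsto_const_nhds hB.support
    (Or.inl ENNReal.one_ne_top) (a := 1)
  rw [tsub_self] at h1
  exact h1.congr fun T => (prob_compl_eq_one_sub (hms T)).symm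

/-- With probability tending to one, the likelihood separates the true coefficients from the
coefficients at distance at least `η`, uniformly over perturbations of the regressors. -/
theorem LikelihoodAssumptions.uniformlyWorse
    (hA : FactorAssumptions μ w f eps lam e δ Sigma)
    (hB : LikelihoodAssumptions μ h β w f eps φ Φ Ξl Ξu)
    (hz : ∀ v : EuclideanSpace ℝ (Coord p d),
      (∀ᵐ ω ∂μ, inner ℝ v (regressor (w 0 ω) (f 0 ω)) = 0) → v = 0) {η : ℝ} (hη : 0 < η) :
    UniformlyWorse μ (fun t ω => (regressor (w t ω) (f t ω), eps (t + h) ω)) Φ β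
      {γ | η ≤ ‖γ - β‖} := by
  have hm := hA.measurable_eps 0
  have hzm : Measurable fun ω => regressor (w 0 ω) (f 0 ω) :=
    measurable_regressor.comp ((hA.measurable_w 0).prodMk (hA.measurable_f 0))
  have hQ : IsProbabilityMeasure (μ.map (eps 0)) :=
    Measure.isProbabilityMeasure_map hm.aemeasurable
  have hP : IsProbabilityMeasure (μ.map fun ω => regressor (w 0 ω) (f 0 ω)) :=
    Measure.isProbabilityMeasure_map hzm.aemeasurable
  have hc := hB.continuous_cdf hm
  have h01 := hB.cdf_mem_Ioo hm
  have hinj := fun x x₀ T => hB.eq_of_cdf_eq (x := x) (x₀ := x₀) (T := T) hm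
  have hξ := weaklyMixing_sample hA (fun t => (hB.pdf t).trans (hB.pdf 0).symm) h
  rw [hB.eq_cdf hm] at hc h01 hinj ⊢
  refine UniformlyWorse.compl_ball hξ h01 hc (fun γ hγ hae => hγ ?_) (fun v hv hae => hv ?_) hη
  · have h1 := ae_of_ae_map hzm.aemeasurable hae
    refine sub_eq_zero.1 (hz _ ?_)
    filter_upwards [h1, hB.ae_mem (hA.measurable_w 0) (hA.measurable_f 0)] with ω hω ⟨T, hT⟩
    rw [inner_sub_left, hinj _ _ T hT hω, sub_self]
  · exact hz v (ae_of_ae_map hzm.aemeasurable hae)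

/-- With probability tending to one, maximum likelihood estimators exist and all lie within any
given distance of the rotated coefficients. -/
theorem LikelihoodAssumptions.withHighProb_mle
    (hA : FactorAssumptions μ w f eps lam e δ Sigma)
    (hB : LikelihoodAssumptions μ h β w f eps φ Φ Ξl Ξu)
    (hz : ∀ v : EuclideanSpace ℝ (Coord p d),
      (∀ᵐ ω ∂μ, inner ℝ v (regressor (w 0 ω) (f 0 ω)) = 0) → v = 0)
    {y : ℕ → Ω → ℝ}
    (hy : ∀ t ω, y (t + h) ω = response β (regressor (w t ω) (f t ω)) (eps (t + h) ω))
    {Ft : (N T : ℕ) → Ω → Matrix (Fin T) (Fin d) ℝ}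
    {H : (N T : ℕ) → Ω → Matrix (Fin d) (Fin d) ℝ} {B : ℝ}
    (hpca : ∀ ζ : ℝ, 0 < ζ → WithHighProb μ atTop fun (q : ℕ × ℕ) ω =>
      IsUnit (H q.1 q.2 ω) ∧ ‖(H q.1 q.2 ω)⁻¹‖ ≤ B ∧
      ‖Ft q.1 q.2 ω * (H q.1 q.2 ω)⁻¹ - factorMatrix q.2 fun t => f t ω‖ ^ 2 ≤ ζ * q.2)
    {ε : ℝ} (hε : 0 < ε) :
    WithHighProb μ atTop fun (q : ℕ × ℕ) ω =>
      (∃ b, IsMLE h q.2 Φ (fun t => y t ω) (fun t => w t ω) (Ft q.1 q.2 ω) b) ∧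
      ∀ b, IsMLE h q.2 Φ (fun t => y t ω) (fun t => w t ω) (Ft q.1 q.2 ω) b →
        ‖b - WithLp.toLp 2 (rotationExt p (H q.1 q.2 ω) *ᵥ β.ofLp)‖ < ε := by
  obtain ⟨M, hM⟩ := hB.logLik_deriv_bdd
  obtain ⟨bL, bU, hbL, hbU, hcurv⟩ := hB.curvature
  -- distances grow at most by the factor `√(1 + p + B²)` under the rotation
  set R := √(1 + p + B ^ 2) with hR
  have hR0 : 0 < R := Real.sqrt_pos.2 (by positivity)
  have hη : 0 < ε / (2 * R) := by positivity
  obtain ⟨κ, C, hκ, hC, hsep⟩ := hB.uniformlyWorse hA hz hη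
  set K := 16 * (2 * (|M| * ‖β‖) ^ 2 / κ + bU / 2 * ‖β‖ ^ 2) with hK
  have hbU0 : 0 ≤ bU := (hbL.trans hbU).le
  have hK0 : 0 ≤ K := by positivity
  have hζ : 0 < κ / (4 * C + K + 1) := by positivity
  set ζ := κ / (4 * C + K + 1) with hζdef
  have hζκ : ζ * (4 * C + K + 1) = κ := div_mul_cancel₀ _ (by positivity)
  have hsep' : WithHighProb μ atTop fun (T : ℕ) ω => ∀ γ, ε / (2 * R) ≤ ‖γ - β‖ →
      ∀ u : ℕ → EuclideanSpace ℝ (Coord p d), ∑ t ∈ Finset.range (T - h),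
        logRatio Φ β (regressor (w t ω) (f t ω), eps (t + h) ω) γ (u t) ≤
        -κ * (T - h : ℕ) + C * ∑ t ∈ Finset.range (T - h), ‖u t‖ ^ 2 := by
    have := hsep.comp (tendsto_sub_atTop_nat h)
    unfold WithHighProb
    simpa only [not_forall, not_le, exists_prop, Function.comp_def, Set.mem_ofPred_eq] using this
  have e1 := (hsep'.and (hB.withHighProb_support hA.measurable_w hA.measurable_f)).comp
    (tendsto_snd (f := (atTop : Filter ℕ)) (g := (atTop : Filter ℕ)))
  rw [prod_atTop_atTop_eq] at e1
  refine (e1.and (hpca ζ hζ)).mono ?_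
  filter_upwards [eventually_ge_atTop ((0, 2 * h + 1) : ℕ × ℕ)] with ⟨N, T⟩ hNT ω hω
  obtain ⟨⟨hs, hsupp⟩, hHu, hHB, hFH⟩ := hω
  obtain ⟨a1, a2⟩ := mle_close_of_separation (eps := fun t => eps t ω) (y := fun t => y t ω)
    (fun t => hy t ω)
    (fun y hy => (hB.logLik_smooth y hy).of_le (by norm_num)) (Ξ := Set.Icc (Ξl T) (Ξu T))
    (M := |M|) (fun y hy x hx => by
      have := hM y hy T x hx 1 (by simp)
      rw [iteratedDeriv_one] at this
      exact this.trans (le_abs_self M))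
    (fun y hy => (hcurv y hy).2) (abs_nonneg M) hbU0 hsupp (show 2 * h < T from hNT.2) hκ hC hη
    hs hHu hHB hFH hζ.le (by nlinarith) (by rw [← hK]; nlinarith)
  refine ⟨a1, fun b hb => (a2 b hb).trans_lt ?_⟩
  rw [← hR, mul_div_assoc', div_lt_iff₀ (by positivity)]
  nlinarith

end Consistency

theorem theorem1 {Ω : Type*} [MeasurableSpace Ω] (μ : Measure Ω) [IsProbabilityMeasure μ]
    (p d h : ℕ)
    -- the regressors, the factors, the response errors, the loadings and the panel errors
    (w : ℕ → Ω → EuclideanSpace ℝ (Fin p)) (f : ℕ → Ω → EuclideanSpace ℝ (Fin d))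
    (eps : ℕ → Ω → ℝ) (lam : ℕ → Ω → EuclideanSpace ℝ (Fin d)) (e : ℕ → ℕ → Ω → ℝ)
    (δ : ℝ) (Sigma : Matrix (Fin d) (Fin d) ℝ)
    (hA1 : FactorAssumptions μ w f eps lam e δ Sigma)
    -- the true coefficients
    (β : EuclideanSpace ℝ (Coord p d)) (φ Φ : ℝ → ℝ) (Ξl Ξu : ℕ → ℝ)
    (hA2 : LikelihoodAssumptions μ h β w f eps φ Φ Ξl Ξu)
    -- the regressors `(1, w, f)` are not collinear
    (hz : ∀ v : EuclideanSpace ℝ (Coord p d),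
      (∀ᵐ ω ∂μ, inner ℝ v (regressor (w 0 ω) (f 0 ω)) = 0) → v = 0)
    -- the responses and the predictors
    (y : ℕ → Ω → ℝ)
    (hy : ∀ t ω, y (t + h) ω = response β (regressor (w t ω) (f t ω)) (eps (t + h) ω))
    (X : (N T : ℕ) → Ω → Matrix (Fin T) (Fin N) ℝ)
    (hX : ∀ N T ω, X N T ω = predictorMatrix N T (fun t => f t ω) (fun i => lam i ω)
      (fun i t => e i t ω))
    -- the estimated factors (any choice of eigenvectors)
    (Ft : (N T : ℕ) → Ω → Matrix (Fin T) (Fin d) ℝ)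
    (hFt : ∀ N T ω, d ≤ T → IsPCAFactor (X N T ω) (Ft N T ω))
    -- the maximum likelihood estimator (any choice of maximizer, whenever there is one)
    (βhat : (N T : ℕ) → Ω → EuclideanSpace ℝ (Coord p d))
    (hβhat : ∀ N T ω,
      (∃ b, IsMLE h T Φ (fun t => y t ω) (fun t => w t ω) (Ft N T ω) b) →
      IsMLE h T Φ (fun t => y t ω) (fun t => w t ω) (Ft N T ω) (βhat N T ω))
    -- the rotation
    (H : (N T : ℕ) → Ω → Matrix (Fin d) (Fin d) ℝ)
    (hH : ∀ N T ω, H N T ω = pcaRotation (loadingMatrix N fun i => lam i ω)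
      (factorMatrix T fun t => f t ω) (Ft N T ω) (pcaV d (X N T ω))) :
    -- as `N, T → ∞`, `V` and `H` are invertible with probability approaching one,
    Tendsto (fun q : ℕ × ℕ =>
      μ {ω | ¬ (IsUnit (pcaV d (X q.1 q.2 ω)) ∧ IsUnit (H q.1 q.2 ω))}) atTop (𝓝 0) ∧
    -- the estimator exists with probability approaching one,
    Tendsto (fun q : ℕ × ℕ =>
      μ {ω | ¬ ∃ b, IsMLE h q.2 Φ (fun t => y t ω) (fun t => w t ω) (Ft q.1 q.2 ω) b})
      atTop (𝓝 0) ∧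
    -- and it is consistent for `diag(I, H⁻¹) β`
    TendstoInMeasure μ (fun (q : ℕ × ℕ) ω =>
      ‖βhat q.1 q.2 ω - WithLp.toLp 2 ((rotationExt p (H q.1 q.2 ω)) *ᵥ β.ofLp)‖)
      atTop (fun _ => 0) := by
  have hlaw : ∀ t, μ.map (eps t) = μ.map (eps 0) := fun t => (hA2.pdf t).trans (hA2.pdf 0).symm
  obtain ⟨B, hpca⟩ := hA1.exists_withHighProb_pca hlaw hz hX hFt hH
  have hmle := fun (ε : ℝ) (hε : 0 < ε) => hA2.withHighProb_mle hA1 hz hy (fun ζ hζ =>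
    (hpca ζ hζ).mono (Eventually.of_forall fun q ω hω => hω.2)) hε
  refine ⟨?_, ?_, ?_⟩
  · exact (hpca 1 one_pos).mono (Eventually.of_forall fun q ω hω => ⟨hω.1, hω.2.1⟩)
  · exact (hmle 1 one_pos).mono (Eventually.of_forall fun q ω hω => hω.1)
  · rw [tendstoInMeasure_iff_norm]
    intro ε hε
    have h1 := (hmle ε hε).mono (B := fun (q : ℕ × ℕ) ω => ¬ ε ≤
      ‖‖βhat q.1 q.2 ω - WithLp.toLp 2 ((rotationExt p (H q.1 q.2 ω)) *ᵥ β.ofLp)‖ - 0‖)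
      (Eventually.of_forall fun q ω hω => by
        rw [sub_zero, norm_norm, not_le]
        exact hω.2 _ (hβhat q.1 q.2 ω hω.1))
    unfold WithHighProb at h1
    simpa only [not_not] using h1
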